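/- Let $\alpha=e^{i\pi/4}$, $S=\mathrm{diag}(1,i)$. For $s\in\{0,\dots,7\}$, $a\in\{0,1\}^n$, $b\in\{0,\dots,3\}^n$ consider the operators $\alpha^s X(a)S(b)=\alpha^s\,X^{a_1}S^{b_1}\otimes\cdots\otimes X^{a_n}S^{b_n}$ on $n$ qubits. A nonzero $n$-qubit vector $|\psi\rangle$ is an *XS-stabilizer state* if there are finitely many such operators $g_1,\dots,g_m$ such that, up to scalars, $|\psi\rangle$ is the only nonzero vector fixed by the group $G=\langle g_1,\dots,g_m\rangle$. The group $G$ is *regular* if every element of $G$ of the form $\alpha^sS(b)$ is of the form $\alpha^{s'}Z(c)$, where $Z(c)=Z^{c_1}\otimes\cdots\otimes Z^{c_n}$, $c\in\{0,1\}^n$. A *Pauli stabilizer state* is a nonzero vector that is, up to scalars, the only nonzero vector fixed by finitely many Pauli operators $i^sX(a)Z(c)$, $s\in\{0,\dots,3\}$, $a,c\in\{0,1\}^n$. For a bipartition $(A,B)$ of the qubits (a set $A$ and its complement $B$, possibly empty) let $\rho_A=\mathrm{Tr}_B|\psi\rangle\langle\psi|/\langle\psi|\psi\rangle$. **Theorem.**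 1. For every XS-stabilizer state $|\psi\rangle$ and every bipartition $(A,B)$ of its qubits there are a Pauli stabilizer state $|\phi_{A,B}\rangle$ and diagonal unitary operators $D_A$, $D_B$, acting on the qubits in $A$ and in $B$ respectively, such that $|\psi\rangle=(D_A\otimes D_B)|\phi_{A,B}\rangle$. 2. There is a deterministic algorithm that, given $n$, $m$, a bipartition $(A,B)$ of $n$ qubits and the exponents $(s_j,a_j,b_j)$ of generators $g_1,\dots,g_m$ of a regular group $G$ that uniquely stabilizes a state $|\psi\rangle$, computes in time polynomial in $n+m$ a description of a Pauli stabilizer state $|\phi_{A,B}\rangle$ as in 1, namely the exponents of $n$ Pauli operators that uniquely stabilize it. 3. There is a deterministic algorithm that, on the same input, computes in time polynomial in $n+m$ the von Neumann entanglement entropy $-\mathrm{Tr}(\rho_A\log_2\rho_A)$ of $|\psi\rangle$ with respect to $(A,B)$, which is a non-negative integer. 4. For every XS-stabilizer state $|\psi\rangle$ and every set $A$ of its qubits, the reduced density operator $\rho_A$ is proportional to an orthogonal projector: $\rho_A=rP$ with $r>0$ and $P=P^\dagger=P^2$. That is, all nonzero eigenvalues of $\rho_A$ coincide. Running time is the number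 of elementary steps of a random access machine on natural numbers with addition, truncated subtraction, memory access, branching and loops. -/

import Mathlib

/-! ### Qubits and operators -/

/-- Computational basis labels of `n` qubits. -/
abbrev Bits (n : ℕ) : Type := Fin n → ZMod 2

/-- (Not necessarily normalized) vectors of the `n`-qubit Hilbert space, by their amplitudes. -/
abbrev QVec (n : ℕ) : Type := Bits n → ℂ

/-- Operators on `n` qubits, as matrices in the computational basis. -/
abbrev QOp (n : ℕ) : Type := Matrix (Bits n) (Bits n) ℂ

/-- The tensor product `M 0 ⊗ ⋯ ⊗ M (n-1)` of single-qubit operators. -/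
def tensorOp {n : ℕ} (M : Fin n → Matrix (ZMod 2) (ZMod 2) ℂ) : QOp n :=
  Matrix.of fun x y => ∏ i, M i (x i) (y i)

/-- The Pauli matrix `X`. -/
def pauliX : Matrix (ZMod 2) (ZMod 2) ℂ := Matrix.of fun x y => if x = y + 1 then 1 else 0

/-- `Z = diag(1, -1)`. -/
def pauliZ : Matrix (ZMod 2) (ZMod 2) ℂ := Matrix.diagonal fun x => if x = 0 then 1 else -1

/-- `S = diag(1, i)`. -/
def gateS : Matrix (ZMod 2) (ZMod 2) ℂ := Matrix.diagonal fun x => if x = 0 then 1 else Complex.I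

/-- `α = e^{iπ/4}`. -/
noncomputable def alphaPhase : ℂ := Complex.exp (Complex.I * (Real.pi / 4))

/-- `X(a)`, `S(b)` and `Z(c)`: the X-type, S-type and Z-type operators. -/
def opX {n : ℕ} (a : Fin n → ZMod 2) : QOp n := tensorOp fun i => pauliX ^ (a i).val

def opS {n : ℕ} (b : Fin n → ZMod 4) : QOp n := tensorOp fun i => gateS ^ (b i).val

def opZ {n : ℕ} (c : Fin n → ZMod 2) : QOp n := tensorOp fun i => pauliZ ^ (c i).val

/-- An element of the `n`-qubit Pauli-S group (tensor products of elements of the group generated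
by `αI`, `X`, `S`), given by the exponents of `α^s X^{a_1} S^{b_1} ⊗ ⋯ ⊗ X^{a_n} S^{b_n}`. -/
structure XSOp (n : ℕ) where
  s : ZMod 8
  a : Fin n → ZMod 2
  b : Fin n → ZMod 4

/-- The operator `α^s X(a) S(b)`. -/
noncomputable def XSOp.toMatrix {n : ℕ} (g : XSOp n) : QOp n :=
  alphaPhase ^ g.s.val • (opX g.a * opS g.b)

/-- An `n`-qubit Pauli operator, given by the exponents of
`i^s X^{a_1} Z^{b_1} ⊗ ⋯ ⊗ X^{a_n} Z^{b_n}`. -/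
structure PauliOp (n : ℕ) where
  s : ZMod 4
  a : Fin n → ZMod 2
  b : Fin n → ZMod 2

/-- The operator `i^s X(a) Z(b)`. -/
noncomputable def PauliOp.toMatrix {n : ℕ} (g : PauliOp n) : QOp n :=
  Complex.I ^ g.s.val • (opX g.a * opZ g.b)

theorem tensorOp_mul {n : ℕ} (M N : Fin n → Matrix (ZMod 2) (ZMod 2) ℂ) :
    tensorOp M * tensorOp N = tensorOp fun i => M i * N i := by
  ext x y
  simp only [tensorOp, Matrix.mul_apply, Matrix.of_apply, Finset.prod_univ_sum,
    Fintype.piFinset_univ, Finset.prod_mul_distrib]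

theorem tensorOp_one {n : ℕ} : tensorOp (fun _ : Fin n => (1 : Matrix (ZMod 2) (ZMod 2) ℂ)) = 1 := by
  ext x y
  by_cases h : x = y
  · subst h; simp [tensorOp]
  · obtain ⟨i, hi⟩ := Function.ne_iff.mp h
    rw [Matrix.one_apply_ne h]
    exact Finset.prod_eq_zero (Finset.mem_univ i) (Matrix.one_apply_ne hi)

theorem isUnit_tensorOp {n : ℕ} (M : Fin n → Matrix (ZMod 2) (ZMod 2) ℂ)
    (hM : ∀ i, IsUnit (M i)) : IsUnit (tensorOp M) := by
  have h1 : ∀ i, ∃ N, M i * N = 1 := fun i => (hM i).exists_right_inv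
  choose N hN using h1
  have h2 : tensorOp M * tensorOp N = 1 := by
    rw [tensorOp_mul]; simp only [hN]; exact tensorOp_one
  exact IsUnit.of_mul_eq_one _ h2

theorem isUnit_pauliX : IsUnit pauliX := by
  refine IsUnit.of_mul_eq_one pauliX ?_
  have h : ∀ x y : ZMod 2, x = y + 1 + 1 ↔ x = y := by decide
  ext x y
  simp [pauliX, Matrix.mul_apply, Matrix.one_apply, h]

theorem isUnit_gateS : IsUnit gateS := by
  refine IsUnit.of_mul_eq_one (Matrix.diagonal fun x => if x = 0 then 1 else -Complex.I) ?_
  rw [gateS, Matrix.diagonal_mul_diagonal, ← Matrix.diagonal_one]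
  congr 1
  funext x
  by_cases hx : x = 0 <;> simp [hx]

theorem XSOp.isUnit_toMatrix {n : ℕ} (g : XSOp n) : IsUnit g.toMatrix := by
  have h1 : IsUnit (opX g.a) := isUnit_tensorOp _ fun i => isUnit_pauliX.pow _
  have h2 : IsUnit (opS g.b) := isUnit_tensorOp _ fun i => isUnit_gateS.pow _
  have h3 : IsUnit (alphaPhase ^ g.s.val) := by
    rw [isUnit_iff_ne_zero]; exact pow_ne_zero _ (Complex.exp_ne_zero _)
  exact (h1.mul h2).smul h3.unit

/-! ### Stabilizer groups and stabilizer states -/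

/-- The group `G = ⟨g_1, …, g_m⟩` of operators. -/
noncomputable def xsGroup {n m : ℕ} (g : Fin m → XSOp n) : Subgroup (QOp n)ˣ :=
  Subgroup.closure (Set.range fun j => (g j).isUnit_toMatrix.unit)

/-- `G_D`: the elements of `G` of the form `α^s S(b)`. -/
def diagonalSubgroup {n : ℕ} (G : Subgroup (QOp n)ˣ) : Set (QOp n)ˣ :=
  {U | U ∈ G ∧ ∃ (s : ZMod 8) (b : Fin n → ZMod 4), (U : QOp n) = alphaPhase ^ s.val • opS b}

/-- `G_Z`: the elements of `G` of the form `α^s Z(c)`. -/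
def zSubgroup {n : ℕ} (G : Subgroup (QOp n)ˣ) : Set (QOp n)ˣ :=
  {U | U ∈ G ∧ ∃ (s : ZMod 8) (c : Fin n → ZMod 2), (U : QOp n) = alphaPhase ^ s.val • opZ c}

/-- The condition `G_D = G_Z` that makes an XS-stabilizer group regular. -/
def IsRegularXSGroup {n : ℕ} (G : Subgroup (QOp n)ˣ) : Prop := diagonalSubgroup G = zSubgroup G

/-- `ψ ≠ 0` is stabilized by all operators in `T`, and is the only such vector up to scalars. -/
def UniquelyStabilizedBy {n : ℕ} (T : Set (QOp n)) (ψ : QVec n) : Prop :=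
  ψ ≠ 0 ∧ (∀ M ∈ T, M.mulVec ψ = ψ) ∧
    ∀ φ : QVec n, (∀ M ∈ T, M.mulVec φ = φ) → ∃ c : ℂ, φ = c • ψ

/-- `ψ` is the state uniquely stabilized by the group generated by `g_1, …, g_m`. -/
def IsXSStateOf {n m : ℕ} (g : Fin m → XSOp n) (ψ : QVec n) : Prop :=
  UniquelyStabilizedBy {M | ∃ U ∈ xsGroup g, (U : QOp n) = M} ψ

/-- XS-stabilizer states. -/
def IsXSStabilizerState {n : ℕ} (ψ : QVec n) : Prop :=
  ∃ (m : ℕ) (g : Fin m → XSOp n), IsXSStateOf g ψ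

/-- `φ` is the state uniquely stabilized by the Pauli operators `p_1, …, p_m`. -/
def IsPauliStateOf {n m : ℕ} (p : Fin m → PauliOp n) (φ : QVec n) : Prop :=
  UniquelyStabilizedBy (Set.range fun j => (p j).toMatrix) φ

/-- Pauli stabilizer states. -/
def IsPauliStabilizerState {n : ℕ} (φ : QVec n) : Prop :=
  ∃ (m : ℕ) (p : Fin m → PauliOp n), IsPauliStateOf p φ

/-! ### Bipartitions: the parties are the qubits in `A` and the qubits not in `A` -/

abbrev BitsIn {n : ℕ} (A : Finset (Fin n)) : Type := {i : Fin n // i ∈ A} → ZMod 2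

abbrev BitsOut {n : ℕ} (A : Finset (Fin n)) : Type := {i : Fin n // i ∉ A} → ZMod 2

/-- The operator `M ⊗ N`, with `M` acting on the qubits in `A` and `N` on the other qubits. -/
def bipartiteOp {n : ℕ} (A : Finset (Fin n)) (M : Matrix (BitsIn A) (BitsIn A) ℂ)
    (N : Matrix (BitsOut A) (BitsOut A) ℂ) : QOp n :=
  Matrix.of fun x y => M (fun i => x i) (fun i => y i) * N (fun i => x i) (fun i => y i)

/-- `ψ = (D_A ⊗ D_B) φ` for some diagonal unitary operators `D_A`, `D_B`. -/
def DiagonallyEquivalent {n : ℕ} (A : Finset (Fin n)) (ψ φ : QVec n) : Prop :=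
  ∃ (DA : Matrix (BitsIn A) (BitsIn A) ℂ) (DB : Matrix (BitsOut A) (BitsOut A) ℂ),
    DA.IsDiag ∧ DA ∈ Matrix.unitaryGroup (BitsIn A) ℂ ∧
    DB.IsDiag ∧ DB ∈ Matrix.unitaryGroup (BitsOut A) ℂ ∧
    ψ = (bipartiteOp A DA DB).mulVec φ

/-- The bit string with restriction `x` to `A` and `z` to the complement of `A`. -/
def glue {n : ℕ} (A : Finset (Fin n)) (x : BitsIn A) (z : BitsOut A) : Bits n :=
  fun i => if h : i ∈ A then x ⟨i, h⟩ else z ⟨i, h⟩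

/-- The reduced density operator `ρ_A = Tr_B |ψ⟩⟨ψ| / ⟨ψ|ψ⟩` of a nonzero vector `ψ`. -/
noncomputable def reducedDensity {n : ℕ} (A : Finset (Fin n)) (ψ : QVec n) :
    Matrix (BitsIn A) (BitsIn A) ℂ :=
  Matrix.of fun x y =>
    (∑ z : BitsOut A, ψ (glue A x z) * star (ψ (glue A y z))) / ∑ w : Bits n, ψ w * star (ψ w)

theorem reducedDensity_isHermitian {n : ℕ} (A : Finset (Fin n)) (ψ : QVec n) :
    (reducedDensity A ψ).IsHermitian := by
  ext x y
  simp [reducedDensity, Matrix.conjTranspose_apply, mul_comm]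

/-- The von Neumann entanglement entropy `-Tr (ρ_A log₂ ρ_A)`, in bits. -/
noncomputable def entanglementEntropy {n : ℕ} (A : Finset (Fin n)) (ψ : QVec n) : ℝ :=
  (∑ k, Real.negMulLog ((reducedDensity_isHermitian A ψ).eigenvalues k)) / Real.log 2

/-! ### A random access machine with a step count -/

namespace RAM

/-- Finitely many of the registers and memory cells are in use at any time; all hold naturals. -/
structure State where
  reg : ℕ → ℕ
  mem : ℕ → ℕ

/-- Expressions: constants, registers, memory access `mem[e]`, sums, truncated differences.
There is no multiplication, so that unit cost per operation is polynomially related to the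
running time of Turing machines. -/
inductive Expr where
  | const (k : ℕ)
  | reg (r : ℕ)
  | load (e : Expr)
  | add (e₁ e₂ : Expr)
  | sub (e₁ e₂ : Expr)

def Expr.eval (σ : State) : Expr → ℕ
  | .const k => k
  | .reg r => σ.reg r
  | .load e => σ.mem (e.eval σ)
  | .add e₁ e₂ => e₁.eval σ + e₂.eval σ
  | .sub e₁ e₂ => e₁.eval σ - e₂.eval σ

/-- The number of elementary operations in the evaluation of an expression. -/
def Expr.cost : Expr → ℕ
  | .const _ => 1
  | .reg _ => 1
  | .load e => e.cost + 1
  | .add e₁ e₂ => e₁.cost + e₂.cost + 1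
  | .sub e₁ e₂ => e₁.cost + e₂.cost + 1

/-- Programs; a condition holds when its value is not zero. -/
inductive Program where
  | skip
  | assign (r : ℕ) (e : Expr)
  | store (addr e : Expr)
  | seq (c₁ c₂ : Program)
  | ite (e : Expr) (c₁ c₂ : Program)
  | while (e : Expr) (c : Program)

/-- `Runs c σ t σ'`: started in `σ`, the program `c` halts in `σ'` after exactly `t` steps. -/
inductive Runs : Program → State → ℕ → State → Prop where
  | skip (σ : State) : Runs .skip σ 1 σ
  | assign (r : ℕ) (e : Expr) (σ : State) :
      Runs (.assign r e) σ (e.cost + 1) { σ with reg := Function.update σ.reg r (e.eval σ) }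
  | store (addr e : Expr) (σ : State) :
      Runs (.store addr e) σ (addr.cost + e.cost + 1)
        { σ with mem := Function.update σ.mem (addr.eval σ) (e.eval σ) }
  | seq {c₁ c₂ : Program} {σ σ₁ σ₂ : State} {t₁ t₂ : ℕ} :
      Runs c₁ σ t₁ σ₁ → Runs c₂ σ₁ t₂ σ₂ → Runs (.seq c₁ c₂) σ (t₁ + t₂) σ₂
  | iteTrue {e : Expr} {c₁ c₂ : Program} {σ σ' : State} {t : ℕ} :
      e.eval σ ≠ 0 → Runs c₁ σ t σ' → Runs (.ite e c₁ c₂) σ (e.cost + 1 + t) σ'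
  | iteFalse {e : Expr} {c₁ c₂ : Program} {σ σ' : State} {t : ℕ} :
      e.eval σ = 0 → Runs c₂ σ t σ' → Runs (.ite e c₁ c₂) σ (e.cost + 1 + t) σ'
  | whileTrue {e : Expr} {c : Program} {σ σ₁ σ₂ : State} {t₁ t₂ : ℕ} :
      e.eval σ ≠ 0 → Runs c σ t₁ σ₁ → Runs (.while e c) σ₁ t₂ σ₂ →
      Runs (.while e c) σ (e.cost + 1 + t₁ + t₂) σ₂
  | whileFalse {e : Expr} {c : Program} {σ : State} :
      e.eval σ = 0 → Runs (.while e c) σ (e.cost + 1) σ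

/-- The input is written to the memory cells `0, 1, 2, …`; everything else is zero. -/
def initialState (input : List ℕ) : State where
  reg := fun _ => 0
  mem := fun i => input.getD i 0

/-- On `input`, the program halts within `T` steps, with `output` in the memory cells
`0, 1, …, output.length - 1`. -/
def OutputsWithin (c : Program) (input output : List ℕ) (T : ℕ) : Prop :=
  ∃ (t : ℕ) (σ' : State), t ≤ T ∧ Runs c (initialState input) t σ' ∧
    ∀ (i : ℕ) (hi : i < output.length), σ'.mem i = output[i]

end RAM

/-! ### Encodings of operators -/

/-- `s, a_1, …, a_n, b_1, …, b_n` -/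
def XSOp.encode {n : ℕ} (g : XSOp n) : List ℕ :=
  g.s.val :: ((List.ofFn fun i => (g.a i).val) ++ List.ofFn fun i => (g.b i).val)

/-- `s, a_1, …, a_n, b_1, …, b_n` -/
def PauliOp.encode {n : ℕ} (p : PauliOp n) : List ℕ :=
  p.s.val :: ((List.ofFn fun i => (p.a i).val) ++ List.ofFn fun i => (p.b i).val)

/-- The input of the algorithms: `n`, `m`, the indicator bits of `A`, then the `m` generators. -/
def encodeInput {n m : ℕ} (g : Fin m → XSOp n) (A : Finset (Fin n)) : List ℕ :=
  n :: m :: ((List.ofFn fun i => if i ∈ A then 1 else 0) ++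
    (List.ofFn fun j => (g j).encode).flatten)

/-- The description of a Pauli stabilizer state on `n` qubits: a list of `n` stabilizers. -/
def encodePaulis {n : ℕ} (p : Fin n → PauliOp n) : List ℕ :=
  (List.ofFn fun j => (p j).encode).flatten

/-! Fix an XS-stabilizer state `ψ`, and let `L` be the span over the field with two elements of the
`X`-parts of its generators. Restricting `ψ` to a coset of `L` keeps it fixed, so uniqueness forces
the support to be a single coset `x₀ + L`. Every translation by `y ∈ L` multiplies the amplitudes by
the phase of some operator with `X`-part `y`. Such a phase is a product of functions of single bits.
For `w, w'` with disjoint supports its multiplicative second difference is therefore trivial, and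
the second difference `cross ψ x w w'` of the amplitudes does not depend on `x` in the support.
Constancy makes it multiplicative in `w` and in `w'`; since `w + w = 0` it is a sign. On `L_A ×
L_B`, the vectors of `L` supported on `A` and on its complement `B`, it is thus `(-1)^(wᵀ M w')` for
a matrix `M` (`AdaptedForms.couples`).

The state with amplitudes `κ (-1)^(xᵀ M x)` on `x₀ + L` has the same second differences and is a
Pauli stabilizer state (`isPauliStateOf_quadPauli`). The quotient of the two states has trivial
second differences. The coset of `L_A + L_B` containing `x` is visible to each party alone, so the
quotient splits into a function of the bits in `A` times a function of the other bits
(`exists_split`). These are the diagonal unitaries.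

For the spectrum, only vectors of `L_A` and `L_B` contribute to the square of `ρ_A`, and the
remaining sum over `L_B` is a character sum. This gives `ρ_A² = r ρ_A` with `r = |K| |L_B| / |L|`,
where `K` is the left kernel of `M` on `L_A × L_B` (`CosetState.reducedDensity_mul_self`). Hence the
spectrum is flat and the entropy is `dim L - dim L_A - dim L_B + rank M`.

For the algorithms, Gauss–Jordan elimination is performed on the operators themselves, once with the
columns outside `A` first and once with those in `A` first; bases of `L_A` and `L_B` appear as rows.
A point of the support is also needed. In a regular group the diagonal elements are of `Z`-type, so
being fixed by them is a linear condition on a basis vector. A solution of these equations for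
suitable diagonal elements already lies in the support: on its coset the rows commute and square to
one, so symmetrizing the basis vector gives a fixed vector, which is a multiple of `ψ` by uniqueness
(`XSOp.ne_zero_solution`).

The running time is controlled by writing the algorithms in a small array language in which every
loop runs to the same bound `N`, quadratic in `n + m`. `exists_program` compiles this language to
the random access machine with a polynomial time bound, so only functional correctness remains to be
shown. -/

namespace RAM

/-! ### An array language with bounded loops -/

/-- Expressions over loop variables and two-dimensional arrays. -/
inductive AExp where
  | const (c : ℕ)
  | var (x : ℕ)
  | arr (k x y : ℕ)
  | inp (e : AExp)
  | add (e₁ e₂ : AExp)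
  | sub (e₁ e₂ : AExp)
  | ite (c e₁ e₂ : AExp)
  | sum (x : ℕ) (e : AExp)

/-- Contents of the arrays: name, row, column. -/
abbrev Arrays : Type := ℕ → ℕ → ℕ → ℕ

def AExp.ev (N : ℕ) (I : ℕ → ℕ) : AExp → (ℕ → ℕ) → Arrays → ℕ
  | .const c, _, _ => c
  | .var x, ρ, _ => ρ x
  | .arr k x y, ρ, A => A k (ρ x) (ρ y)
  | .inp e, ρ, A => I (e.ev N I ρ A)
  | .add e₁ e₂, ρ, A => e₁.ev N I ρ A + e₂.ev N I ρ A
  | .sub e₁ e₂, ρ, A => e₁.ev N I ρ A - e₂.ev N I ρ A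
  | .ite c e₁ e₂, ρ, A => if c.ev N I ρ A ≠ 0 then e₁.ev N I ρ A else e₂.ev N I ρ A
  | .sum x e, ρ, A => ∑ i ∈ Finset.range N, e.ev N I (Function.update ρ x i) A

/-- Commands; `assign k e` sets all entries of array `k` in parallel, the row and the column being
the variables `0` and `1` in `e`. -/
inductive Cmd where
  | assign (k : ℕ) (e : AExp)
  | seq (c₁ c₂ : Cmd)
  | loop (x : ℕ) (c : Cmd)

/-- `f (n-1) (⋯ (f 0 a))` -/
def iter {α : Type*} (f : ℕ → α → α) (a : α) : ℕ → α
  | 0 => a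
  | n + 1 => f n (iter f a n)

def Cmd.exec (N : ℕ) (I : ℕ → ℕ) : Cmd → (ℕ → ℕ) → Arrays → Arrays
  | .assign k e, ρ, A => Function.update A k fun i j =>
      e.ev N I (Function.update (Function.update ρ 0 i) 1 j) A
  | .seq c₁ c₂, ρ, A => c₂.exec N I ρ (c₁.exec N I ρ A)
  | .loop x c, ρ, A => iter (fun i A => c.exec N I (Function.update ρ x i) A) A N

/-! ### Simulation of the array language -/

/-- The program `c` started in `σ` halts within `T` steps in a state with property `Q`. -/
def Reaches (c : Program) (σ : State) (T : ℕ) (Q : State → Prop) : Prop :=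
  ∃ t ≤ T, ∃ σ', Runs c σ t σ' ∧ Q σ'

theorem Reaches.mono {c : Program} {σ : State} {T T' : ℕ} {Q Q' : State → Prop}
    (h : Reaches c σ T Q) (hT : T ≤ T') (hQ : ∀ σ', Q σ' → Q' σ') : Reaches c σ T' Q' := by
  obtain ⟨t, ht, σ', hr, hq⟩ := h
  exact ⟨t, ht.trans hT, σ', hr, hQ _ hq⟩

theorem Reaches.seq {c₁ c₂ : Program} {σ : State} {T₁ T₂ : ℕ} {Q Q' : State → Prop}
    (h₁ : Reaches c₁ σ T₁ Q) (h₂ : ∀ σ', Q σ' → Reaches c₂ σ' T₂ Q') :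
    Reaches (.seq c₁ c₂) σ (T₁ + T₂) Q' := by
  obtain ⟨t, ht, σ', hr, hq⟩ := h₁
  obtain ⟨t', ht', σ'', hr', hq'⟩ := h₂ σ' hq
  exact ⟨t + t', by omega, σ'', .seq hr hr', hq'⟩

theorem Reaches.assign {r : ℕ} {e : Expr} {σ : State} {T : ℕ} {Q : State → Prop}
    (hT : e.cost + 1 ≤ T) (h : Q { σ with reg := Function.update σ.reg r (e.eval σ) }) :
    Reaches (.assign r e) σ T Q :=
  ⟨_, hT, _, .assign r e σ, h⟩

theorem Reaches.store {a e : Expr} {σ : State} {T : ℕ} {Q : State → Prop}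
    (hT : a.cost + e.cost + 1 ≤ T)
    (h : Q { σ with mem := Function.update σ.mem (a.eval σ) (e.eval σ) }) :
    Reaches (.store a e) σ T Q :=
  ⟨_, hT, _, .store a e σ, h⟩

theorem Reaches.ite {e : Expr} {c₁ c₂ : Program} {σ : State} {T : ℕ} {Q : State → Prop}
    (h₁ : e.eval σ ≠ 0 → Reaches c₁ σ T Q) (h₂ : e.eval σ = 0 → Reaches c₂ σ T Q) :
    Reaches (.ite e c₁ c₂) σ (e.cost + 1 + T) Q := by
  by_cases h : e.eval σ = 0
  · obtain ⟨t, ht, σ', hr, hq⟩ := h₂ h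
    exact ⟨_, by omega, σ', .iteFalse h hr, hq⟩
  · obtain ⟨t, ht, σ', hr, hq⟩ := h₁ h
    exact ⟨_, by omega, σ', .iteTrue h hr, hq⟩

theorem Reaches.while {e : Expr} {c : Program} {T : ℕ} (n : ℕ) (P : ℕ → State → Prop)
    (hcond : ∀ i ≤ n, ∀ σ, P i σ → (e.eval σ ≠ 0 ↔ i < n))
    (hbody : ∀ i < n, ∀ σ, P i σ → Reaches c σ T (P (i + 1))) (σ : State) (h : P 0 σ) :
    Reaches (.while e c) σ (n * (e.cost + 1 + T) + (e.cost + 1)) (P n) := by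
  suffices H : ∀ k i, i + k = n → ∀ σ, P i σ →
      Reaches (.while e c) σ (k * (e.cost + 1 + T) + (e.cost + 1)) (P n) from
    H n 0 (by omega) σ h
  intro k
  induction k with
  | zero =>
    intro i hi σ hσ
    obtain rfl : i = n := by omega
    exact ⟨_, by omega, σ, .whileFalse (by_contra fun h0 =>
      lt_irrefl _ ((hcond i le_rfl σ hσ).1 h0)), hσ⟩
  | succ k ih =>
    intro i hi σ hσ
    obtain ⟨t, ht, σ', hr, hq⟩ := hbody i (by omega) σ hσ
    obtain ⟨t', ht', σ'', hr', hq'⟩ := ih (i + 1) (by omega) σ' hq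
    refine ⟨_, ?_, σ'', .whileTrue ((hcond i (by omega) σ hσ).2 (by omega)) hr hr', hq'⟩
    rw [Nat.succ_mul]
    omega

/-- In `σ`, register `0` holds the loop bound `N`, register `1` holds `N * N`, the variable `x` is
kept in register `3x+2` and its `N`-fold in register `3x+3`, the temporary `τ e`, `e < d`, is kept in
register `3e+4`, the memory cells below `N * N` hold `I`, followed by the arrays. -/
structure Sim (N : ℕ) (τ : ℕ → ℕ) (d : ℕ) (ρ : ℕ → ℕ) (I : ℕ → ℕ) (B : Arrays) (σ : State) :
    Prop where
  bound : σ.reg 0 = N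
  size : σ.reg 1 = N * N
  var : ∀ x, σ.reg (3 * x + 2) = ρ x
  row : ∀ x, σ.reg (3 * x + 3) = N * ρ x
  tmp : ∀ e < d, σ.reg (3 * e + 4) = τ e
  cell : ∀ k i j, i < N → j < N → σ.mem ((k + 1) * (N * N) + N * i + j) = B k i j
  input : ∀ a < N * N, σ.mem a = I a

variable {N : ℕ} {τ τ' : ℕ → ℕ} {d d' : ℕ} {ρ : ℕ → ℕ} {I : ℕ → ℕ} {B : Arrays} {σ : State}

theorem Sim.weaken (h : Sim N τ d ρ I B σ) (hd : d' ≤ d) (hτ : ∀ e < d', τ' e = τ e) :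
    Sim N τ' d' ρ I B σ :=
  ⟨h.bound, h.size, h.var, h.row, fun e he => by rw [hτ e he, h.tmp e (by omega)], h.cell, h.input⟩

/-- The residue of a register number modulo 3 separates variables, their `N`-folds and temporaries,
and temporaries start beyond register `1`; the other invariants are therefore untouched. -/
theorem Sim.setTmp (h : Sim N τ d ρ I B σ) (e v : ℕ) (hτ : τ' e = v)
    (hd : ∀ f < d', f ≠ e → f < d ∧ τ' f = τ f) :
    Sim N τ' d' ρ I B { σ with reg := Function.update σ.reg (3 * e + 4) v } where
  bound := by simpa using h.bound
  size := by
    have : (1 : ℕ) ≠ 3 * e + 4 := by omega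
    simpa [Function.update_of_ne this] using h.size
  var x := by
    have : 3 * x + 2 ≠ 3 * e + 4 := by omega
    simpa [Function.update_of_ne this] using h.var x
  row x := by
    have : 3 * x + 3 ≠ 3 * e + 4 := by omega
    simpa [Function.update_of_ne this] using h.row x
  tmp f hf := by
    by_cases hfe : f = e
    · subst hfe; simp [hτ]
    · have : 3 * f + 4 ≠ 3 * e + 4 := by omega
      obtain ⟨h1, h2⟩ := hd f hf hfe
      simpa [Function.update_of_ne this, h2] using h.tmp f h1
  cell := h.cell
  input := h.input

theorem Sim.setVar (h : Sim N τ d ρ I B σ) (x i w : ℕ) (hw : w = N * i) :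
    Sim N τ d (Function.update ρ x i) I B
      { σ with reg := Function.update (Function.update σ.reg (3 * x + 2) i) (3 * x + 3) w } where
  bound := by simpa using h.bound
  size := by
    have h1 : (1 : ℕ) ≠ 3 * x + 2 := by omega
    have h2 : (1 : ℕ) ≠ 3 * x + 3 := by omega
    simpa [Function.update_of_ne h1, Function.update_of_ne h2] using h.size
  var y := by
    have h1 : 3 * y + 2 ≠ 3 * x + 3 := by omega
    by_cases hy : y = x
    · subst hy; simp
    · have h2 : 3 * y + 2 ≠ 3 * x + 2 := by omega
      simpa [Function.update_of_ne h1, Function.update_of_ne h2, Function.update_of_ne hy]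
        using h.var y
  row y := by
    have h1 : 3 * y + 3 ≠ 3 * x + 2 := by omega
    by_cases hy : y = x
    · subst hy; simp [hw]
    · have h2 : 3 * y + 3 ≠ 3 * x + 3 := by omega
      simpa [Function.update_of_ne h1, Function.update_of_ne h2, Function.update_of_ne hy]
        using h.row y
  tmp e he := by
    have h1 : 3 * e + 4 ≠ 3 * x + 2 := by omega
    have h2 : 3 * e + 4 ≠ 3 * x + 3 := by omega
    simpa [Function.update_of_ne h1, Function.update_of_ne h2] using h.tmp e he
  cell := h.cell
  input := h.input

/-- An address is `N * (k * N + i) + j`, so remainders modulo `N` recover first `j`, then `i`, then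
`k`. -/
theorem address_inj {k k' i i' j j' : ℕ} (hi : i < N) (hi' : i' < N) (hj : j < N) (hj' : j' < N)
    (h : k * (N * N) + N * i + j = k' * (N * N) + N * i' + j') : k = k' ∧ i = i' ∧ j = j' := by
  have h0 : 0 < N := by omega
  have e1 : N * (k * N + i) + j = N * (k' * N + i') + j' := by linarith
  have e2 : j = j' := by
    have := congrArg (· % N) e1
    simpa [Nat.mul_add_mod, Nat.mod_eq_of_lt hj, Nat.mod_eq_of_lt hj'] using this
  subst e2
  have e3 : N * k + i = N * k' + i' := by
    have := Nat.eq_of_mul_eq_mul_left h0 (Nat.add_right_cancel e1)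
    linarith
  have e4 : i = i' := by
    have := congrArg (· % N) e3
    simpa [Nat.mul_add_mod, Nat.mod_eq_of_lt hi, Nat.mod_eq_of_lt hi'] using this
  subst e4
  exact ⟨Nat.eq_of_mul_eq_mul_left h0 (Nat.add_right_cancel e3), rfl, rfl⟩

theorem Sim.setCell (h : Sim N τ d ρ I B σ) {q i j : ℕ} (hi : i < N) (hj : j < N) (v : ℕ) :
    Sim N τ d ρ I (Function.update B q (Function.update (B q) i (Function.update (B q i) j v)))
      { σ with mem := Function.update σ.mem ((q + 1) * (N * N) + N * i + j) v } where
  bound := h.bound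
  size := h.size
  var := h.var
  row := h.row
  tmp := h.tmp
  cell k i' j' hi' hj' := by
    by_cases hh : (k + 1) * (N * N) + N * i' + j' = (q + 1) * (N * N) + N * i + j
    · obtain ⟨h1, rfl, rfl⟩ := address_inj hi' hi hj' hj hh
      obtain rfl : k = q := by omega
      simp
    · simp only [Function.update_of_ne hh, h.cell k i' j' hi' hj']
      by_cases h1 : k = q
      · subst h1
        by_cases h2 : i' = i
        · subst h2
          have h3 : j' ≠ j := by rintro rfl; exact hh rfl
          simp [h3]
        · simp [h2]
      · simp [h1]
  input a ha := by
    have : a ≠ (q + 1) * (N * N) + N * i + j := by nlinarith [Nat.zero_le (q * (N * N))]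
    simpa [Function.update_of_ne this] using h.input a ha

/-- The input block ends below `N * N`, where the arrays begin; this lets the output overwrite the
input without harming the arrays. -/
theorem Sim.setInput (h : Sim N τ d ρ I B σ) {a : ℕ} (ha : a < N * N) (v : ℕ) :
    Sim N τ d ρ (Function.update I a v) B { σ with mem := Function.update σ.mem a v } where
  bound := h.bound
  size := h.size
  var := h.var
  row := h.row
  tmp := h.tmp
  cell k i j hi hj := by
    have : (k + 1) * (N * N) + N * i + j ≠ a := by nlinarith [Nat.zero_le (k * (N * N))]
    simpa [Function.update_of_ne this] using h.cell k i j hi hj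
  input b hb := by
    by_cases hba : b = a
    · subst hba; simp
    · simpa [Function.update_of_ne hba] using h.input b hb

/-- `(k+1) * N²` plus an expression -/
def offsetExpr (e : Expr) : ℕ → Expr
  | 0 => .add (.reg 1) e
  | k + 1 => .add (.reg 1) (offsetExpr e k)

/-- The address of the entry at row `x` and column `y` of array `k`. -/
def addrExpr (k x y : ℕ) : Expr :=
  offsetExpr (.add (.reg (3 * x + 3)) (.reg (3 * y + 2))) k

theorem offsetExpr_eval (e : Expr) (σ : State) (k : ℕ) :
    (offsetExpr e k).eval σ = (k + 1) * σ.reg 1 + e.eval σ := by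
  induction k with
  | zero => simp [offsetExpr, Expr.eval]
  | succ k ih => simp only [offsetExpr, Expr.eval, ih]; ring

theorem Sim.addrExpr_eval (h : Sim N τ d ρ I B σ) (k x y : ℕ) :
    (addrExpr k x y).eval σ = (k + 1) * (N * N) + N * ρ x + ρ y := by
  rw [addrExpr, offsetExpr_eval]
  simp only [Expr.eval, h.size, h.row, h.var]
  ring

/-- Run `body` for `x = 0, …, N - 1`, keeping the old value of `x` in the temporaries
`d` and `d + 1`. -/
def forLoop (x d : ℕ) (body : Program) : Program :=
  .seq (.assign (3 * d + 4) (.reg (3 * x + 2))) <|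
  .seq (.assign (3 * (d + 1) + 4) (.reg (3 * x + 3))) <|
  .seq (.seq (.assign (3 * x + 2) (.const 0)) (.assign (3 * x + 3) (.const 0))) <|
  .seq (.while (.sub (.reg 0) (.reg (3 * x + 2))) <|
    .seq body <| .seq (.assign (3 * x + 2) (.add (.reg (3 * x + 2)) (.const 1)))
      (.assign (3 * x + 3) (.add (.reg (3 * x + 3)) (.reg 0)))) <|
  .seq (.assign (3 * x + 2) (.reg (3 * d + 4))) (.assign (3 * x + 3) (.reg (3 * (d + 1) + 4)))

theorem reaches_setVar (h : Sim N τ d ρ I B σ) (x i : ℕ) {e₁ e₂ : Expr} {T₁ T₂ : ℕ}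
    (h₁ : e₁.cost + 1 ≤ T₁) (h₂ : e₂.cost + 1 ≤ T₂) (he₁ : e₁.eval σ = i)
    (he₂ : e₂.eval { σ with reg := Function.update σ.reg (3 * x + 2) i } = N * i) :
    Reaches (.seq (.assign (3 * x + 2) e₁) (.assign (3 * x + 3) e₂)) σ (T₁ + T₂)
      (Sim N τ d (Function.update ρ x i) I B) := by
  subst he₁
  refine Reaches.seq (Q := fun σ' => σ' = _) (Reaches.assign h₁ rfl) ?_
  rintro _ rfl
  exact Reaches.assign h₂ (h.setVar x _ _ he₂)

/-- `Q i` is the invariant of the memory after `i` rounds and `τs i` describes the temporaries at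
that time. The latter vary with `i` because a sum accumulates in a temporary below the two that save
the loop variable. -/
theorem reaches_forLoop {τs : ℕ → ℕ → ℕ} {x T : ℕ} {body : Program}
    (Q : ℕ → (ℕ → ℕ) → Arrays → Prop) (hd : d + 2 ≤ d')
    (hτ0 : ∀ e < d, τs 0 e = τ e) (hd' : d' = d + 2)
    (hs : ∀ i, τs i d = ρ x ∧ τs i (d + 1) = N * ρ x)
    (hbody : ∀ i < N, ∀ I B σ, Q i I B → Sim N (τs i) d' (Function.update ρ x i) I B σ →
      Reaches body σ T fun σ' => ∃ I' B', Q (i + 1) I' B' ∧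
        Sim N (τs (i + 1)) d' (Function.update ρ x i) I' B' σ')
    (hQ : Q 0 I B) (h : Sim N τ d ρ I B σ) :
    Reaches (forLoop x d body) σ (N * (T + 12) + 20) fun σ' => ∃ I' B', Q N I' B' ∧
      Sim N (τs N) d ρ I' B' σ' := by
  subst hd'
  have hσ0 := hs 0
  refine Reaches.mono (T := 2 + (2 + ((2 + 2) + ((N * (4 + (T + (4 + 4))) + 4) + (2 + 2)))))
    ?_ (by nlinarith) (fun _ h => h)
  refine Reaches.seq (Q := Sim N (Function.update τ d (ρ x)) (d + 1) ρ I B)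
    (Reaches.assign (by simp [Expr.cost]) ?_) ?_
  · simp only [Expr.eval, h.var]
    exact h.setTmp d _ (by simp) fun f hf hne => ⟨by omega, by simp [hne]⟩
  intro σ₁ h₁
  refine Reaches.seq (Q := Sim N (τs 0) (d + 2) ρ I B)
    (Reaches.assign (by simp [Expr.cost]) ?_) ?_
  · simp only [Expr.eval, h₁.row]
    refine h₁.setTmp (d + 1) _ hσ0.2 fun f hf hne => ⟨by omega, ?_⟩
    by_cases hfd : f = d
    · subst hfd; simp [hσ0.1]
    · rw [Function.update_of_ne hfd, hτ0 f (by omega)]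
  intro σ₂ h₂
  refine Reaches.seq (reaches_setVar h₂ x 0 (by simp [Expr.cost]) (by simp [Expr.cost])
    (by simp [Expr.eval]) (by simp [Expr.eval])) ?_
  intro σ₃ h₃
  let P : ℕ → State → Prop := fun i σ => ∃ I' B', Q i I' B' ∧
    Sim N (τs i) (d + 2) (Function.update ρ x i) I' B' σ
  refine Reaches.seq (Q := P N) ?_ ?_
  · refine Reaches.mono (Reaches.while (T := T + (4 + 4)) N P ?_ ?_ σ₃ ⟨I, B, hQ, h₃⟩)
      (by simp [Expr.cost]) (fun _ h => h)
    · rintro i hi σ ⟨I', B', hQ', hS⟩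
      have := hS.var x
      simp only [Function.update_self] at this
      simp only [Expr.eval, hS.bound, this]
      omega
    · rintro i hi σ ⟨I', B', hQ', hS⟩
      refine Reaches.seq (hbody i hi I' B' σ hQ' hS) ?_
      rintro σ' ⟨I'', B'', hQ'', hS'⟩
      have hv := hS'.var x
      have hw := hS'.row x
      simp only [Function.update_self] at hv hw
      refine Reaches.mono (reaches_setVar hS' x (i + 1) (by simp [Expr.cost]) (by simp [Expr.cost])
        (by simp [Expr.eval, hv]) ?_) le_rfl fun σ'' h'' => ⟨I'', B'', hQ'', by simpa using h''⟩
      have h1 : (0 : ℕ) ≠ 3 * x + 2 := by omega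
      have h2 : 3 * x + 3 ≠ 3 * x + 2 := by omega
      simp only [Expr.eval, Function.update_of_ne h1, Function.update_of_ne h2, hw, hS'.bound]
      ring
  · rintro σ₄ ⟨I', B', hQ', hS⟩
    have hsN := hs N
    refine Reaches.mono (reaches_setVar hS x (ρ x) (by simp [Expr.cost]) (by simp [Expr.cost])
      (by simp [Expr.eval, hS.tmp d (by omega), hsN.1]) ?_) le_rfl fun σ'' h'' =>
        ⟨I', B', hQ', (by simpa using h'' : Sim N (τs N) (d + 2) ρ I' B' σ'').weaken (by omega)
          fun _ _ => rfl⟩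
    have h2 : 3 * (d + 1) + 4 ≠ 3 * x + 2 := by omega
    simp only [Expr.eval, Function.update_of_ne h2, hS.tmp (d + 1) (by omega), hsN.2]

/-- Evaluate an expression into the temporary `d`. -/
def AExp.compile : AExp → ℕ → Program
  | .const c, d => .assign (3 * d + 4) (.const c)
  | .var x, d => .assign (3 * d + 4) (.reg (3 * x + 2))
  -- Array `k` is stored at position `k + 1`; position `0` is the buffer for parallel assignments.
  | .arr k x y, d => .assign (3 * d + 4) (.load (addrExpr (k + 1) x y))
  -- Memory from `N * N` on holds arrays, so beyond that bound the padding value `0` is produced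
  -- without a memory access.
  | .inp e, d => .seq (e.compile d) <| .ite (.sub (.reg 1) (.reg (3 * d + 4)))
      (.assign (3 * d + 4) (.load (.reg (3 * d + 4)))) (.assign (3 * d + 4) (.const 0))
  | .add e₁ e₂, d => .seq (e₁.compile d) <| .seq (e₂.compile (d + 1)) <|
      .assign (3 * d + 4) (.add (.reg (3 * d + 4)) (.reg (3 * (d + 1) + 4)))
  | .sub e₁ e₂, d => .seq (e₁.compile d) <| .seq (e₂.compile (d + 1)) <|
      .assign (3 * d + 4) (.sub (.reg (3 * d + 4)) (.reg (3 * (d + 1) + 4)))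
  | .ite c e₁ e₂, d => .seq (c.compile d) <|
      .ite (.reg (3 * d + 4)) (e₁.compile d) (e₂.compile d)
  -- Temporary `d` accumulates and `d + 1`, `d + 2` save the loop variable, hence the summand goes
  -- to `d + 3`.
  | .sum x e, d => .seq (.assign (3 * d + 4) (.const 0)) <| forLoop x (d + 1) <|
      .seq (e.compile (d + 3)) <|
      .assign (3 * d + 4) (.add (.reg (3 * d + 4)) (.reg (3 * (d + 3) + 4)))

open Polynomial in
/-- A bound on the running time, in terms of the loop bound. -/
noncomputable def AExp.time : AExp → Polynomial ℕ
  | .const _ => C 2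
  | .var _ => C 2
  | .arr k _ _ => C ((addrExpr (k + 1) 0 0).cost + 2)
  | .inp e => e.time + C 10
  | .add e₁ e₂ => e₁.time + e₂.time + C 4
  | .sub e₁ e₂ => e₁.time + e₂.time + C 4
  | .ite c e₁ e₂ => c.time + (e₁.time + e₂.time) + C 2
  | .sum _ e => X * (e.time + C 16) + C 22

theorem addrExpr_cost (k x y : ℕ) : (addrExpr k x y).cost = (addrExpr k 0 0).cost := by
  simp only [addrExpr]
  induction k with
  | zero => simp [offsetExpr, Expr.cost]
  | succ k ih => simp [offsetExpr, Expr.cost, ih]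

theorem AExp.reaches_compile (hI : ∀ a, N * N ≤ a → I a = 0) (e : AExp) :
    ∀ (τ : ℕ → ℕ) (d : ℕ) (ρ : ℕ → ℕ) (B : Arrays) (σ : State), (∀ x, ρ x < N) →
      Sim N τ d ρ I B σ → Reaches (e.compile d) σ (e.time.eval N)
        (Sim N (Function.update τ d (e.ev N I ρ fun k => B (k + 1))) (d + 1) ρ I B) := by
  have upd : ∀ {τ : ℕ → ℕ} {d : ℕ} {v : ℕ}, ∀ f < d + 1, f ≠ d →
      f < d ∧ Function.update τ d v f = τ f :=
    fun f hf hne => ⟨by omega, by simp [hne]⟩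
  induction e with
  | const c =>
    intro τ d ρ B σ hρ h
    exact Reaches.assign (by simp [Expr.cost, AExp.time])
      (h.setTmp d _ (by simp [AExp.ev, Expr.eval]) upd)
  | var x =>
    intro τ d ρ B σ hρ h
    exact Reaches.assign (by simp [Expr.cost, AExp.time])
      (h.setTmp d _ (by simp [AExp.ev, Expr.eval, h.var]) upd)
  | arr k x y =>
    intro τ d ρ B σ hρ h
    refine Reaches.assign (by simp [Expr.cost, AExp.time, addrExpr_cost (k + 1) x y])
      (h.setTmp d _ ?_ upd)
    simp [AExp.ev, Expr.eval, h.addrExpr_eval, h.cell (k + 1) _ _ (hρ x) (hρ y)]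
  | inp e ih =>
    intro τ d ρ B σ hρ h
    refine Reaches.mono (T' := _) (Reaches.seq (ih τ d ρ B σ hρ h) (T₂ := 4 + 3) fun σ' h' => ?_)
      (by simp [AExp.time]) (fun _ h => h)
    have ht := h'.tmp d (by omega)
    simp only [Function.update_self] at ht
    refine Reaches.ite (fun h1 => Reaches.assign (by simp [Expr.cost])
      (h'.setTmp d _ ?_ fun f hf hne => ⟨hf, by simp [hne]⟩)) (fun h1 => Reaches.assign
      (by simp [Expr.cost]) (h'.setTmp d _ ?_ fun f hf hne => ⟨hf, by simp [hne]⟩))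
    · simp only [Expr.eval, h'.size, ht] at h1
      simp only [Function.update_self, AExp.ev, Expr.eval, ht]
      rw [h'.input _ (by omega)]
    · simp only [Expr.eval, h'.size, ht] at h1
      simp only [Function.update_self, AExp.ev, Expr.eval]
      exact hI _ (by omega)
  | add e₁ e₂ ih₁ ih₂ =>
    intro τ d ρ B σ hρ h
    refine Reaches.mono (Reaches.seq (ih₁ τ d ρ B σ hρ h) fun σ₁ h₁ =>
      Reaches.seq (ih₂ _ _ ρ B σ₁ hρ h₁) (T₂ := 4) fun σ₂ h₂ => Reaches.assign (by simp [Expr.cost])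
        (h₂.setTmp d _ ?_ fun f hf hne => ⟨by omega, ?_⟩)) (by simp [AExp.time, add_assoc]) (fun _ h => h)
    · simp [Expr.eval, h₂.tmp d (by omega), h₂.tmp (d + 1) (by omega), AExp.ev]
    · simp [hne, show f ≠ d + 1 by omega]
  | sub e₁ e₂ ih₁ ih₂ =>
    intro τ d ρ B σ hρ h
    refine Reaches.mono (Reaches.seq (ih₁ τ d ρ B σ hρ h) fun σ₁ h₁ =>
      Reaches.seq (ih₂ _ _ ρ B σ₁ hρ h₁) (T₂ := 4) fun σ₂ h₂ => Reaches.assign (by simp [Expr.cost])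
        (h₂.setTmp d _ ?_ fun f hf hne => ⟨by omega, ?_⟩)) (by simp [AExp.time, add_assoc]) (fun _ h => h)
    · simp [Expr.eval, h₂.tmp d (by omega), h₂.tmp (d + 1) (by omega), AExp.ev]
    · simp [hne, show f ≠ d + 1 by omega]
  | ite c e₁ e₂ ihc ih₁ ih₂ =>
    intro τ d ρ B σ hρ h
    refine Reaches.mono (T := c.time.eval N + (2 + (e₁.time.eval N + e₂.time.eval N)))
      (Reaches.seq (ihc τ d ρ B σ hρ h) fun σ₁ h₁ => ?_)
      (by simp [AExp.time]; omega) (fun _ h => h)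
    have ht := h₁.tmp d (by omega)
    simp only [Function.update_self] at ht
    have h₁' : Sim N τ d ρ I B σ₁ := h₁.weaken (by omega) fun f hf => by simp [hf.ne]
    refine Reaches.ite (fun hc => ?_) (fun hc => ?_)
    · simp only [Expr.eval, ht] at hc
      refine (ih₁ τ d ρ B σ₁ hρ h₁').mono (by omega) fun σ' h' => ?_
      simpa [AExp.ev, hc] using h'
    · simp only [Expr.eval, ht] at hc
      refine (ih₂ τ d ρ B σ₁ hρ h₁').mono (by omega) fun σ' h' => ?_
      simpa [AExp.ev, hc] using h'
  | sum x e ih =>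
    intro τ d ρ B σ hρ h
    refine Reaches.mono (T := 2 + (N * ((e.time.eval N + 4) + 12) + 20))
      (Reaches.seq (Q := Sim N (Function.update τ d 0) (d + 1) ρ I B) (Reaches.assign
        (by simp [Expr.cost]) (h.setTmp d _ (by simp [Expr.eval]) upd)) fun σ₁ h₁ => ?_)
      (by simp [AExp.time]; ring_nf; omega) (fun _ h => h)
    let v : ℕ → ℕ := fun i => e.ev N I (Function.update ρ x i) fun k => B (k + 1)
    let τs : ℕ → ℕ → ℕ := fun i => Function.update (Function.update (Function.update τ d
      (∑ j ∈ Finset.range i, v j)) (d + 1) (ρ x)) (d + 2) (N * ρ x)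
    refine (reaches_forLoop (τs := τs) (d' := d + 1 + 2) (fun _ I' B' => I' = I ∧ B' = B) le_rfl
      (fun f hf => ?_) rfl (fun i => ?_) ?_ ⟨rfl, rfl⟩ h₁).mono le_rfl ?_
    · have : f ≠ d + 1 ∧ f ≠ d + 2 := by omega
      by_cases hfd : f = d
      · subst hfd; simp [τs]
      · simp [τs, this, hfd]
    · simp [τs]
    · rintro i hi I' B' σ' ⟨rfl, rfl⟩ hS
      refine Reaches.seq (ih _ _ _ _ _ ?_ hS) fun σ₂ h₂ => Reaches.assign (by simp [Expr.cost])
        ⟨I', B', ⟨rfl, rfl⟩, h₂.setTmp d _ ?_ fun f hf hne => ⟨by omega, ?_⟩⟩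
      · intro y
        by_cases hy : y = x
        · subst hy; simpa using hi
        · simpa [hy] using hρ y
      · simp only [Expr.eval, h₂.tmp d (by omega), h₂.tmp (d + 1 + 2) (by omega)]
        simp [τs, Finset.sum_range_succ, v]
      · by_cases h3 : f = d + 2
        · subst h3; simp [τs]
        · by_cases h4 : f = d + 1
          · subst h4; simp [τs]
          · simp [τs, hne, h3, h4, show f ≠ d + 1 + 2 by omega]
    · rintro σ' ⟨I', B', ⟨rfl, rfl⟩, hS⟩
      refine hS.weaken le_rfl fun f hf => ?_
      by_cases hfd : f = d
      · subst hfd; simp [τs, AExp.ev, v]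
      · simp [τs, hfd, show f ≠ d + 1 ∧ f ≠ d + 2 by omega]

end RAM

/-! ### From commands to complete programs with polynomial running time. -/

namespace RAM

variable {N : ℕ} {τ τ' : ℕ → ℕ} {d d' : ℕ} {ρ : ℕ → ℕ} {I : ℕ → ℕ} {B : Arrays} {σ : State}

/-- Fill all entries of the array at position `q` of the memory by running `body`. -/
def fillLoop (d : ℕ) (body : Program) : Program :=
  forLoop 0 d (forLoop 1 (d + 2) body)

/-- When `body` runs, the target array is partly filled. Quantifying over its contents `F` demands
that the value written does not depend on them. -/
theorem reaches_fillLoop {q T : ℕ} {body : Program} (val : ℕ → ℕ → ℕ)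
    (hbody : ∀ i < N, ∀ j < N, ∀ τ F σ,
      Sim N τ (d + 4) (Function.update (Function.update ρ 0 i) 1 j) I (Function.update B q F) σ →
      Reaches body σ T (Sim N τ (d + 4) (Function.update (Function.update ρ 0 i) 1 j) I
        (Function.update B q (Function.update F i (Function.update (F i) j (val i j))))))
    (h : Sim N τ d ρ I B σ) :
    Reaches (fillLoop d body) σ (N * (N * (T + 12) + 32) + 20)
      (Sim N τ d ρ I (Function.update B q val)) := by
  let τ₀ : ℕ → ℕ := Function.update (Function.update τ d (ρ 0)) (d + 1) (N * ρ 0)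
  let P : ℕ → ℕ → (ℕ → ℕ) → Arrays → Prop := fun i j I' B' => I' = I ∧
    ∃ F, B' = Function.update B q F ∧
      ∀ i' < N, ∀ j' < N, (i' < i ∨ (i' = i ∧ j' < j)) → F i' j' = val i' j'
  refine (reaches_forLoop (τs := fun _ => τ₀) (d' := d + 2) (T := N * (T + 12) + 20)
    (fun i => P i 0) le_rfl (fun e he => ?_) rfl (fun _ => ?_) ?_ ⟨rfl, B q, by simp, ?_⟩ h).mono
    (by nlinarith) ?_
  · simp [τ₀, show e ≠ d + 1 ∧ e ≠ d by omega]
  · simp [τ₀]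
  · intro i hi I₁ B₁ σ₁ hQ h₁
    let τ₁ : ℕ → ℕ := Function.update (Function.update τ₀ (d + 2)
      (Function.update ρ 0 i 1)) (d + 3) (N * (Function.update ρ 0 i 1))
    refine (reaches_forLoop (τs := fun _ => τ₁) (d' := d + 4) (T := T)
      (fun j => P i j) le_rfl (fun e he => ?_) rfl (fun _ => ?_) ?_ hQ h₁).mono
      le_rfl ?_
    · simp [τ₁, show e ≠ d + 3 ∧ e ≠ d + 2 by omega]
    · simp [τ₁]
    · rintro j hj I₂ B₂ σ₂ ⟨rfl, F, rfl, hF⟩ h₂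
      refine (hbody i hi j hj _ F _ h₂).mono le_rfl fun σ₃ h₃ => ⟨_, _, ⟨rfl, _, rfl, ?_⟩, h₃⟩
      intro i' hi' j' hj' hij
      by_cases h4 : i' = i
      · subst h4
        by_cases h5 : j' = j
        · subst h5; simp
        · simpa [h5] using hF i' hi' j' hj' (by omega)
      · simpa [h4] using hF i' hi' j' hj' (by omega)
    · rintro σ₂ ⟨I₂, B₂, ⟨rfl, F, rfl, hF⟩, h₂⟩
      refine ⟨_, _, ⟨rfl, F, rfl, fun i' hi' j' hj' hij => hF i' hi' j' hj' (by omega)⟩, h₂.weaken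
        le_rfl fun e he => ?_⟩
      simp [τ₁, show e ≠ d + 3 ∧ e ≠ d + 2 by omega]
  · intro i' _ j' _ h'; omega
  · rintro σ₂ ⟨I₂, B₂, ⟨rfl, F, rfl, hF⟩, h₂⟩
    have h₃ := h₂.weaken (d' := d) (τ' := τ) le_rfl fun e he => by
      simp [τ₀, show e ≠ d + 1 ∧ e ≠ d by omega]
    -- The filled array agrees with `val` only at indices below `N`, which is all that `cell` sees.
    refine ⟨h₃.bound, h₃.size, h₃.var, h₃.row, h₃.tmp, fun k i j hi hj => ?_, h₃.input⟩
    rw [h₃.cell k i j hi hj]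
    by_cases hk : k = q
    · subst hk; simpa using hF i hi j hj (by omega)
    · simp [hk]

/-- The expression of an assignment may read the array being assigned. All entries are therefore
computed into the buffer and copied afterwards. -/
def Cmd.compile : Cmd → ℕ → Program
  | .assign k e, d => .seq
      (fillLoop d <| .seq (e.compile (d + 4)) (.store (addrExpr 0 0 1) (.reg (3 * (d + 4) + 4))))
      (fillLoop d <| .store (addrExpr (k + 1) 0 1) (.load (addrExpr 0 0 1)))
  | .seq c₁ c₂, d => .seq (c₁.compile d) (c₂.compile d)
  | .loop x c, d => forLoop x d (c.compile (d + 2))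

open Polynomial in
noncomputable def Cmd.time : Cmd → Polynomial ℕ
  | .assign k e =>
      (X * (X * (e.time + C ((addrExpr 0 0 0).cost + 14)) + C 32) + C 20) +
      (X * (X * C ((addrExpr (k + 1) 0 0).cost + (addrExpr 0 0 0).cost + 14) + C 32) + C 20)
  | .seq c₁ c₂ => c₁.time + c₂.time
  | .loop _ c => X * (c.time + C 12) + C 20

theorem update_lt (hρ : ∀ x, ρ x < N) {x i : ℕ} (hi : i < N) (y : ℕ) :
    Function.update ρ x i y < N := by
  by_cases hy : y = x
  · subst hy; simpa using hi
  · simpa [hy] using hρ y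

/-- The buffer at position `0` keeps arbitrary leftovers; only the shifted arrays are compared with
the semantics. -/
theorem Cmd.reaches_compile (hI : ∀ a, N * N ≤ a → I a = 0) (c : Cmd) :
    ∀ (τ : ℕ → ℕ) (d : ℕ) (ρ : ℕ → ℕ) (B : Arrays) (σ : State), (∀ x, ρ x < N) →
      Sim N τ d ρ I B σ → Reaches (c.compile d) σ (c.time.eval N) fun σ' =>
        ∃ B', (fun k => B' (k + 1)) = c.exec N I ρ (fun k => B (k + 1)) ∧
          Sim N τ d ρ I B' σ' := by
  induction c with
  | assign k e =>
    intro τ d ρ B σ hρ h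
    set val : ℕ → ℕ → ℕ := fun i j =>
      e.ev N I (Function.update (Function.update ρ 0 i) 1 j) fun k => B (k + 1) with hval
    refine (Reaches.seq (reaches_fillLoop (q := 0) (T := e.time.eval N +
      ((addrExpr 0 0 0).cost + 2)) val ?_ h) fun σ₁ h₁ => reaches_fillLoop (q := k + 1)
        (T := (addrExpr (k + 1) 0 0).cost + (addrExpr 0 0 0).cost + 2) val ?_ h₁).mono
        (by simp [Cmd.time]; ring_nf; omega) fun σ₂ h₂ => ⟨_, ?_, h₂⟩
    · intro i hi j hj τ F σ₁ h₁
      refine Reaches.seq (AExp.reaches_compile hI e _ _ _ _ _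
        (update_lt (update_lt hρ hi) hj) h₁) fun σ₂ h₂ => Reaches.store (by simp [Expr.cost, addrExpr_cost 0 0 1]) ?_
      have h3 := h₂.tmp (d + 4) (by omega)
      simp only [Function.update_self] at h3
      have h4 := h₂.setCell (q := 0) hi hj (val i j)
      simp only [Function.update_self, Function.update_idem] at h4
      rw [h₂.addrExpr_eval]
      simp only [Expr.eval, h3]
      simpa [val] using h4.weaken (d' := d + 4) (τ' := τ) (by omega)
        fun e he => by simp [show e ≠ d + 4 by omega]
    · intro i hi j hj τ F σ₁ h₁
      refine Reaches.store (by simp [Expr.cost, addrExpr_cost (k + 1) 0 1, addrExpr_cost 0 0 1];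
                               omega) ?_
      have h4 := h₁.setCell (q := k + 1) hi hj (val i j)
      simp only [Function.update_self, Function.update_idem] at h4
      rw [h₁.addrExpr_eval]
      have h5 : (Expr.load (addrExpr 0 0 1)).eval σ₁ = val i j := by
        simpa [Expr.eval, h₁.addrExpr_eval] using h₁.cell 0 i j hi hj
      rw [h5]
      simpa using h4
    · simp only [Cmd.exec]
      funext q
      by_cases hq : q = k
      · subst hq; simp [val]
      · simp [hq]
  | seq c₁ c₂ ih₁ ih₂ =>
    intro τ d ρ B σ hρ h
    refine (Reaches.seq (ih₁ τ d ρ B σ hρ h) (T₂ := c₂.time.eval N) ?_).mono (by simp [Cmd.time])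
      (fun _ h => h)
    rintro σ₁ ⟨B₁, hB₁, h₁⟩
    refine (ih₂ τ d ρ B₁ σ₁ hρ h₁).mono le_rfl ?_
    rintro σ₂ ⟨B₂, hB₂, h₂⟩
    exact ⟨B₂, by rw [hB₂, hB₁, Cmd.exec], h₂⟩
  | loop x c ih =>
    intro τ d ρ B σ hρ h
    let τ₀ : ℕ → ℕ := Function.update (Function.update τ d (ρ x)) (d + 1) (N * ρ x)
    refine (reaches_forLoop (τs := fun _ => τ₀) (d' := d + 2) (T := c.time.eval N)
      (fun i I' B' => I' = I ∧ (fun k => B' (k + 1)) = iter (fun i A => c.exec N I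
        (Function.update ρ x i) A) (fun k => B (k + 1)) i) le_rfl (fun e he => ?_) rfl (fun _ => ?_)
        ?_ ⟨rfl, rfl⟩ h).mono (by simp [Cmd.time]) ?_
    · simp [τ₀, show e ≠ d + 1 ∧ e ≠ d by omega]
    · simp [τ₀]
    · rintro i hi _ B₁ σ₁ ⟨rfl, hB₁⟩ h₁
      refine (ih _ _ _ B₁ σ₁ (update_lt hρ hi) h₁).mono le_rfl ?_
      rintro σ₂ ⟨B₂, hB₂, h₂⟩
      exact ⟨_, B₂, ⟨rfl, by rw [hB₂, hB₁, iter]⟩, h₂⟩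
    · rintro σ₁ ⟨_, B₁, ⟨rfl, hB₁⟩, h₁⟩
      exact ⟨B₁, by rw [hB₁, Cmd.exec], h₁.weaken le_rfl fun e he => by
        simp [τ₀, show e ≠ d + 1 ∧ e ≠ d by omega]⟩

/-- Copy row `0` of array `k` to the memory cells `0, …, N - 1`. -/
def outputLoop (k : ℕ) : Program :=
  forLoop 0 0 (.store (.reg 2) (.load (addrExpr (k + 1) 1 0)))

/-- Variable `1` has value `0` and serves as the row index; variable `0`, kept in register `2`, is
both the column and the target address. -/
theorem reaches_outputLoop (k : ℕ) (hρ : ρ 1 = 0) (h : Sim N τ 0 ρ I B σ) :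
    Reaches (outputLoop k) σ (N * ((addrExpr (k + 1) 0 0).cost + 15) + 20)
      fun σ' => ∀ t < N, σ'.mem t = B (k + 1) 0 t := by
  let τ₀ : ℕ → ℕ := Function.update (Function.update τ 0 (ρ 0)) 1 (N * ρ 0)
  refine (reaches_forLoop (τs := fun _ => τ₀) (d' := 2) (T := (addrExpr (k + 1) 0 0).cost + 3)
    (fun i I' B' => B' = B ∧ ∀ t < i, I' t = B (k + 1) 0 t) le_rfl (fun e he => by omega) rfl
    (fun _ => by simp [τ₀]) ?_ ⟨rfl, fun t ht => by omega⟩ h).mono (by simp) ?_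
  · rintro i hi I₁ B₁ σ₁ ⟨rfl, hI₁⟩ h₁
    have hv : σ₁.reg 2 = i := by simpa using h₁.var 0
    have hN : i < N * N := by nlinarith
    refine Reaches.store (by simp [Expr.cost, addrExpr_cost (k + 1) 1 0]; omega)
      ⟨Function.update I₁ i (B₁ (k + 1) 0 i), B₁, ⟨rfl, fun t ht => ?_⟩, ?_⟩
    · by_cases hti : t = i
      · subst hti; simp
      · simpa [hti] using hI₁ t (by omega)
    · have := h₁.setInput hN (B₁ (k + 1) 0 i)
      have h5 : (Expr.load (addrExpr (k + 1) 1 0)).eval σ₁ = B₁ (k + 1) 0 i := by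
        have h6 := h₁.cell (k + 1) 0 i (by omega) hi
        simpa [Expr.eval, h₁.addrExpr_eval, hρ] using h6
      rw [h5]
      simpa only [Expr.eval, hv] using this
  · rintro σ₁ ⟨I₁, B₁, ⟨rfl, hI₁⟩, h₁⟩ t ht
    rw [h₁.input t (by nlinarith), hI₁ t ht]

/-- Register `r` is set to the product of the registers `a` and `b`; register `a` is cleared. -/
def mulReg (r a b : ℕ) : Program :=
  .seq (.assign r (.const 0)) <| .while (.reg a) <|
    .seq (.assign r (.add (.reg r) (.reg b))) (.assign a (.sub (.reg a) (.const 1)))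

/-- Repeated addition takes time linear in the value of a factor. This is affordable because the
loop bound is itself polynomial in `n + m`. -/
theorem reaches_mulReg (σ : State) {r a b : ℕ} (hra : r ≠ a) (hrb : r ≠ b) (hab : a ≠ b) :
    Reaches (mulReg r a b) σ (σ.reg a * 10 + 4) fun σ' =>
      σ' = { σ with reg := Function.update (Function.update σ.reg r (σ.reg a * σ.reg b)) a 0 } := by
  let S : ℕ → State := fun i =>
    { σ with reg := Function.update (Function.update σ.reg r (i * σ.reg b)) a (σ.reg a - i) }
  refine (Reaches.seq (T₁ := 2) (T₂ := σ.reg a * 10 + 2) (Q := fun σ' => σ' = S 0)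
    (Reaches.assign (by simp [Expr.cost]) ?_) ?_).mono (by omega) (fun _ h => h)
  · simp only [S, Expr.eval]
    congr 1
    funext q
    by_cases hq : q = a
    · subst hq; simp [Function.update_of_ne hra.symm]
    · simp [hq]
  · rintro _ rfl
    refine (Reaches.while (T := 8) (σ.reg a) (fun i σ' => σ' = S i) ?_ ?_ _ rfl).mono
      (by simp [Expr.cost]) ?_
    · rintro i hi _ rfl
      simp [S, Expr.eval]
      omega
    · rintro i hi _ rfl
      refine (Reaches.seq (T₁ := 4) (T₂ := 4) (Reaches.assign (Q := fun σ' => σ' = _)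
        (by simp [Expr.cost]) rfl) ?_).mono le_rfl (fun _ h => h)
      rintro _ rfl
      refine Reaches.assign (by simp [Expr.cost]) ?_
      simp only [S, Expr.eval]
      congr 1
      funext q
      by_cases hq : q = a
      · subst hq; simp [Function.update_of_ne hra.symm]; omega
      · by_cases hqr : q = r
        · subst hqr
          simp [hq, hab.symm, hrb.symm, Nat.succ_mul]
        · simp [hq, hqr]
    · rintro _ rfl
      simp [S]

/-- The loop bound for inputs of size `s`. -/
def loopBound (s : ℕ) : ℕ := (s + 2) * (2 * (s + 2))

/-- Put the loop bound and its square into the registers `0` and `1`. -/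
def prelude : Program :=
  .seq (.assign 4 (.add (.add (.load (.const 0)) (.load (.const 1))) (.const 2))) <|
  .seq (.assign 7 (.add (.reg 4) (.reg 4))) <|
  .seq (mulReg 0 4 7) <|
  .seq (.assign 4 (.reg 0)) <|
  .seq (mulReg 1 4 0) (.assign 7 (.const 0))

/-- The length bound confines the input to the first `N * N` cells, so all arrays start out zero. -/
theorem reaches_prelude (input : List ℕ)
    (hlen : input.length ≤ loopBound (input.getD 0 0 + input.getD 1 0)) :
    Reaches prelude (initialState input)
      ((input.getD 0 0 + input.getD 1 0 + 2) * 10 +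
        loopBound (input.getD 0 0 + input.getD 1 0) * 10 + 40)
      (Sim (loopBound (input.getD 0 0 + input.getD 1 0)) (fun _ => 0) 0 (fun _ => 0)
        (fun i => input.getD i 0) (fun _ _ _ => 0)) := by
  set s := input.getD 0 0 + input.getD 1 0 with hs
  have hN : 0 < loopBound s := by unfold loopBound; positivity
  refine (Reaches.seq (Reaches.assign (T := 8) (Q := fun σ' => σ' = _) (by simp [Expr.cost]) rfl)
    (T₂ := 4 + (((s + 2) * 10 + 4) + (2 + ((loopBound s * 10 + 4) + 2)))) ?_).mono (by omega)
    (fun _ h => h)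
  rintro _ rfl
  refine Reaches.seq (Reaches.assign (Q := fun σ' => σ' = _) (by simp [Expr.cost]) rfl) ?_
  rintro _ rfl
  refine Reaches.seq ((reaches_mulReg _ (by decide) (by decide) (by decide)).mono ?_
    (fun _ h => h)) ?_
  · simp [Expr.eval, initialState, hs]
  rintro _ rfl
  refine Reaches.seq (Reaches.assign (Q := fun σ' => σ' = _) (by simp [Expr.cost]) rfl) ?_
  rintro _ rfl
  refine Reaches.seq ((reaches_mulReg _ (by decide) (by decide) (by decide)).mono ?_
    (fun _ h => h)) ?_
  · simp [Expr.eval, initialState, loopBound, hs]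
    nlinarith
  rintro _ rfl
  refine Reaches.assign (by simp [Expr.cost]) ?_
  have hv : (s + 2) * (s + 2 + (s + 2)) = loopBound s := by unfold loopBound; ring
  simp only [Expr.eval, initialState, Function.update_self, ← hs]
  refine ⟨?_, ?_, fun x => ?_, fun x => ?_, fun e he => by omega, fun k i j hi hj => ?_,
    fun a ha => rfl⟩
  · simpa [Function.update_apply] using hv
  · simp [hv]
  · simp only [Function.update_apply]
    split_ifs <;> first | rfl | omega
  · simp only [Function.update_apply, mul_zero]
    split_ifs <;> first | rfl | omega
  · simp only
    rw [List.getD_eq_default]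
    nlinarith [Nat.zero_le (k * (loopBound s * loopBound s))]

open Polynomial in
/-- What the array language computes with loop bound `loopBound s`, where `s` is the sum of the first
two inputs, is computed by a random access machine in time polynomial in `s`. -/
theorem exists_program (c : Cmd) (k : ℕ) : ∃ (p : Program) (T : Polynomial ℕ),
    ∀ (input output : List ℕ) (s : ℕ), s = input.getD 0 0 + input.getD 1 0 →
      input.length ≤ loopBound s → output.length ≤ loopBound s →
      (∀ (t : ℕ) (ht : t < output.length), c.exec (loopBound s) (fun i => input.getD i 0)
        (fun _ => 0) (fun _ _ _ => 0) k 0 t = output[t]) →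
      OutputsWithin p input output (T.eval s) := by
  let NN : Polynomial ℕ := (X + C 2) * (C 2 * (X + C 2))
  refine ⟨.seq prelude (.seq (c.compile 0) (outputLoop k)),
    ((X + C 2) * C 10 + NN * C 10 + C 40) + (c.time.comp NN +
      (NN * C ((addrExpr (k + 1) 0 0).cost + 15) + C 20)), ?_⟩
  intro input output s hs hin hout hexec
  subst hs
  set N := loopBound (input.getD 0 0 + input.getD 1 0) with hNdef
  have hN : 0 < N := by rw [hNdef]; unfold loopBound; positivity
  have hI : ∀ a, N * N ≤ a → (fun i => input.getD i 0) a = 0 := fun a ha =>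
    List.getD_eq_default _ _ (by nlinarith)
  have key := Reaches.seq (reaches_prelude input hin) fun σ₁ h₁ =>
    Reaches.seq (T₂ := N * ((addrExpr (k + 1) 0 0).cost + 15) + 20)
      (Q' := fun σ' => ∀ t < N, σ'.mem t = c.exec N (fun i => input.getD i 0)
        (fun _ => 0) (fun _ _ _ => 0) k 0 t)
      (c.reaches_compile hI _ _ _ _ σ₁ (fun _ => hN) h₁) (by
        rintro σ₂ ⟨B, hB, h₂⟩
        refine (reaches_outputLoop k rfl h₂).mono le_rfl fun σ₃ h₃ t ht => ?_
        rw [h₃ t ht, ← hB])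
  obtain ⟨t, ht, σ', hr, hq⟩ := key
  refine ⟨t, σ', ht.trans (le_of_eq ?_), hr, fun i hi => by rw [hq i (by omega), hexec i hi]⟩
  have : NN.eval (input.getD 0 0 + input.getD 1 0) = N := by simp [NN, hNdef, loopBound]
  simp only [eval_add, eval_mul, eval_comp, this, eval_X, eval_C]
  rfl

/-! ### Reasoning about the array language -/

theorem iter_induction {α : Type*} {f : ℕ → α → α} {a : α} (P : ℕ → α → Prop) (n : ℕ) (h0 : P 0 a)
    (hs : ∀ i < n, ∀ b, P i b → P (i + 1) (f i b)) : P n (iter f a n) := by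
  suffices ∀ k ≤ n, P k (iter f a k) from this n le_rfl
  intro k hk
  induction k with
  | zero => exact h0
  | succ k ih => exact hs k (by omega) _ (ih (by omega))

/-- Whether array `k` is assigned to. -/
def Cmd.Writes (k : ℕ) : Cmd → Prop
  | .assign k' _ => k = k'
  | .seq c₁ c₂ => c₁.Writes k ∨ c₂.Writes k
  | .loop _ c => c.Writes k

/-- The frame rule: it carries the results of one stage of an algorithm unchanged through the later
stages. -/
theorem Cmd.exec_of_not_writes {c : Cmd} {k : ℕ} (h : ¬ c.Writes k) (A : Arrays) (ρ : ℕ → ℕ) :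
    c.exec N I ρ A k = A k := by
  induction c generalizing A ρ with
  | assign k' e => exact Function.update_of_ne h _ _
  | seq c₁ c₂ ih₁ ih₂ =>
    simp only [Cmd.Writes, not_or] at h
    rw [Cmd.exec, ih₂ h.2, ih₁ h.1]
  | loop x c ih =>
    exact iter_induction (fun _ A' => A' k = A k) N rfl fun i _ b hb => (ih h b _).trans hb

end RAM

/-! ### Products of operators, and their action on amplitudes -/

theorem Bits.add_self {n : ℕ} (x : Bits n) : x + x = 0 := by
  funext i; exact CharTwo.add_self_eq_zero _

theorem Bits.add_add_cancel {n : ℕ} (x y : Bits n) : x + y + y = x := by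
  rw [add_assoc, Bits.add_self, add_zero]

theorem Bits.eq_add_iff {n : ℕ} (x y a : Bits n) : x = y + a ↔ y = x + a := by
  constructor <;> rintro rfl <;> rw [Bits.add_add_cancel]

theorem zmod2_cases (x : ZMod 2) : x = 0 ∨ x = 1 := by
  revert x; decide

theorem pauliX_pow_mul_diagonal (a : ZMod 2) (f : ZMod 2 → ℂ) (x y : ZMod 2) :
    (pauliX ^ a.val * Matrix.diagonal f) x y = if x = y + a then f y else 0 := by
  rcases zmod2_cases a with rfl | rfl
  · by_cases h : x = y
    · subst h; simp
    · simp [h]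
  · simp [pauliX, ZMod.val_one, Matrix.mul_diagonal]

theorem tensorOp_mulVec {n : ℕ} (a : Bits n) (f : Fin n → ZMod 2 → ℂ) (φ : QVec n) (x : Bits n) :
    (tensorOp fun i => pauliX ^ (a i).val * Matrix.diagonal (f i)).mulVec φ x =
      (∏ i, f i ((x + a) i)) * φ (x + a) := by
  simp only [Matrix.mulVec, dotProduct, tensorOp, Matrix.of_apply, pauliX_pow_mul_diagonal,
    Finset.prod_ite_zero, Finset.mem_univ, true_implies]
  rw [Finset.sum_eq_single (x + a)]
  · rw [if_pos]
    intro i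
    exact congrFun (Bits.add_add_cancel x a).symm i
  · intro y _ hy
    rw [if_neg, zero_mul]
    exact fun h => hy ((Bits.eq_add_iff x y a).1 (funext h))
  · simp

theorem gateS_pow (b : ℕ) :
    gateS ^ b = Matrix.diagonal fun x => Complex.I ^ (b * x.val) := by
  rw [gateS, Matrix.diagonal_pow]
  congr 1
  funext x
  rcases zmod2_cases x with rfl | rfl <;> simp [ZMod.val_one]

theorem pauliZ_pow (b : ℕ) :
    pauliZ ^ b = Matrix.diagonal fun x => (-1) ^ (b * x.val) := by
  rw [pauliZ, Matrix.diagonal_pow]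
  congr 1
  funext x
  rcases zmod2_cases x with rfl | rfl <;> simp [ZMod.val_one]

/-- The eigenvalue of `α^s S(b)` at the basis vector `x`. -/
noncomputable def XSOp.phase {n : ℕ} (g : XSOp n) (x : Bits n) : ℂ :=
  alphaPhase ^ g.s.val * ∏ l, Complex.I ^ ((g.b l).val * (x l).val)

/-- The eigenvalue of `i^s Z(b)` at the basis vector `x`. -/
noncomputable def PauliOp.phase {n : ℕ} (g : PauliOp n) (x : Bits n) : ℂ :=
  Complex.I ^ g.s.val * ∏ l, (-1) ^ ((g.b l).val * (x l).val)

theorem XSOp.mulVec_toMatrix {n : ℕ} (g : XSOp n) (φ : QVec n) (x : Bits n) :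
    g.toMatrix.mulVec φ x = g.phase (x + g.a) * φ (x + g.a) := by
  rw [XSOp.toMatrix, opX, opS, tensorOp_mul, Matrix.smul_mulVec, Pi.smul_apply]
  simp only [gateS_pow]
  rw [tensorOp_mulVec, XSOp.phase, smul_eq_mul, mul_assoc]

theorem PauliOp.mulVec_toMatrix {n : ℕ} (g : PauliOp n) (φ : QVec n) (x : Bits n) :
    g.toMatrix.mulVec φ x = g.phase (x + g.a) * φ (x + g.a) := by
  rw [PauliOp.toMatrix, opX, opZ, tensorOp_mul, Matrix.smul_mulVec, Pi.smul_apply]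
  simp only [pauliZ_pow]
  rw [tensorOp_mulVec, PauliOp.phase, smul_eq_mul, mul_assoc]

theorem alphaPhase_sq : alphaPhase ^ 2 = Complex.I := by
  have h : ((2 : ℕ) : ℂ) * (Complex.I * (Real.pi / 4)) = Real.pi / 2 * Complex.I := by
    push_cast
    ring
  rw [alphaPhase, ← Complex.exp_nat_mul, h, Complex.exp_pi_div_two_mul_I]

theorem alphaPhase_pow_four : alphaPhase ^ 4 = -1 := by
  rw [show 4 = 2 * 2 from rfl, pow_mul, alphaPhase_sq, Complex.I_sq]

theorem alphaPhase_pow_eight : alphaPhase ^ 8 = 1 := by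
  rw [show 8 = 4 * 2 from rfl, pow_mul, alphaPhase_pow_four]; norm_num

theorem norm_alphaPhase : ‖alphaPhase‖ = 1 := by
  have h : ‖alphaPhase‖ ^ 8 = 1 := by rw [← norm_pow, alphaPhase_pow_eight, norm_one]
  exact (pow_eq_one_iff_of_nonneg (norm_nonneg _) (by norm_num)).1 h

/-- `s ↦ α^s` -/
noncomputable def chiEight : AddChar (ZMod 8) ℂ := AddChar.zmodChar 8 alphaPhase_pow_eight

/-- `s ↦ i^s` -/
noncomputable def chiFour : AddChar (ZMod 4) ℂ := AddChar.zmodChar 4 Complex.I_pow_four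

theorem AddChar.map_sum_eq_prod {ι A M : Type*} [AddCommMonoid A] [CommMonoid M] (ψ : AddChar A M)
    (f : ι → A) (s : Finset ι) : ψ (∑ i ∈ s, f i) = ∏ i ∈ s, ψ (f i) := by
  classical
  induction s using Finset.induction_on with
  | empty => simp
  | insert a s ha ih => rw [Finset.sum_insert ha, Finset.prod_insert ha, ψ.map_add_eq_mul, ih]

theorem chiEight_two_mul (b : ZMod 4) : chiEight (2 * (b.val : ZMod 8)) = chiFour b := by
  have : (2 * (b.val : ZMod 8)) = ((2 * b.val : ℕ) : ZMod 8) := by push_cast; rfl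
  rw [this, chiEight, AddChar.zmodChar_apply', chiFour, AddChar.zmodChar_apply, pow_mul,
    alphaPhase_sq]

/-! ### The product of operators in terms of exponents, and properties inherited by products. -/

namespace XSOp

variable {n : ℕ}

theorem phase_eq (g : XSOp n) (x : Bits n) :
    g.phase x = chiEight g.s * ∏ l, (chiFour (g.b l)) ^ (x l).val := by
  simp only [phase, chiEight, chiFour, AddChar.zmodChar_apply, pow_mul]

theorem norm_phase (g : XSOp n) (x : Bits n) : ‖g.phase x‖ = 1 := by
  simp [phase, norm_alphaPhase]

theorem phase_ne_zero (g : XSOp n) (x : Bits n) : g.phase x ≠ 0 := by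
  intro h
  have := g.norm_phase x
  simp [h] at this

instance : One (XSOp n) := ⟨⟨0, 0, 0⟩⟩

/-- Since `S^b X = i^b X S^(-b)` and `i = α²`, moving `S`-factors past an `X` on qubit `l` negates
the exponent `b l` and contributes `2 * b l` to the exponent of `α`. -/
instance : Mul (XSOp n) := ⟨fun g h =>
  ⟨g.s + h.s + ∑ l, if h.a l = 0 then 0 else 2 * ((g.b l).val : ZMod 8), g.a + h.a,
    fun l => (if h.a l = 0 then g.b l else -g.b l) + h.b l⟩⟩

@[simp] theorem one_s : (1 : XSOp n).s = 0 := rfl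
@[simp] theorem one_a : (1 : XSOp n).a = 0 := rfl
@[simp] theorem one_b : (1 : XSOp n).b = 0 := rfl
@[simp] theorem mul_a (g h : XSOp n) : (g * h).a = g.a + h.a := rfl

theorem mul_s (g h : XSOp n) : (g * h).s =
    g.s + h.s + ∑ l, if h.a l = 0 then 0 else 2 * ((g.b l).val : ZMod 8) := rfl

theorem mul_b (g h : XSOp n) (l : Fin n) :
    (g * h).b l = (if h.a l = 0 then g.b l else -g.b l) + h.b l := rfl

@[simp] theorem phase_one (x : Bits n) : (1 : XSOp n).phase x = 1 := by
  simp [phase]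

theorem phase_mul (g h : XSOp n) (x : Bits n) :
    (g * h).phase x = g.phase (x + h.a) * h.phase x := by
  simp only [phase_eq, mul_s, mul_b, AddChar.map_add_eq_mul, AddChar.map_sum_eq_prod, Pi.add_apply]
  have key : ∀ l, chiEight (if h.a l = 0 then 0 else 2 * ((g.b l).val : ZMod 8)) *
      (chiFour (if h.a l = 0 then g.b l else -g.b l) * chiFour (h.b l)) ^ (x l).val =
      chiFour (g.b l) ^ (x l + h.a l).val * chiFour (h.b l) ^ (x l).val := by
    intro l
    have hinv : chiFour (g.b l) * chiFour (-g.b l) = 1 := by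
      rw [← AddChar.map_add_eq_mul, add_neg_cancel, AddChar.map_zero_eq_one]
    rcases zmod2_cases (h.a l) with h1 | h1 <;> rcases zmod2_cases (x l) with h2 | h2
    · simp [h1, h2]
    · simp [h1, h2, ZMod.val_one]
    · simp [h1, h2, ZMod.val_one, chiEight_two_mul, -ZMod.natCast_val]
    · simp [h1, h2, ZMod.val_one, chiEight_two_mul, -ZMod.natCast_val, ← mul_assoc, hinv,
        show (1 + 1 : ZMod 2) = 0 from rfl]
  calc _ = chiEight g.s * chiEight h.s * ∏ l,
        (chiEight (if h.a l = 0 then 0 else 2 * ((g.b l).val : ZMod 8)) *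
        (chiFour (if h.a l = 0 then g.b l else -g.b l) * chiFour (h.b l)) ^ (x l).val) := by
        rw [Finset.prod_mul_distrib]; ring
    _ = _ := by
        rw [Finset.prod_congr rfl fun l _ => key l, Finset.prod_mul_distrib]; ring

theorem toMatrix_mul (g h : XSOp n) : (g * h).toMatrix = g.toMatrix * h.toMatrix := by
  refine Matrix.mulVec_injective (funext fun φ => funext fun x => ?_)
  rw [← Matrix.mulVec_mulVec, mulVec_toMatrix, mulVec_toMatrix, mulVec_toMatrix, phase_mul, mul_a,
    ← add_assoc, Bits.add_add_cancel, mul_assoc]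

theorem toMatrix_one : (1 : XSOp n).toMatrix = 1 := by
  refine Matrix.mulVec_injective (funext fun φ => funext fun x => ?_)
  rw [mulVec_toMatrix]
  simp

/-- The amplitude form of `g ψ = ψ`. -/
def Fixes (g : XSOp n) (ψ : QVec n) : Prop :=
  ∀ y, ψ (y + g.a) = g.phase y * ψ y

theorem fixes_iff (g : XSOp n) (ψ : QVec n) : g.Fixes ψ ↔ g.toMatrix.mulVec ψ = ψ := by
  constructor
  · intro h
    funext x
    rw [mulVec_toMatrix, ← h, Bits.add_add_cancel]
  · intro h y
    conv_lhs => rw [← h]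
    rw [mulVec_toMatrix, Bits.add_add_cancel]

/-- Properties that hold for the identity and are inherited by products and right quotients. -/
structure Stable (P : XSOp n → Prop) : Prop where
  one : P 1
  mul : ∀ {g h}, P g → P h → P (g * h)
  of_mul : ∀ {g h}, P (g * h) → P h → P g

theorem stable_fixes (ψ : QVec n) : Stable fun g : XSOp n => g.Fixes ψ where
  one y := by simp
  mul {g h} hg hh y := by
    rw [mul_a, phase_mul, add_comm g.a, ← add_assoc, hg, hh, mul_assoc]
  of_mul {g h} hgh hh y := by
    have h1 := hgh (y + h.a)
    have h2 := hh (y + h.a)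
    rw [Bits.add_add_cancel] at h2
    rw [mul_a, phase_mul, Bits.add_add_cancel, mul_assoc, ← h2, add_assoc,
      add_comm g.a, ← add_assoc h.a, Bits.add_self, zero_add] at h1
    exact h1

theorem stable_a_mem (L : Submodule (ZMod 2) (Bits n)) : Stable fun g : XSOp n => g.a ∈ L where
  one := L.zero_mem
  mul hg hh := L.add_mem hg hh
  of_mul hgh hh := by simpa using L.sub_mem hgh hh

theorem unit_mul (g h : XSOp n) : (g * h).isUnit_toMatrix.unit =
    g.isUnit_toMatrix.unit * h.isUnit_toMatrix.unit :=
  Units.ext (by simp [toMatrix_mul])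

theorem stable_mem_group (G : Subgroup (QOp n)ˣ) :
    Stable fun g : XSOp n => g.isUnit_toMatrix.unit ∈ G where
  one := by
    have : (1 : XSOp n).isUnit_toMatrix.unit = 1 := Units.ext (by simp [toMatrix_one])
    rw [this]; exact G.one_mem
  mul hg hh := by rw [unit_mul]; exact G.mul_mem hg hh
  of_mul {g h} hgh hh := by
    rw [unit_mul] at hgh
    exact (G.mul_mem_cancel_right hh).1 hgh

/-- The equation `a · x = s` over the field with two elements. -/
def Sat (x : Bits n) (g : XSOp n) : Prop :=
  (ZMod.castHom (show 2 ∣ 8 by norm_num) (ZMod 2)) g.s = ∑ l, g.a l * x l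

/-- The phase correction in a product is even, so `s` modulo 2 is additive, as is `a`. Elimination
on operators therefore also solves linear systems over the field with two elements. -/
theorem stable_sat (x : Bits n) : Stable (Sat x) := by
  have hs : ∀ g h : XSOp n, (ZMod.castHom (show 2 ∣ 8 by norm_num) (ZMod 2)) (g * h).s =
      (ZMod.castHom (show 2 ∣ 8 by norm_num) (ZMod 2)) g.s +
      (ZMod.castHom (show 2 ∣ 8 by norm_num) (ZMod 2)) h.s := by
    intro g h
    rw [mul_s, map_add, map_add, map_sum, Finset.sum_eq_zero, add_zero]
    intro l _
    split_ifs
    · simp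
    · rw [map_mul, show (ZMod.castHom (show 2 ∣ 8 by norm_num) (ZMod 2)) 2 = 0 from rfl, zero_mul]
  have ha : ∀ g h : XSOp n, ∑ l, (g * h).a l * x l = ∑ l, g.a l * x l + ∑ l, h.a l * x l := by
    intro g h
    simp only [mul_a, Pi.add_apply, add_mul, Finset.sum_add_distrib]
  refine ⟨by simp [Sat], fun {g h} h1 h2 => ?_, fun {g h} h1 h2 => ?_⟩
  · rw [Sat, hs, ha, h1, h2]
  · rw [Sat, hs, ha, ← h2] at h1
    exact add_right_cancel h1

/-! ### Gauss–Jordan elimination -/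

/-- The `X`-exponents, indexed by natural numbers. -/
def bit (g : XSOp n) (i : ℕ) : ZMod 2 := if h : i < n then g.a ⟨i, h⟩ else 0

/-- The `S`-exponents, indexed by natural numbers. -/
def sbit (g : XSOp n) (i : ℕ) : ZMod 4 := if h : i < n then g.b ⟨i, h⟩ else 0

@[simp] theorem bit_one (i : ℕ) : (1 : XSOp n).bit i = 0 := by simp [bit]
@[simp] theorem sbit_one (i : ℕ) : (1 : XSOp n).sbit i = 0 := by simp [sbit]

theorem bit_fin (g : XSOp n) (i : Fin n) : g.bit i = g.a i := by simp [bit]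
theorem sbit_fin (g : XSOp n) (i : Fin n) : g.sbit i = g.b i := by simp [sbit]

theorem bit_mul (g h : XSOp n) (i : ℕ) : (g * h).bit i = g.bit i + h.bit i := by
  unfold bit; split_ifs <;> simp

theorem lt_of_bit_ne {g : XSOp n} {i : ℕ} (h : g.bit i ≠ 0) : i < n := by
  by_contra hi; exact h (dif_neg hi)

theorem sbit_mul (g h : XSOp n) (i : ℕ) :
    (g * h).sbit i = (if h.bit i = 0 then g.sbit i else -g.sbit i) + h.sbit i := by
  unfold sbit bit; split_ifs <;> simp_all [mul_b]

/-- Clear the entries of `g` in the columns `p < N` by the rows `T p`. -/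
def reduce (T : ℕ → XSOp n) (g : XSOp n) (N : ℕ) : XSOp n :=
  RAM.iter (fun p r => if r.bit p = 0 then r else r * T p) g N

/-- `c` is the first column in which `g` does not vanish. -/
def IsPivot (key : ℕ → ℕ) (g : XSOp n) (c : ℕ) : Prop :=
  g.bit c ≠ 0 ∧ ∀ i, key i < key c → g.bit i = 0

open Classical in
/-- Add the row `r` to the reduced rows `T`. -/
noncomputable def insertRow (key : ℕ → ℕ) (T : ℕ → XSOp n) (r : XSOp n) : ℕ → XSOp n := fun p =>
  if IsPivot key r p then r else if ∃ c, IsPivot key r c ∧ (T p).bit c ≠ 0 then T p * r else T p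

/-- `T p` is the identity or the row with pivot column `p` of a matrix in reduced echelon form. -/
structure Reduced (key : ℕ → ℕ) (T : ℕ → XSOp n) : Prop where
  diag : ∀ p, T p = 1 ∨ (T p).bit p ≠ 0
  off : ∀ p q, p ≠ q → (T p).bit p ≠ 0 → (T q).bit p = 0
  lead : ∀ p i, key i < key p → (T p).bit i = 0

theorem reduced_one (key : ℕ → ℕ) : Reduced key fun _ => (1 : XSOp n) :=
  ⟨fun _ => .inl rfl, fun _ _ _ _ => by simp, fun _ _ _ => by simp⟩

theorem exists_isPivot (key : ℕ → ℕ) {g : XSOp n} (h : g.a ≠ 0) : ∃ c, IsPivot key g c := by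
  have hne : (Finset.univ.filter fun i : Fin n => g.a i ≠ 0).Nonempty := by
    obtain ⟨i, hi⟩ := Function.ne_iff.1 h
    exact ⟨i, by simpa using hi⟩
  obtain ⟨c, hc, hmin⟩ := Finset.exists_min_image _ (fun i : Fin n => key i) hne
  refine ⟨c, by simpa [bit_fin] using hc, fun i hi => ?_⟩
  by_contra hb
  have hin := lt_of_bit_ne hb
  have := hmin ⟨i, hin⟩ (by simpa [bit, hin] using hb)
  exact absurd hi (not_lt.2 this)

theorem zmod2_add_eq_zero {a b : ZMod 2} (ha : a ≠ 0) (hb : b ≠ 0) : a + b = 0 := by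
  revert a b; decide

/-- Multiplication by `T k` clears column `k`; by `off` it leaves the other pivot columns, cleared
earlier, as they are. -/
theorem Reduced.bit_reduce {key : ℕ → ℕ} {T : ℕ → XSOp n} (hT : Reduced key T) (g : XSOp n)
    {N : ℕ} (hN : n ≤ N) (p : ℕ) (hp : (T p).bit p ≠ 0) : (reduce T g N).bit p = 0 := by
  have := RAM.iter_induction (f := fun p r => if r.bit p = 0 then r else r * T p) (a := g)
    (fun k r => ∀ p < k, (T p).bit p ≠ 0 → r.bit p = 0) N (by intro p hp; omega) ?_
  · exact this p ((lt_of_bit_ne hp).trans_le hN) hp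
  · intro k _ r hr p hpk hp
    by_cases hpk' : p = k
    · subst hpk'
      split_ifs with h
      · exact h
      · rw [bit_mul]; exact zmod2_add_eq_zero h hp
    · have h1 := hr p (by omega) hp
      split_ifs with h
      · exact h1
      · rw [bit_mul, h1, hT.off p k hpk' hp, add_zero]

theorem Stable.reduce_iff {P : XSOp n → Prop} (hP : Stable P) {T : ℕ → XSOp n}
    (hT : ∀ p, P (T p)) (g : XSOp n) (N : ℕ) : P (reduce T g N) ↔ P g := by
  refine RAM.iter_induction (fun _ r => P r ↔ P g) N Iff.rfl fun p _ r hr => ?_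
  split_ifs
  · exact hr
  · exact ⟨fun h => hr.1 (hP.of_mul h (hT p)), fun h => hP.mul (hr.2 h) (hT p)⟩

theorem IsPivot.unique {key : ℕ → ℕ} (hk : Set.InjOn key (Set.Iio n)) {g : XSOp n} {c c' : ℕ}
    (h : IsPivot key g c) (h' : IsPivot key g c') : c = c' :=
  hk (lt_of_bit_ne h.1) (lt_of_bit_ne h'.1) <| le_antisymm
    (not_lt.1 fun hlt => h'.1 (h.2 _ hlt)) (not_lt.1 fun hlt => h.1 (h'.2 _ hlt))

/-- `r` vanishes at the old pivots, so adding it to a row does not disturb them. A row with a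
nonzero entry in the new pivot column `c` has, by `lead`, a pivot whose key is at most that of `c`,
so `r` does not spoil its leading zeros either. -/
theorem Reduced.insertRow {key : ℕ → ℕ} (hk : Set.InjOn key (Set.Iio n)) {T : ℕ → XSOp n}
    (hT : Reduced key T) {r : XSOp n} (hr : ∀ p, (T p).bit p ≠ 0 → r.bit p = 0) :
    Reduced key (insertRow key T r) := by
  have hval : ∀ p, IsPivot key r p → XSOp.insertRow key T r p = r := fun p hp => if_pos hp
  have hmul : ∀ p c, ¬ IsPivot key r p → IsPivot key r c → (T p).bit c ≠ 0 →
      XSOp.insertRow key T r p = T p * r := fun p c hp hc hb => by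
    rw [XSOp.insertRow, if_neg hp, if_pos ⟨c, hc, hb⟩]
  have hkeep : ∀ p, ¬ IsPivot key r p → (∀ c, IsPivot key r c → (T p).bit c = 0) →
      XSOp.insertRow key T r p = T p := fun p hp hb => by
    rw [XSOp.insertRow, if_neg hp, if_neg]
    rintro ⟨c, hc, h⟩
    exact h (hb c hc)
  have cases : ∀ p, (IsPivot key r p ∧ XSOp.insertRow key T r p = r) ∨
      (¬ IsPivot key r p ∧ (∃ c, IsPivot key r c ∧ (T p).bit c ≠ 0) ∧
        XSOp.insertRow key T r p = T p * r) ∨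
      (¬ IsPivot key r p ∧ (∀ c, IsPivot key r c → (T p).bit c = 0) ∧
        XSOp.insertRow key T r p = T p) := by
    intro p
    by_cases hp : IsPivot key r p
    · exact .inl ⟨hp, hval p hp⟩
    · by_cases hc : ∃ c, IsPivot key r c ∧ (T p).bit c ≠ 0
      · obtain ⟨c, hc, hb⟩ := hc
        exact .inr (.inl ⟨hp, ⟨c, hc, hb⟩, hmul p c hp hc hb⟩)
      · push Not at hc
        exact .inr (.inr ⟨hp, hc, hkeep p hp hc⟩)
  have diag_of : ∀ p c, (T p).bit c ≠ 0 → (T p).bit p ≠ 0 := by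
    intro p c hb
    rcases hT.diag p with h | h
    · simp [h] at hb
    · exact h
  refine ⟨fun p => ?_, fun p q hpq hp => ?_, fun p i hi => ?_⟩
  · rcases cases p with ⟨hp, e⟩ | ⟨_, ⟨c, hc, hb⟩, e⟩ | ⟨_, _, e⟩ <;> rw [e]
    · exact .inr hp.1
    · have := diag_of p c hb
      exact .inr (by rwa [bit_mul, hr p this, add_zero])
    · exact hT.diag p
  · by_cases hpp : IsPivot key r p
    · have hq : ¬ IsPivot key r q := fun h => hpq (hpp.unique hk h)
      rcases cases q with ⟨hq', _⟩ | ⟨_, ⟨c, hc, hb⟩, e⟩ | ⟨_, h, e⟩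
      · exact absurd hq' hq
      · obtain rfl := hpp.unique hk hc
        rw [e, bit_mul, zmod2_add_eq_zero hb hc.1]
      · rw [e, h p hpp]
    · have hTp : (T p).bit p ≠ 0 := by
        rcases cases p with ⟨hp', _⟩ | ⟨_, ⟨c, hc, hb⟩, e⟩ | ⟨_, _, e⟩
        · exact absurd hp' hpp
        · exact diag_of p c hb
        · rwa [e] at hp
      rcases cases q with ⟨_, e⟩ | ⟨_, _, e⟩ | ⟨_, _, e⟩ <;> rw [e]
      · exact hr p hTp
      · rw [bit_mul, hr p hTp, hT.off p q hpq hTp, add_zero]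
      · exact hT.off p q hpq hTp
  · rcases cases p with ⟨hp, e⟩ | ⟨_, ⟨c, hc, hb⟩, e⟩ | ⟨_, _, e⟩ <;> rw [e]
    · exact hp.2 i hi
    · rw [bit_mul, hT.lead p i hi, zero_add]
      exact hc.2 i (hi.trans_le (not_lt.1 fun hlt => hb (hT.lead p c hlt)))
    · exact hT.lead p i hi

/-- `T` is in reduced echelon form and generates the same rows as `S`, up to diagonal ones. -/
structure Spans (key : ℕ → ℕ) (T : ℕ → XSOp n) (S : Set (XSOp n)) : Prop where
  reduced : Reduced key T
  of_gen : ∀ P, Stable P → (∀ g ∈ S, P g) → ∀ p, P (T p)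
  -- Generators that reduce to diagonal operators leave no row in `T`, so `P` cannot be recovered
  -- from `T` alone. Such an operator inherits every stable property `Q` of the generators, and `P`
  -- is only required for diagonal operators with `Q`.
  gen_of : ∀ P Q, Stable P → Stable Q → (∀ g ∈ S, Q g) → (∀ h : XSOp n, h.a = 0 → Q h → P h) →
    (∀ p, P (T p)) → ∀ g ∈ S, P g

theorem spans_empty (key : ℕ → ℕ) : Spans key (fun _ => (1 : XSOp n)) ∅ :=
  ⟨reduced_one key, fun _ hP _ _ => hP.one, fun _ _ _ _ _ _ _ _ h => h.elim⟩

theorem Spans.insertRow {key : ℕ → ℕ} (hk : Set.InjOn key (Set.Iio n)) {T : ℕ → XSOp n}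
    {S : Set (XSOp n)} (hT : Spans key T S) (g : XSOp n) {N : ℕ} (hN : n ≤ N) :
    Spans key (insertRow key T (reduce T g N)) (insert g S) := by
  set r := reduce T g N with hr
  have hr0 : ∀ p, (T p).bit p ≠ 0 → r.bit p = 0 := fun p hp => hT.reduced.bit_reduce g hN p hp
  refine ⟨hT.reduced.insertRow hk hr0, fun P hP hS p => ?_, fun P Q hP hQ hS h0 hT' => ?_⟩
  · have h1 := hT.of_gen P hP fun h hh => hS h (Set.mem_insert_of_mem _ hh)
    have h2 : P r := (hP.reduce_iff h1 g N).2 (hS g (Set.mem_insert _ _))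
    unfold XSOp.insertRow
    split_ifs
    exacts [h2, hP.mul (h1 p) h2, h1 p]
  · have hQ1 := hT.of_gen Q hQ fun h hh => hS h (Set.mem_insert_of_mem _ hh)
    have hQr : Q r := (hQ.reduce_iff hQ1 g N).2 (hS g (Set.mem_insert _ _))
    have hPr : P r := by
      -- A diagonal remainder is discarded by the insertion, so `P` comes from `h0`; any other
      -- remainder is stored at its pivot.
      by_cases ha : r.a = 0
      · exact h0 r ha hQr
      · obtain ⟨c, hc⟩ := exists_isPivot key ha
        have := hT' c
        rwa [XSOp.insertRow, if_pos hc] at this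
    have hPT : ∀ p, P (T p) := by
      intro p
      by_cases hp : IsPivot key r p
      · rcases hT.reduced.diag p with h | h
        · rw [h]; exact hP.one
        · exact absurd (hr0 p h) hp.1
      · have := hT' p
        unfold XSOp.insertRow at this
        rw [if_neg hp] at this
        split_ifs at this
        exacts [hP.of_mul this hPr, this]
    intro h hh
    rcases Set.mem_insert_iff.1 hh with rfl | hh
    · exact (hP.reduce_iff hPT h N).1 hPr
    · exact hT.gen_of P Q hP hQ (fun g hg => hS g (Set.mem_insert_of_mem _ hg)) h0 hPT h hh

theorem Reduced.bit_eq_zero {key : ℕ → ℕ} {T : ℕ → XSOp n} (hT : Reduced key T) {p : ℕ}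
    (hp : (T p).bit p = 0) : T p = 1 := by
  rcases hT.diag p with h | h
  exacts [h, absurd hp h]

/-- A vector in the span is determined by its entries at the pivots. -/
theorem Reduced.eq_sum {key : ℕ → ℕ} {T : ℕ → XSOp n} (hT : Reduced key T) {y : Bits n}
    (hy : y ∈ Submodule.span (ZMod 2) (Set.range fun p => (T p).a)) :
    y = ∑ p : Fin n, y p • (T p).a := by
  induction hy using Submodule.span_induction with
  | mem x hx =>
    obtain ⟨q, rfl⟩ := hx
    by_cases hq : (T q).bit q = 0
    · simp [hT.bit_eq_zero hq]
    · have hqn := lt_of_bit_ne hq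
      rw [Finset.sum_eq_single ⟨q, hqn⟩]
      · have h1 : (T q).a ⟨q, hqn⟩ = (T q).bit q := by simp [bit, hqn]
        rcases zmod2_cases ((T q).bit q) with h | h
        · exact absurd h hq
        · simp only [h1, h, one_smul]
      · intro p _ hp
        by_cases hpp : (T p).bit p = 0
        · rw [hT.bit_eq_zero hpp]; simp
        · have := hT.off p q (fun h => hp (Fin.ext h)) hpp
          rw [bit_fin] at this
          simp only [this, zero_smul]
      · simp
  | zero => simp
  | add x z _ _ hx hz =>
    conv_lhs => rw [hx, hz]
    simp [add_smul, Finset.sum_add_distrib]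
  | smul c x _ hx =>
    conv_lhs => rw [hx]
    simp [Finset.smul_sum, smul_smul]

end XSOp

/-! ### The structure of XS-stabilizer states -/

/-- The operators that fix a given vector are closed under products and inverses, so the generators
decide. -/
theorem isXSStateOf_iff {n m : ℕ} (g : Fin m → XSOp n) (ψ : QVec n) :
    IsXSStateOf g ψ ↔ ψ ≠ 0 ∧ (∀ j, (g j).Fixes ψ) ∧
      ∀ φ : QVec n, (∀ j, (g j).Fixes φ) → ∃ c : ℂ, φ = c • ψ := by
  have key : ∀ φ : QVec n, (∀ M ∈ {M | ∃ U ∈ xsGroup g, (U : QOp n) = M}, M.mulVec φ = φ) ↔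
      ∀ j, (g j).Fixes φ := by
    intro φ
    constructor
    · intro h j
      rw [XSOp.fixes_iff]
      exact h _ ⟨_, Subgroup.subset_closure ⟨j, rfl⟩, rfl⟩
    · rintro h _ ⟨U, hU, rfl⟩
      induction hU using Subgroup.closure_induction with
      | mem x hx =>
        obtain ⟨j, rfl⟩ := hx
        exact (XSOp.fixes_iff _ _).1 (h j)
      | one => simp
      | mul x y _ _ hx hy => rw [Units.val_mul, ← Matrix.mulVec_mulVec, hy, hx]
      | inv x _ hx =>
        conv_lhs => rw [← hx]
        rw [Matrix.mulVec_mulVec, Units.inv_mul, Matrix.one_mulVec]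
  simp only [IsXSStateOf, UniquelyStabilizedBy, key]

theorem fixes_of_mem_xsGroup {n m : ℕ} {g : Fin m → XSOp n} {ψ : QVec n} (h : IsXSStateOf g ψ)
    {k : XSOp n} (hk : k.isUnit_toMatrix.unit ∈ xsGroup g) : k.Fixes ψ :=
  (XSOp.fixes_iff _ _).2 (h.2.1 _ ⟨_, hk, rfl⟩)

/-- `ψ` is supported on the coset `x₀ + L`, and for every `y ∈ L` it is fixed by some operator
with `X`-part `y`. -/
structure CosetState {n : ℕ} (L : Submodule (ZMod 2) (Bits n)) (x₀ : Bits n) (ψ : QVec n) :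
    Prop where
  supp : ∀ x, ψ x ≠ 0 ↔ x + x₀ ∈ L
  shift : ∀ y ∈ L, ∃ h : XSOp n, h.a = y ∧ h.Fixes ψ

/-- Products of generators realize every `y ∈ L` as an `X`-part. They carry the nonzero amplitude at
`x₀` to the whole coset, and uniqueness excludes any support outside of it. -/
theorem cosetState_of_isXSStateOf {n m : ℕ} {g : Fin m → XSOp n} {ψ : QVec n}
    (h : IsXSStateOf g ψ) {x₀ : Bits n} (hx₀ : ψ x₀ ≠ 0) :
    CosetState (Submodule.span (ZMod 2) (Set.range fun j => (g j).a)) x₀ ψ := by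
  set L := Submodule.span (ZMod 2) (Set.range fun j => (g j).a) with hL
  obtain ⟨-, hfix, huniq⟩ := (isXSStateOf_iff g ψ).1 h
  have hshift : ∀ y ∈ L, ∃ h : XSOp n, h.a = y ∧ h.Fixes ψ := by
    intro y hy
    induction hy using Submodule.span_induction with
    | mem x hx => obtain ⟨j, rfl⟩ := hx; exact ⟨g j, rfl, hfix j⟩
    | zero => exact ⟨1, rfl, (XSOp.stable_fixes ψ).one⟩
    | add x z _ _ hx hz =>
      obtain ⟨h1, rfl, hf1⟩ := hx
      obtain ⟨h2, rfl, hf2⟩ := hz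
      exact ⟨h1 * h2, rfl, (XSOp.stable_fixes ψ).mul hf1 hf2⟩
    | smul c x _ hx =>
      rcases zmod2_cases c with rfl | rfl
      · exact ⟨1, by simp, (XSOp.stable_fixes ψ).one⟩
      · simpa using hx
  refine ⟨fun x => ⟨fun hx => ?_, fun hx => ?_⟩, hshift⟩
  · classical
    -- The restriction of `ψ` to `x₀ + L` is again fixed, since the generators preserve cosets of
    -- `L`. Comparison at `x₀` gives the factor `1`, so `ψ` equals its restriction.
    obtain ⟨c, hc⟩ := huniq (fun y => if y + x₀ ∈ L then ψ y else 0) (by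
      intro j y
      have ha : (g j).a ∈ L := Submodule.subset_span ⟨j, rfl⟩
      have : y + (g j).a + x₀ ∈ L ↔ y + x₀ ∈ L := by
        rw [add_right_comm]
        exact L.add_mem_iff_left ha
      simp only [this, hfix j y]
      split_ifs <;> simp)
    have h1 := congrFun hc x₀
    have h2 := congrFun hc x
    simp only [Bits.add_self, L.zero_mem, if_true, Pi.smul_apply, smul_eq_mul] at h1 h2
    have hc1 : c = 1 := mul_right_cancel₀ hx₀ (by rw [← h1, one_mul])
    by_contra hn
    rw [if_neg hn, hc1, one_mul] at h2
    exact hx h2.symm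
  · obtain ⟨h, ha, hf⟩ := hshift _ hx
    have := hf x₀
    rw [ha, add_comm x, ← add_assoc, Bits.add_self, zero_add] at this
    rw [this]
    exact mul_ne_zero (h.phase_ne_zero _) hx₀

/-- `b ↦ (-1)^b` -/
noncomputable def sgn : AddChar (ZMod 2) ℂ := AddChar.zmodChar 2 (by norm_num : (-1 : ℂ) ^ 2 = 1)

theorem sgn_one : sgn 1 = -1 := by simp [sgn, AddChar.zmodChar_apply, ZMod.val_one]

theorem sgn_mul_self (b : ZMod 2) : sgn b * sgn b = 1 := by
  rw [← AddChar.map_add_eq_mul, CharTwo.add_self_eq_zero, AddChar.map_zero_eq_one]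

theorem norm_sgn (b : ZMod 2) : ‖sgn b‖ = 1 := by
  rcases zmod2_cases b with rfl | rfl <;> simp [sgn_one]

theorem sgn_ne_zero (b : ZMod 2) : sgn b ≠ 0 := by
  intro h; simpa [h] using norm_sgn b

theorem chiFour_two_mul (b : ZMod 2) : chiFour (2 * (b.val : ZMod 4)) = sgn b := by
  have : (2 * (b.val : ZMod 4)) = ((2 * b.val : ℕ) : ZMod 4) := by push_cast; rfl
  rw [this, chiFour, AddChar.zmodChar_apply', sgn, AddChar.zmodChar_apply, pow_mul, Complex.I_sq]

theorem PauliOp.phase_eq {n : ℕ} (p : PauliOp n) (x : Bits n) :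
    p.phase x = chiFour p.s * sgn (p.b ⬝ᵥ x) := by
  rw [PauliOp.phase, chiFour, AddChar.zmodChar_apply, dotProduct, AddChar.map_sum_eq_prod]
  congr 1
  refine Finset.prod_congr rfl fun l _ => ?_
  rcases zmod2_cases (p.b l) with h1 | h1 <;> rcases zmod2_cases (x l) with h2 | h2 <;>
    simp [h1, h2, sgn_one, ZMod.val_one]

/-- The second difference of the amplitudes in directions `w`, `w'`, multiplicatively. -/
noncomputable def cross {n : ℕ} (ψ : QVec n) (x w w' : Bits n) : ℂ :=
  ψ x * ψ (x + w + w') / (ψ (x + w) * ψ (x + w'))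

/-- The phase is a product over qubits, and on each qubit one of `w`, `w'` vanishes; the factors on
both sides then agree up to order. -/
theorem XSOp.phase_cross {n : ℕ} (k : XSOp n) (x : Bits n) {w w' : Bits n}
    (hd : ∀ l, w l = 0 ∨ w' l = 0) :
    k.phase x * k.phase (x + w + w') = k.phase (x + w) * k.phase (x + w') := by
  simp only [XSOp.phase]
  have : ∀ l, Complex.I ^ ((k.b l).val * (x l).val) *
      Complex.I ^ ((k.b l).val * ((x + w + w') l).val) =
      Complex.I ^ ((k.b l).val * ((x + w) l).val) * Complex.I ^ ((k.b l).val * ((x + w') l).val) := by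
    intro l
    rcases hd l with h | h <;> simp [h, mul_comm]
  calc _ = alphaPhase ^ k.s.val * alphaPhase ^ k.s.val * ∏ l, (Complex.I ^ ((k.b l).val * (x l).val) *
      Complex.I ^ ((k.b l).val * ((x + w + w') l).val)) := by rw [Finset.prod_mul_distrib]; ring
    _ = _ := by rw [Finset.prod_congr rfl fun l _ => this l, Finset.prod_mul_distrib]; ring

/-! ### Second differences of the amplitudes on a coset. -/

namespace CosetState

variable {n : ℕ} {L : Submodule (ZMod 2) (Bits n)} {x₀ : Bits n} {ψ : QVec n}

theorem ne_zero_add (S : CosetState L x₀ ψ) {x y : Bits n} (hx : ψ x ≠ 0) (hy : y ∈ L) :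
    ψ (x + y) ≠ 0 := by
  rw [S.supp, add_right_comm] at *
  exact L.add_mem hx hy

theorem norm_eq (S : CosetState L x₀ ψ) {x : Bits n} (hx : ψ x ≠ 0) : ‖ψ x‖ = ‖ψ x₀‖ := by
  obtain ⟨h, ha, hf⟩ := S.shift _ ((S.supp x).1 hx)
  have := hf x₀
  rw [ha, add_comm x, ← add_assoc, Bits.add_self, zero_add] at this
  rw [this, norm_mul, h.norm_phase, one_mul]

/-- Translation by `y` multiplies the four amplitudes by phases of one operator, which cancel by
`XSOp.phase_cross`. Everything bipartite in the proof rests on this invariance. -/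
theorem cross_shift (S : CosetState L x₀ ψ) (x : Bits n) {y w w' : Bits n}
    (hy : y ∈ L) (hd : ∀ l, w l = 0 ∨ w' l = 0) : cross ψ (x + y) w w' = cross ψ x w w' := by
  obtain ⟨k, rfl, hk⟩ := S.shift y hy
  have h0 := k.phase_cross x hd
  have h1 := k.phase_ne_zero (x + w)
  have h2 := k.phase_ne_zero (x + w')
  simp only [cross]
  rw [show x + k.a + w + w' = x + w + w' + k.a by abel, show x + k.a + w = x + w + k.a by abel,
    show x + k.a + w' = x + w' + k.a by abel, hk, hk, hk, hk,
    show k.phase x * ψ x * (k.phase (x + w + w') * ψ (x + w + w')) =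
      (k.phase x * k.phase (x + w + w')) * (ψ x * ψ (x + w + w')) by ring, h0,
    show k.phase (x + w) * ψ (x + w) * (k.phase (x + w') * ψ (x + w')) =
      (k.phase (x + w) * k.phase (x + w')) * (ψ (x + w) * ψ (x + w')) by ring,
    mul_div_mul_left _ _ (mul_ne_zero h1 h2)]

theorem cross_comm (ψ : QVec n) (x w w' : Bits n) : cross ψ x w w' = cross ψ x w' w := by
  rw [cross, cross, add_right_comm, mul_comm (ψ (x + w))]

/-- The second difference for `w₁ + w₂` telescopes into one at `x` and one at `x + w₁`; the latter
is moved back to `x` by `cross_shift`. -/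
theorem cross_add_left (S : CosetState L x₀ ψ) {x : Bits n} (hx : ψ x ≠ 0) {w₁ w₂ w' : Bits n}
    (h₁ : w₁ ∈ L) (h' : w' ∈ L) (hd : ∀ l, w₂ l = 0 ∨ w' l = 0) :
    cross ψ x (w₁ + w₂) w' = cross ψ x w₁ w' * cross ψ x w₂ w' := by
  rw [← S.cross_shift x (y := w₁) h₁ hd]
  have e1 := S.ne_zero_add hx h₁
  have e2 := S.ne_zero_add hx h'
  have e3 := S.ne_zero_add e1 h'
  simp only [cross, ← add_assoc]
  field_simp

theorem cross_zero_left (S : CosetState L x₀ ψ) {x : Bits n} (hx : ψ x ≠ 0) {w' : Bits n}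
    (h' : w' ∈ L) : cross ψ x 0 w' = 1 := by
  have := S.ne_zero_add hx h'
  rw [cross, add_zero]
  exact div_self (mul_ne_zero hx this)

/-- By multiplicativity the square is the value at `w + w = 0`, which is `1`. Fourth and eighth
roots of unity in the amplitudes thus leave only signs between the parties. -/
theorem cross_eq_one_or (S : CosetState L x₀ ψ) {x : Bits n} (hx : ψ x ≠ 0) {w w' : Bits n}
    (h : w ∈ L) (h' : w' ∈ L) (hd : ∀ l, w l = 0 ∨ w' l = 0) :
    cross ψ x w w' = 1 ∨ cross ψ x w w' = -1 := by
  have := S.cross_add_left hx h h' hd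
  rw [Bits.add_self, S.cross_zero_left hx h'] at this
  exact mul_self_eq_one_iff.1 this.symm

theorem cross_sum_left (S : CosetState L x₀ ψ) {x : Bits n} (hx : ψ x ≠ 0) {ι : Type*}
    (s : Finset ι) (u : ι → ZMod 2) (w : ι → Bits n) {w' : Bits n} (c : ι → ZMod 2)
    (hw : ∀ i, w i ∈ L) (h' : w' ∈ L) (hd : ∀ i l, w i l = 0 ∨ w' l = 0)
    (hc : ∀ i, cross ψ x (w i) w' = sgn (c i)) :
    cross ψ x (∑ i ∈ s, u i • w i) w' = sgn (∑ i ∈ s, u i * c i) := by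
  classical
  induction s using Finset.induction_on with
  | empty => simp [S.cross_zero_left hx h']
  | insert a s ha ih =>
    rw [Finset.sum_insert ha, Finset.sum_insert ha, S.cross_add_left hx (L.smul_mem _ (hw a)) h',
      ih, AddChar.map_add_eq_mul]
    · congr 1
      rcases zmod2_cases (u a) with h | h
      · simp [h, S.cross_zero_left hx h']
      · simp [h, hc]
    · intro l
      by_cases hl : w' l = 0
      · exact .inr hl
      · left
        rw [Finset.sum_apply]
        exact Finset.sum_eq_zero fun i _ => by simp [(hd i l).resolve_right hl]

end CosetState

/-! ### Quadratic states, and functions that split over the bipartition. -/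

/-- The bilinear form `x ᵀ M y`. -/
def bil {n : ℕ} (M : Matrix (Fin n) (Fin n) (ZMod 2)) (x y : Bits n) : ZMod 2 :=
  x ⬝ᵥ M.mulVec y

theorem bil_add_left {n : ℕ} (M : Matrix (Fin n) (Fin n) (ZMod 2)) (x y z : Bits n) :
    bil M (x + y) z = bil M x z + bil M y z := by simp [bil, add_dotProduct]

theorem bil_add_right {n : ℕ} (M : Matrix (Fin n) (Fin n) (ZMod 2)) (x y z : Bits n) :
    bil M x (y + z) = bil M x y + bil M x z := by simp [bil, Matrix.mulVec_add, dotProduct_add]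

theorem bil_eq_sum {n : ℕ} (M : Matrix (Fin n) (Fin n) (ZMod 2)) (x y : Bits n) :
    bil M x y = ∑ p, x p * ∑ q, M p q * y q := by simp [bil, dotProduct, Matrix.mulVec]

theorem bil_transpose {n : ℕ} (M : Matrix (Fin n) (Fin n) (ZMod 2)) (x y : Bits n) :
    bil M.transpose x y = bil M y x := by
  simp only [bil_eq_sum, Finset.mul_sum, Matrix.transpose_apply]
  rw [Finset.sum_comm]
  exact Finset.sum_congr rfl fun _ _ => Finset.sum_congr rfl fun _ _ => by ring

open Classical in
/-- The amplitudes `κ (-1)^{x ᵀ M x}` on the coset `x₀ + L`. -/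
noncomputable def quadState {n : ℕ} (κ : ℂ) (L : Submodule (ZMod 2) (Bits n)) (x₀ : Bits n)
    (M : Matrix (Fin n) (Fin n) (ZMod 2)) : QVec n := fun x =>
  if x + x₀ ∈ L then κ * sgn (bil M x x) else 0

/-- The vectors in `L` that are supported on `A`. -/
def supportedIn {n : ℕ} (L : Submodule (ZMod 2) (Bits n)) (A : Finset (Fin n)) :
    Submodule (ZMod 2) (Bits n) where
  carrier := {y | y ∈ L ∧ ∀ l ∉ A, y l = 0}
  zero_mem' := ⟨L.zero_mem, fun _ _ => rfl⟩
  add_mem' := fun ⟨h1, h2⟩ ⟨h3, h4⟩ => ⟨L.add_mem h1 h3, fun l hl => by simp [h2 l hl, h4 l hl]⟩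
  smul_mem' := fun c _ ⟨h1, h2⟩ => ⟨L.smul_mem c h1, fun l hl => by simp [h2 l hl]⟩

theorem mem_supportedIn {n : ℕ} {L : Submodule (ZMod 2) (Bits n)} {A : Finset (Fin n)}
    {y : Bits n} : y ∈ supportedIn L A ↔ y ∈ L ∧ ∀ l ∉ A, y l = 0 := Iff.rfl

/-- `M` couples qubits in `A` to qubits outside of `A` only. -/
def IsCoupling {n : ℕ} (A : Finset (Fin n)) (M : Matrix (Fin n) (Fin n) (ZMod 2)) : Prop :=
  ∀ p q, M p q ≠ 0 → p ∈ A ∧ q ∉ A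

theorem IsCoupling.bil_eq_zero {n : ℕ} {A : Finset (Fin n)}
    {M : Matrix (Fin n) (Fin n) (ZMod 2)} (hM : IsCoupling A M) {x y : Bits n}
    (h : (∀ l ∈ A, x l = 0) ∨ ∀ l ∉ A, y l = 0) : bil M x y = 0 := by
  rw [bil_eq_sum]
  refine Finset.sum_eq_zero fun p _ => ?_
  rw [Finset.mul_sum]
  refine Finset.sum_eq_zero fun q _ => ?_
  by_cases hpq : M p q = 0
  · simp [hpq]
  · obtain ⟨h1, h2⟩ := hM p q hpq
    rcases h with h | h
    · simp [h p h1]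
    · simp [h q h2]

/-- The coupling of `M` is the cross term of the amplitudes of `ψ`. -/
def Couples {n : ℕ} (A : Finset (Fin n)) (L : Submodule (ZMod 2) (Bits n)) (x₀ : Bits n)
    (ψ : QVec n) (M : Matrix (Fin n) (Fin n) (ZMod 2)) : Prop :=
  ∀ w ∈ supportedIn L A, ∀ w' ∈ supportedIn L Aᶜ, cross ψ x₀ w w' = sgn (bil M w w')

theorem glue_left {n : ℕ} (A : Finset (Fin n)) (x : BitsIn A) (z : BitsOut A) (i : Fin n)
    (h : i ∈ A) : glue A x z i = x ⟨i, h⟩ := dif_pos h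

theorem glue_right {n : ℕ} (A : Finset (Fin n)) (x : BitsIn A) (z : BitsOut A) (i : Fin n)
    (h : i ∉ A) : glue A x z i = z ⟨i, h⟩ := dif_neg h

/-- A function on a coset with the rectangle property splits into a function of the bits in `A` and a
function of the other bits. -/
theorem exists_split {n : ℕ} (A : Finset (Fin n)) (L : Submodule (ZMod 2) (Bits n)) (x₀ : Bits n)
    (F : Bits n → ℂ) (hnorm : ∀ x, x + x₀ ∈ L → ‖F x‖ = 1)
    (hrect : ∀ x, x + x₀ ∈ L → ∀ w ∈ supportedIn L A, ∀ w' ∈ supportedIn L Aᶜ,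
      F x * F (x + w + w') = F (x + w) * F (x + w')) :
    ∃ (u : BitsIn A → ℂ) (v : BitsOut A → ℂ), (∀ ξ, ‖u ξ‖ = 1) ∧ (∀ ζ, ‖v ζ‖ = 1) ∧
      ∀ x, x + x₀ ∈ L → F x = u (fun i => x i) * v (fun i => x i) := by
  classical
  set W := supportedIn L A ⊔ supportedIn L Aᶜ with hW
  have hWL : W ≤ L := sup_le (fun y hy => hy.1) fun y hy => hy.1
  -- A representative of the coset `x + W` that depends on the coset only. Each party can determine
  -- it: if `x` and `y` agree on one side, then `x + y ∈ L` is supported on the other side and lies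
  -- in `W`.
  let r : Bits n → Bits n := fun x => (Submodule.Quotient.mk (p := W) x).out
  have hr : ∀ x, x + r x ∈ W := by
    intro x
    have h1 : Submodule.Quotient.mk (p := W) (r x) = Submodule.Quotient.mk x := Quotient.out_eq _
    have h2 := (Submodule.Quotient.eq W).1 h1
    rw [add_comm]
    rwa [sub_eq_add_neg, show -x = x from funext fun i => CharTwo.neg_eq _] at h2
  have hr_eq : ∀ x y, x + y ∈ W → r x = r y := by
    intro x y h
    have : Submodule.Quotient.mk (p := W) x = Submodule.Quotient.mk y := by
      rw [Submodule.Quotient.eq, sub_eq_add_neg, show -y = y from funext fun i => CharTwo.neg_eq _]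
      exact h
    simp only [r, this]
  have hrV : ∀ x, x + x₀ ∈ L → r x + x₀ ∈ L := by
    intro x hx
    have := L.add_mem (hWL (hr x)) hx
    rwa [show x + r x + (x + x₀) = r x + x₀ + x + x by abel, Bits.add_add_cancel] at this
  have key : ∀ x, x + x₀ ∈ L → ∃ w ∈ supportedIn L A, ∃ w' ∈ supportedIn L Aᶜ,
      x = r x + w + w' ∧ glue A (fun i => x i) (fun i => r x i) = r x + w ∧
        glue A (fun i => r x i) (fun i => x i) = r x + w' := by
    intro x hx
    obtain ⟨w, hw, w', hw', he⟩ := Submodule.mem_sup.1 (hr x)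
    have hx' : x = r x + w + w' := by
      rw [add_assoc, he, add_comm, Bits.add_add_cancel]
    refine ⟨w, hw, w', hw', hx', ?_, ?_⟩
    · funext i
      by_cases hi : i ∈ A
      · have h1 := hw'.2 i (by simpa using hi)
        have h2 := congrFun hx' i
        simp only [Pi.add_apply, h1, add_zero] at h2
        rw [glue_left _ _ _ _ hi, Pi.add_apply, ← h2]
      · rw [glue_right _ _ _ _ hi, Pi.add_apply, hw.2 i hi, add_zero]
    · funext i
      by_cases hi : i ∈ A
      · rw [glue_left _ _ _ _ hi, Pi.add_apply, hw'.2 i (by simpa using hi), add_zero]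
      · have h1 := hw.2 i hi
        have h2 := congrFun hx' i
        simp only [Pi.add_apply, h1, add_zero] at h2
        rw [glue_right _ _ _ _ hi, Pi.add_apply, ← h2]
  let PA : BitsIn A → Prop := fun ξ => ∃ x, x + x₀ ∈ L ∧ (fun i : {i // i ∈ A} => x i) = ξ
  let PB : BitsOut A → Prop := fun ζ => ∃ x, x + x₀ ∈ L ∧ (fun i : {i // i ∉ A} => x i) = ζ
  have hdiff : ∀ x y, x + x₀ ∈ L → y + x₀ ∈ L → x + y ∈ L := by
    intro x y hx hy
    have := L.add_mem hx hy
    rwa [show x + x₀ + (y + x₀) = x + y + x₀ + x₀ by abel, Bits.add_add_cancel] at this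
  -- With `x = r + w + w'`, the rectangle property reads `F x = F (r + w) * (F (r + w') / F r)`. The
  -- first factor is known to `A`, the second to the complement. Bit strings that do not occur in
  -- the coset get the value `1`, so that the diagonal operators are unitary.
  refine ⟨fun ξ => if h : PA ξ then F (glue A ξ fun i => r h.choose i) else 1,
    fun ζ => if h : PB ζ then F (glue A (fun i => r h.choose i) ζ) / F (r h.choose) else 1,
    fun ξ => ?_, fun ζ => ?_, fun x hx => ?_⟩
  · by_cases h : PA ξ
    · obtain ⟨hx, hxξ⟩ := h.choose_spec
      obtain ⟨w, hw, w', hw', h1, h2, h3⟩ := key _ hx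
      rw [hxξ] at h2
      simp only [dif_pos h]
      rw [h2]
      refine hnorm _ ?_
      rw [add_right_comm]
      exact L.add_mem (hrV _ hx) hw.1
    · simp [dif_neg h]
  · by_cases h : PB ζ
    · obtain ⟨hx, hxζ⟩ := h.choose_spec
      obtain ⟨w, hw, w', hw', h1, h2, h3⟩ := key _ hx
      rw [hxζ] at h3
      simp only [dif_pos h]
      rw [h3, norm_div, hnorm _ (hrV _ hx), hnorm, div_one]
      rw [add_right_comm]
      exact L.add_mem (hrV _ hx) hw'.1
    · simp [dif_neg h]
  · have hA : PA fun i => x i := ⟨x, hx, rfl⟩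
    have hB : PB fun i => x i := ⟨x, hx, rfl⟩
    obtain ⟨hxA, hA2⟩ := hA.choose_spec
    obtain ⟨hxB, hB2⟩ := hB.choose_spec
    -- The chosen completion of the bits in `A` may differ from `x`, but only by a vector of `L`
    -- supported outside of `A`.
    have eA : r hA.choose = r x := by
      refine hr_eq _ _ (Submodule.mem_sup_right ⟨hdiff _ _ hxA hx, fun l hl => ?_⟩)
      have := congrFun hA2 ⟨l, by simpa using hl⟩
      simp only at this
      rw [Pi.add_apply, this]
      exact CharTwo.add_self_eq_zero _
    have eB : r hB.choose = r x := by
      refine hr_eq _ _ (Submodule.mem_sup_left ⟨hdiff _ _ hxB hx, fun l hl => ?_⟩)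
      have := congrFun hB2 ⟨l, hl⟩
      simp only at this
      rw [Pi.add_apply, this]
      exact CharTwo.add_self_eq_zero _
    simp only [dif_pos hA, dif_pos hB, eA, eB]
    obtain ⟨w, hw, w', hw', h1, h2, h3⟩ := key _ hx
    rw [h2, h3]
    have h4 := hrect _ (hrV _ hx) w hw w' hw'
    rw [← h1] at h4
    have h5 : F (r x) ≠ 0 := by
      intro h0
      have := hnorm _ (hrV _ hx)
      simp [h0] at this
    rw [mul_div_assoc', ← h4, mul_div_cancel_left₀ _ h5]

theorem diagonal_mem_unitaryGroup {ι : Type*} [Fintype ι] [DecidableEq ι] (u : ι → ℂ)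
    (hu : ∀ i, ‖u i‖ = 1) : Matrix.diagonal u ∈ Matrix.unitaryGroup ι ℂ := by
  rw [Matrix.mem_unitaryGroup_iff, Matrix.star_eq_conjTranspose, Matrix.diagonal_conjTranspose,
    Matrix.diagonal_mul_diagonal, ← Matrix.diagonal_one]
  congr 1
  funext i
  simp [Complex.mul_conj, Complex.normSq_eq_norm_sq, hu i]

theorem bipartiteOp_diagonal_mulVec {n : ℕ} (A : Finset (Fin n)) (u : BitsIn A → ℂ)
    (v : BitsOut A → ℂ) (φ : QVec n) (x : Bits n) :
    (bipartiteOp A (Matrix.diagonal u) (Matrix.diagonal v)).mulVec φ x =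
      u (fun i => x i) * v (fun i => x i) * φ x := by
  simp only [Matrix.mulVec, dotProduct, bipartiteOp, Matrix.of_apply]
  rw [Finset.sum_eq_single x]
  · simp
  · intro y _ hy
    by_cases h1 : (fun i : {i // i ∈ A} => x i) = fun i : {i // i ∈ A} => y i
    · by_cases h2 : (fun i : {i // i ∉ A} => x i) = fun i : {i // i ∉ A} => y i
      · refine absurd (funext fun i => ?_) hy
        by_cases hi : i ∈ A
        · exact (congrFun h1 ⟨i, hi⟩).symm
        · exact (congrFun h2 ⟨i, hi⟩).symm
      · simp [Matrix.diagonal_apply_ne _ h2]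
    · simp [Matrix.diagonal_apply_ne _ h1]
  · simp

/-- Dividing `ψ` by the quadratic state cancels the second differences between the parties, so the
quotient satisfies the hypotheses of `exists_split`. -/
theorem CosetState.diagonallyEquivalent {n : ℕ} {A : Finset (Fin n)}
    {L : Submodule (ZMod 2) (Bits n)} {x₀ : Bits n} {ψ : QVec n} (S : CosetState L x₀ ψ)
    {M : Matrix (Fin n) (Fin n) (ZMod 2)} (hM : IsCoupling A M) (hc : Couples A L x₀ ψ M) :
    DiagonallyEquivalent A ψ (quadState (‖ψ x₀‖ : ℂ) L x₀ M) := by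
  have hx₀ : ψ x₀ ≠ 0 := (S.supp x₀).2 (by rw [Bits.add_self]; exact L.zero_mem)
  have hκ : (‖ψ x₀‖ : ℂ) ≠ 0 := by simpa using hx₀
  set κ : ℂ := (‖ψ x₀‖ : ℂ) with hκdef
  obtain ⟨u, v, hu, hv, huv⟩ := exists_split A L x₀ (fun x => ψ x * sgn (bil M x x) / κ)
    (by
      intro x hx
      rw [norm_div, norm_mul, norm_sgn, mul_one, S.norm_eq ((S.supp x).2 hx), hκdef,
        Complex.norm_real, norm_norm]
      exact div_self (by simpa using hx₀))
    (by
      intro x hx w hw w' hw'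
      have hψx := (S.supp x).2 hx
      have hd : ∀ l, w l = 0 ∨ w' l = 0 := fun l => by
        by_cases hl : l ∈ A
        · exact .inr (hw'.2 l (by simpa using hl))
        · exact .inl (hw.2 l hl)
      have h1 := S.cross_shift x₀ (y := x + x₀) hx hd
      rw [add_comm x, ← add_assoc, Bits.add_self, zero_add, hc w hw w' hw', cross, div_eq_iff
        (mul_ne_zero (S.ne_zero_add hψx hw.1) (S.ne_zero_add hψx hw'.1))] at h1
      -- A coupling has no block from the complement to `A`, so only one of the two mixed terms
      -- survives in the second difference of `xᵀ M x`; otherwise they could cancel modulo 2.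
      have h2 : bil M w' w = 0 := hM.bil_eq_zero (.inr hw.2)
      have h3 : sgn (bil M w w') * (sgn (bil M x x) * sgn (bil M (x + w + w') (x + w + w'))) =
          sgn (bil M (x + w) (x + w)) * sgn (bil M (x + w') (x + w')) := by
        simp only [← AddChar.map_add_eq_mul]
        congr 1
        simp only [bil_add_left, bil_add_right, h2]
        generalize bil M w w' = a, bil M x x = b, bil M x w = c, bil M w x = d, bil M x w' = e,
          bil M w' x = f, bil M w w = g, bil M w' w' = h
        revert a b c d e f g h
        decide
      calc _ = ψ x * ψ (x + w + w') * (sgn (bil M x x) *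
            sgn (bil M (x + w + w') (x + w + w'))) / (κ * κ) := by field_simp
        _ = ψ (x + w) * ψ (x + w') * (sgn (bil M w w') * (sgn (bil M x x) *
            sgn (bil M (x + w + w') (x + w + w')))) / (κ * κ) := by rw [h1]; ring
        _ = _ := by rw [h3]; field_simp)
  refine ⟨Matrix.diagonal u, Matrix.diagonal v, Matrix.isDiag_diagonal _,
    diagonal_mem_unitaryGroup u hu, Matrix.isDiag_diagonal _, diagonal_mem_unitaryGroup v hv,
    funext fun x => ?_⟩
  rw [bipartiteOp_diagonal_mulVec, quadState]
  split_ifs with hx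
  · rw [← huv x hx]
    field_simp
    rw [pow_two, sgn_mul_self, mul_one]
  · rw [mul_zero]
    by_contra h
    exact hx ((S.supp x).1 h)

/-! ### Stabilizers of quadratic states -/

/-- Stabilizers of `quadState κ L x₀ M`, where `T` is an echelon form of `L`. -/
def quadPauli {n : ℕ} (T : ℕ → XSOp n) (x₀ : Bits n) (M : Matrix (Fin n) (Fin n) (ZMod 2))
    (i : Fin n) : PauliOp n :=
  -- For a pivot row `v` the operator expresses `q (y + v) = q v + ((M + Mᵀ) v) · y + q y` with `q y
  -- = yᵀ M y`. Each column that is not a pivot contributes a parity check instead, so exactly `n`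
  -- operators arise.
  if (T i).a i ≠ 0 then
    ⟨2 * ((bil M (T i).a (T i).a).val : ZMod 4), (T i).a, (M + M.transpose).mulVec (T i).a⟩
  else
    let c : Bits n := fun l => (if l = i then 1 else 0) + (T l).a i
    ⟨2 * ((c ⬝ᵥ x₀).val : ZMod 4), 0, c⟩

theorem PauliOp.mulVec_eq_iff {n : ℕ} (p : PauliOp n) (φ : QVec n) :
    p.toMatrix.mulVec φ = φ ↔ ∀ y, φ (y + p.a) = p.phase y * φ y := by
  constructor
  · intro h y
    conv_lhs => rw [← h]
    rw [mulVec_toMatrix, Bits.add_add_cancel]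
  · intro h
    funext x
    rw [mulVec_toMatrix, ← h, Bits.add_add_cancel]

/-- A vector of the span is the combination of the rows whose coefficients are its pivot entries.
Membership thus says that each remaining entry `y i` equals `∑ y p * (T p).a i`, and this is one
parity check. -/
theorem mem_span_iff_checks {n : ℕ} {key : ℕ → ℕ} {T : ℕ → XSOp n} (hT : XSOp.Reduced key T)
    (y : Bits n) : y ∈ Submodule.span (ZMod 2) (Set.range fun p => (T p).a) ↔
      ∀ i : Fin n, (T i).a i = 0 → (fun l : Fin n => (if l = i then 1 else 0) + (T l).a i) ⬝ᵥ y = 0 := by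
  have hdot : ∀ i : Fin n, (fun l : Fin n => (if l = i then 1 else 0) + (T l).a i) ⬝ᵥ y =
      y i + (∑ p : Fin n, y p • (T p).a) i := by
    intro i
    simp only [dotProduct, add_mul, Finset.sum_add_distrib, ite_mul, one_mul, zero_mul,
      Finset.sum_ite_eq', Finset.mem_univ, if_true, Finset.sum_apply, Pi.smul_apply, smul_eq_mul]
    congr 1
    exact Finset.sum_congr rfl fun _ _ => mul_comm _ _
  constructor
  · intro hy i _
    rw [hdot, ← hT.eq_sum hy]
    exact CharTwo.add_self_eq_zero _
  · intro h
    have : y = ∑ p : Fin n, y p • (T p).a := by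
      funext i
      by_cases hi : (T i).a i = 0
      · have := h i hi
        rw [hdot] at this
        exact CharTwo.add_eq_zero.1 this
      · rw [Finset.sum_apply, Finset.sum_eq_single i]
        · rcases zmod2_cases ((T i).a i) with h1 | h1
          · exact absurd h1 hi
          · simp [h1]
        · intro p _ hp
          have := hT.off i p (fun h => hp (Fin.ext h.symm)) (by rwa [XSOp.bit_fin])
          rw [XSOp.bit_fin] at this
          simp [this]
        · simp
    rw [this]
    exact Submodule.sum_mem _ fun p _ => Submodule.smul_mem _ _ (Submodule.subset_span ⟨p, rfl⟩)

/-- The parity checks confine a fixed vector to the coset; the translations determine the ratio of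
any two of its amplitudes there. -/
theorem isPauliStateOf_quadPauli {n : ℕ} {key : ℕ → ℕ} {T : ℕ → XSOp n} (hT : XSOp.Reduced key T)
    (x₀ : Bits n) (M : Matrix (Fin n) (Fin n) (ZMod 2)) {κ : ℂ} (hκ : κ ≠ 0) :
    IsPauliStateOf (quadPauli T x₀ M)
      (quadState κ (Submodule.span (ZMod 2) (Set.range fun p => (T p).a)) x₀ M) := by
  set L := Submodule.span (ZMod 2) (Set.range fun p => (T p).a) with hL
  set φ := quadState κ L x₀ M with hφ
  have hTL : ∀ p, (T p).a ∈ L := fun p => Submodule.subset_span ⟨p, rfl⟩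
  have hφx₀ : φ x₀ ≠ 0 := by
    simp only [hφ, quadState, Bits.add_self, L.zero_mem, if_true]
    exact mul_ne_zero hκ (sgn_ne_zero _)
  have hshift : ∀ (v y : Bits n), bil M (y + v) (y + v) =
      bil M v v + (M + M.transpose).mulVec v ⬝ᵥ y + bil M y y := by
    intro v y
    have : (M + M.transpose).mulVec v ⬝ᵥ y = bil M y v + bil M v y := by
      rw [dotProduct_comm, Matrix.add_mulVec, dotProduct_add, ← bil_transpose M y v, bil, bil]
    rw [this, bil_add_left, bil_add_right, bil_add_right]
    ring
  have hφshift : ∀ p y, φ (y + (T p).a) = sgn (bil M (T p).a (T p).a) *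
      sgn ((M + M.transpose).mulVec (T p).a ⬝ᵥ y) * φ y := by
    intro p y
    by_cases hy : y + x₀ ∈ L
    · have hy' : y + (T p).a + x₀ ∈ L := by
        rw [add_right_comm]; exact L.add_mem hy (hTL p)
      simp only [hφ, quadState, if_pos hy, if_pos hy']
      rw [hshift, AddChar.map_add_eq_mul, AddChar.map_add_eq_mul]; ring
    · have hy' : y + (T p).a + x₀ ∉ L := fun h => hy (by
        rw [add_right_comm] at h; exact (L.add_mem_iff_left (hTL p)).1 h)
      simp only [hφ, quadState, if_neg hy, if_neg hy', mul_zero]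
  refine ⟨fun h => hφx₀ (by rw [h]; rfl), ?_, fun χ hχ => ?_⟩
  · rintro _ ⟨i, rfl⟩
    rw [PauliOp.mulVec_eq_iff]
    intro y
    rw [PauliOp.phase_eq, quadPauli]
    split_ifs with hi
    · simp only [chiFour_two_mul]
      rw [hφshift i y]
    · simp only [chiFour_two_mul, add_zero]
      by_cases hy : y + x₀ ∈ L
      · have h1 := (mem_span_iff_checks hT (y + x₀)).1 hy i (not_not.1 hi)
        rw [dotProduct_add] at h1
        rw [← AddChar.map_add_eq_mul, add_comm, h1, AddChar.map_zero_eq_one, one_mul]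
      · simp [hφ, quadState, hy]
  · have hχ' : ∀ i y, χ (y + (quadPauli T x₀ M i).a) = (quadPauli T x₀ M i).phase y * χ y :=
      fun i => (PauliOp.mulVec_eq_iff _ _).1 (hχ _ ⟨i, rfl⟩)
    have hsupp : ∀ y, χ y ≠ 0 → y + x₀ ∈ L := by
      intro y hy
      refine (mem_span_iff_checks hT _).2 fun i hi => ?_
      have h1 := hχ' i y
      rw [PauliOp.phase_eq, quadPauli, if_neg (not_not.2 hi)] at h1
      simp only [add_zero, chiFour_two_mul] at h1
      rw [← AddChar.map_add_eq_mul, add_comm, ← dotProduct_add] at h1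
      have h2 := mul_right_cancel₀ hy ((one_mul _).trans h1)
      generalize (fun l : Fin n => (if l = i then 1 else 0) + (T l).a i) ⬝ᵥ (y + x₀) = b at h2
      rcases zmod2_cases b with rfl | rfl
      · rfl
      · rw [sgn_one] at h2; norm_num at h2
    -- Constancy of `χ / φ` along `L`, cross-multiplied because `φ` vanishes off the coset.
    have hrel : ∀ v ∈ L, ∀ y, χ (y + v) * φ y = χ y * φ (y + v) := by
      intro v hv
      induction hv using Submodule.span_induction with
      | mem v hv =>
        obtain ⟨p, rfl⟩ := hv
        intro y
        by_cases hp : (T p).bit p = 0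
        · simp [hT.bit_eq_zero hp]
        · have hpn := XSOp.lt_of_bit_ne hp
          have h1 := hχ' ⟨p, hpn⟩ y
          have hp' : (T p).a ⟨p, hpn⟩ ≠ 0 := by simpa [XSOp.bit, hpn] using hp
          rw [PauliOp.phase_eq, quadPauli, if_pos hp'] at h1
          simp only [chiFour_two_mul] at h1
          simp only [h1, hφshift p y]
          ring
      | zero => intro y; simp
      | add v w hv hw h1 h2 =>
        intro y
        have e1 := h1 y
        have e2 := h2 (y + v)
        rw [← add_assoc]
        by_cases h0 : φ (y + v) = 0
        · have hy : y + v + x₀ ∉ L := by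
            intro hy
            simp only [hφ, quadState, hy, if_true, mul_eq_zero, hκ, sgn_ne_zero, or_self] at h0
          have hy1 : y + x₀ ∉ L := fun h => hy (by rw [add_right_comm]; exact L.add_mem h hv)
          have hy2 : y + v + w + x₀ ∉ L := fun h => hy (by
            rw [add_right_comm] at h; exact (L.add_mem_iff_left hw).1 h)
          simp [hφ, quadState, hy1, hy2]
        · refine mul_right_cancel₀ h0 ?_
          calc χ (y + v + w) * φ y * φ (y + v) = (χ (y + v + w) * φ (y + v)) * φ y := by ring
            _ = (χ (y + v) * φ y) * φ (y + v + w) := by rw [e2]; ring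
            _ = _ := by rw [e1]; ring
      | smul c v _ h1 =>
        rcases zmod2_cases c with rfl | rfl
        · intro y; simp
        · simpa using h1
    refine ⟨χ x₀ / φ x₀, funext fun y => ?_⟩
    rw [Pi.smul_apply, smul_eq_mul]
    by_cases hy : y + x₀ ∈ L
    · have := hrel _ hy x₀
      rw [add_comm y, ← add_assoc, Bits.add_self, zero_add] at this
      field_simp
      exact this
    · have h1 : χ y = 0 := by_contra fun h => hy (hsupp y h)
      rw [h1]
      simp [hφ, quadState, hy]

/-! ### Echelon forms adapted to a bipartition -/

/-- The indicator of `A`. -/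
def inA {n : ℕ} (A : Finset (Fin n)) (i : ℕ) : ℕ := if ∃ h : i < n, (⟨i, h⟩ : Fin n) ∈ A then 1 else 0

theorem inA_fin {n : ℕ} (A : Finset (Fin n)) (i : Fin n) : inA A i = if i ∈ A then 1 else 0 := by
  simp [inA]

/-- The order of the columns in which those outside of `A` come first. -/
def keyOut {n : ℕ} (A : Finset (Fin n)) (i : ℕ) : ℕ := if inA A i ≠ 0 then n + i else i

/-- The order of the columns in which those in `A` come first. -/
def keyIn {n : ℕ} (A : Finset (Fin n)) (i : ℕ) : ℕ := if inA A i ≠ 0 then i else n + i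

theorem keyOut_injOn {n : ℕ} (A : Finset (Fin n)) : Set.InjOn (keyOut A) (Set.Iio n) := by
  intro i hi j hj h
  simp only [Set.mem_Iio] at hi hj
  unfold keyOut at h
  split_ifs at h <;> omega

theorem keyIn_injOn {n : ℕ} (A : Finset (Fin n)) : Set.InjOn (keyIn A) (Set.Iio n) := by
  intro i hi j hj h
  simp only [Set.mem_Iio] at hi hj
  unfold keyIn at h
  split_ifs at h <;> omega

namespace XSOp

variable {n : ℕ}

theorem Spans.span_eq {key : ℕ → ℕ} {T : ℕ → XSOp n} {S : Set (XSOp n)} (hT : Spans key T S) :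
    Submodule.span (ZMod 2) (Set.range fun p => (T p).a) =
      Submodule.span (ZMod 2) ((fun g : XSOp n => g.a) '' S) := by
  apply le_antisymm
  · refine Submodule.span_le.2 ?_
    rintro _ ⟨p, rfl⟩
    exact hT.of_gen _ (stable_a_mem (Submodule.span (ZMod 2) ((fun g : XSOp n => g.a) '' S)))
      (fun g hg => Submodule.subset_span ⟨g, hg, rfl⟩) p
  · refine Submodule.span_le.2 ?_
    rintro _ ⟨g, hg, rfl⟩
    refine hT.gen_of _ (fun _ => True)
      (stable_a_mem (Submodule.span (ZMod 2) (Set.range fun p => (T p).a))) ⟨trivial, fun _ _ => trivial,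
      fun _ _ => trivial⟩ (fun _ _ => trivial) (fun h hh _ => ?_)
      (fun p => Submodule.subset_span ⟨p, rfl⟩) g hg
    rw [hh]
    exact Submodule.zero_mem _

theorem exists_spans {key : ℕ → ℕ} (hk : Set.InjOn key (Set.Iio n)) {S : Set (XSOp n)}
    (hS : S.Finite) : ∃ T, Spans key T S := by
  induction S, hS using Set.Finite.induction_on with
  | empty => exact ⟨_, spans_empty key⟩
  | insert _ _ ih =>
    obtain ⟨T, hT⟩ := ih
    exact ⟨_, hT.insertRow hk _ le_rfl⟩

/-- The rows of an echelon form with pivots in `C`, for a set `C` of columns that come last. -/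
theorem Reduced.supportedIn_eq {key : ℕ → ℕ} {T : ℕ → XSOp n} (hT : Reduced key T)
    {C : Finset (Fin n)} (hC : ∀ p ∈ C, ∀ q ∉ C, key q < key p) :
    supportedIn (Submodule.span (ZMod 2) (Set.range fun p => (T p).a)) C =
      Submodule.span (ZMod 2) (Set.range fun p : {p : Fin n // p ∈ C ∧ (T p).a p ≠ 0} => (T p).a) := by
  apply le_antisymm
  · rintro y ⟨hy, hyC⟩
    rw [hT.eq_sum hy]
    refine Submodule.sum_mem _ fun p _ => ?_
    by_cases hp : p ∈ C
    · by_cases hpp : (T p).a p = 0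
      · rw [hT.bit_eq_zero (by rwa [bit_fin])]
        simp
      · exact Submodule.smul_mem _ _ (Submodule.subset_span ⟨⟨p, hp, hpp⟩, rfl⟩)
    · simp [hyC p hp]
  · refine Submodule.span_le.2 ?_
    rintro _ ⟨⟨p, hp, -⟩, rfl⟩
    refine ⟨Submodule.subset_span ⟨p, rfl⟩, fun l hl => ?_⟩
    have := hT.lead p l (hC p hp l hl)
    rwa [bit_fin] at this

theorem Reduced.finrank_span {key : ℕ → ℕ} {T : ℕ → XSOp n} (hT : Reduced key T)
    (C : Finset (Fin n)) :
    Module.finrank (ZMod 2) (Submodule.span (ZMod 2)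
      (Set.range fun p : {p : Fin n // p ∈ C ∧ (T p).a p ≠ 0} => (T p).a)) =
      (C.filter fun p : Fin n => (T p).a p ≠ 0).card := by
  rw [finrank_span_eq_card, Fintype.card_subtype]
  · congr 1
    ext p
    simp
  · rw [Fintype.linearIndependent_iff]
    rintro u hu ⟨p, hp, hpp⟩
    have h := congrFun hu p
    rw [Finset.sum_apply, Finset.sum_eq_single ⟨p, hp, hpp⟩] at h
    · simpa [hpp] using h
    · rintro ⟨q, hq, hqq⟩ _ hne
      have := hT.off p q (fun h => hne (Subtype.ext (Fin.ext h.symm))) (by rwa [bit_fin])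
      rw [bit_fin] at this
      simp [this]
    · simp

theorem Reduced.finrank_eq {key : ℕ → ℕ} {T : ℕ → XSOp n} (hT : Reduced key T) :
    Module.finrank (ZMod 2) (Submodule.span (ZMod 2) (Set.range fun p => (T p).a)) =
      (Finset.univ.filter fun p : Fin n => (T p).a p ≠ 0).card := by
  have h : Submodule.span (ZMod 2) (Set.range fun p => (T p).a) =
      supportedIn (Submodule.span (ZMod 2) (Set.range fun p => (T p).a)) Finset.univ :=
    Submodule.ext fun y => by simp [mem_supportedIn]
  rw [h, hT.supportedIn_eq (by simp), hT.finrank_span]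

end XSOp

theorem keyOut_lt {n : ℕ} (A : Finset (Fin n)) :
    ∀ p ∈ A, ∀ q ∉ A, keyOut A q < keyOut A p := by
  intro p hp q hq
  simp only [keyOut, inA_fin, hp, hq, if_true, if_false]
  have := q.2
  simp
  omega

theorem keyIn_lt {n : ℕ} (A : Finset (Fin n)) :
    ∀ p ∈ Aᶜ, ∀ q ∉ Aᶜ, keyIn A q < keyIn A p := by
  intro p hp q hq
  rw [Finset.mem_compl] at hp hq
  rw [not_not] at hq
  simp only [keyIn, inA_fin, hp, hq, if_true, if_false]
  have := q.2
  simp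
  omega

/-! ### The coupling matrix read off from adapted echelon forms. -/

/-- The exponent of `i` in the change of `g.phase` from `x` to `x + w`. -/
def crossExp {n : ℕ} (g : XSOp n) (x w : Bits n) : ZMod 4 :=
  ∑ l, if w l = 0 then 0 else if x l = 0 then g.b l else 3 * g.b l

theorem XSOp.phase_add {n : ℕ} (g : XSOp n) (x w : Bits n) :
    g.phase (x + w) = chiFour (crossExp g x w) * g.phase x := by
  rw [XSOp.phase_eq, XSOp.phase_eq, crossExp, AddChar.map_sum_eq_prod, mul_left_comm,
    ← Finset.prod_mul_distrib]
  congr 1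
  refine Finset.prod_congr rfl fun l _ => ?_
  have h4 : chiFour (3 * g.b l) * chiFour (g.b l) = 1 := by
    rw [← AddChar.map_add_eq_mul, show 3 * g.b l + g.b l = 4 * g.b l by ring,
      show (4 : ZMod 4) = 0 from rfl, zero_mul, AddChar.map_zero_eq_one]
  rcases zmod2_cases (w l) with h1 | h1 <;> rcases zmod2_cases (x l) with h2 | h2
  · simp [h1, h2]
  · simp [h1, h2]
  · simp [h1, h2, ZMod.val_one]
  · simp [h1, h2, ZMod.val_one, h4, show (1 + 1 : ZMod 2) = 0 from rfl]

/-- The coupling matrix between the rows of `T₁` with pivot in `A` and the rows of `T₂` with pivot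
outside of `A`. -/
def crossMatrix {n : ℕ} (A : Finset (Fin n)) (T₁ T₂ : ℕ → XSOp n) (x₀ : Bits n) :
    Matrix (Fin n) (Fin n) (ZMod 2) := Matrix.of fun p q =>
  if p ∈ A ∧ q ∉ A then
    (((crossExp (T₁ p) x₀ (T₂ q).a).val - 1 - ((crossExp (T₁ p) x₀ (T₂ q).a).val - 2) : ℕ) : ZMod 2)
  else 0

theorem isCoupling_crossMatrix {n : ℕ} (A : Finset (Fin n)) (T₁ T₂ : ℕ → XSOp n) (x₀ : Bits n) :
    IsCoupling A (crossMatrix A T₁ T₂ x₀) := by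
  intro p q h
  by_contra hn
  exact h (if_neg hn)

/-- The truncated expression maps `0, 1` to `0` and `2, 3` to `1`. An exponent of `i` with real
value is `0` or `2`, so it yields half the exponent. -/
theorem sgn_eq_chiFour {e : ZMod 4} (h : chiFour e = 1 ∨ chiFour e = -1) :
    chiFour e = sgn ((e.val - 1 - (e.val - 2) : ℕ) : ZMod 2) := by
  have hI : Complex.I ≠ 1 ∧ Complex.I ≠ -1 ∧ -Complex.I ≠ 1 := by
    refine ⟨fun h => ?_, fun h => ?_, fun h => ?_⟩ <;> simpa using congrArg Complex.im h
  have key : ∀ e : ZMod 4, e = 0 ∨ e = 1 ∨ e = 2 ∨ e = 3 := by decide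
  have v2 : (2 : ZMod 4).val = 2 := rfl
  have v3 : (3 : ZMod 4).val = 3 := rfl
  have v1 : (1 : ZMod 4).val = 1 := rfl
  rcases key e with rfl | rfl | rfl | rfl
  · simp
  · simp [chiFour, AddChar.zmodChar_apply, v1, hI.1, hI.2.1] at h
  · simp [chiFour, AddChar.zmodChar_apply, v2, sgn_one]
  · rw [chiFour, AddChar.zmodChar_apply, v3, Complex.I_pow_three] at h
    rcases h with h | h
    · exact absurd h hI.2.2
    · exact absurd (neg_injective h) hI.1

/-- Echelon forms `T₁` and `T₂` of `L`, adapted to the bipartition, `T₁` by operators fixing `ψ`. -/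
structure AdaptedForms {n : ℕ} (A : Finset (Fin n)) (L : Submodule (ZMod 2) (Bits n))
    (ψ : QVec n) (T₁ T₂ : ℕ → XSOp n) : Prop where
  reduced₁ : XSOp.Reduced (keyOut A) T₁
  reduced₂ : XSOp.Reduced (keyIn A) T₂
  span₁ : Submodule.span (ZMod 2) (Set.range fun p => (T₁ p).a) = L
  span₂ : Submodule.span (ZMod 2) (Set.range fun p => (T₂ p).a) = L
  fixes : ∀ p, (T₁ p).Fixes ψ

theorem disjoint_of_supportedIn {n : ℕ} {A : Finset (Fin n)} {L : Submodule (ZMod 2) (Bits n)}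
    {w w' : Bits n} (hw : w ∈ supportedIn L A) (hw' : w' ∈ supportedIn L Aᶜ) (l : Fin n) :
    w l = 0 ∨ w' l = 0 := by
  by_cases hl : l ∈ A
  · exact .inr (hw'.2 l (by simpa using hl))
  · exact .inl (hw.2 l hl)

/-- By bimultiplicativity it suffices to compare on bases. The rows of `T₁` with pivot in `A` form a
basis of `L_A`, those of `T₂` with pivot outside a basis of `L_B`. -/
theorem AdaptedForms.couples {n : ℕ} {A : Finset (Fin n)} {L : Submodule (ZMod 2) (Bits n)}
    {ψ : QVec n} {T₁ T₂ : ℕ → XSOp n} (h : AdaptedForms A L ψ T₁ T₂) {x₀ : Bits n}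
    (S : CosetState L x₀ ψ) : Couples A L x₀ ψ (crossMatrix A T₁ T₂ x₀) := by
  have hx₀ : ψ x₀ ≠ 0 := (S.supp x₀).2 (by rw [Bits.add_self]; exact L.zero_mem)
  intro w hw w' hw'
  let v : Fin n → Bits n := fun p => if p ∈ A then (T₁ p).a else 0
  let v' : Fin n → Bits n := fun q => if q ∈ A then 0 else (T₂ q).a
  have hv : ∀ p, v p ∈ supportedIn L A := by
    intro p
    by_cases hp : p ∈ A
    · simp only [v, if_pos hp]
      refine ⟨by rw [← h.span₁]; exact Submodule.subset_span ⟨p, rfl⟩, fun l hl => ?_⟩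
      rw [← XSOp.bit_fin]
      exact h.reduced₁.lead p l (keyOut_lt A p hp l hl)
    · simp only [v, if_neg hp]
      exact Submodule.zero_mem _
  have hv' : ∀ q, v' q ∈ supportedIn L Aᶜ := by
    intro q
    by_cases hq : q ∈ A
    · simp only [v', if_pos hq]
      exact Submodule.zero_mem _
    · simp only [v', if_neg hq]
      refine ⟨by rw [← h.span₂]; exact Submodule.subset_span ⟨q, rfl⟩, fun l hl => ?_⟩
      rw [← XSOp.bit_fin]
      exact h.reduced₂.lead q l (keyIn_lt A q (by simpa using hq) l hl)
  -- In reduced echelon form the coordinates of `w` are its own bits at the pivots. This is why `M`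
  -- can be indexed by qubits and applied to `w` directly.
  have hwv : w = ∑ p, w p • v p := by
    conv_lhs => rw [h.reduced₁.eq_sum (y := w) (by rw [h.span₁]; exact hw.1)]
    refine Finset.sum_congr rfl fun p _ => ?_
    by_cases hp : p ∈ A
    · simp [v, hp]
    · simp [hw.2 p hp]
  have hwv' : w' = ∑ q, w' q • v' q := by
    conv_lhs => rw [h.reduced₂.eq_sum (y := w') (by rw [h.span₂]; exact hw'.1)]
    refine Finset.sum_congr rfl fun q _ => ?_
    by_cases hq : q ∈ A
    · simp [hw'.2 q (by simpa using hq)]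
    · simp [v', hq]
  have hbase : ∀ p q, cross ψ x₀ (v p) (v' q) = sgn (crossMatrix A T₁ T₂ x₀ p q) := by
    intro p q
    by_cases hpq : p ∈ A ∧ q ∉ A
    · have e1 := S.cross_eq_one_or hx₀ (hv p).1 (hv' q).1 (disjoint_of_supportedIn (hv p) (hv' q))
      have hvp : v p = (T₁ p).a := if_pos hpq.1
      have hvq : v' q = (T₂ q).a := if_neg hpq.2
      -- Since `T₁ p` fixes `ψ`, translating by `v p` multiplies the amplitudes at `x₀` and at `x₀ +
      -- v' q` by its phases there; `cross` is the quotient of these phases.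
      have e2 : cross ψ x₀ (v p) (v' q) = chiFour (crossExp (T₁ p) x₀ (T₂ q).a) := by
        have n1 := S.ne_zero_add hx₀ (hv p).1
        have n2 := S.ne_zero_add hx₀ (hv' q).1
        rw [cross, div_eq_iff (mul_ne_zero n1 n2), add_right_comm, hvp, h.fixes, h.fixes, ← hvq,
          XSOp.phase_add]
        ring
      rw [e2] at e1 ⊢
      rw [sgn_eq_chiFour e1, crossMatrix, Matrix.of_apply, if_pos hpq]
    · rw [crossMatrix, Matrix.of_apply, if_neg hpq, AddChar.map_zero_eq_one]
      by_cases hp : p ∈ A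
      · have hq : q ∈ A := by by_contra hq; exact hpq ⟨hp, hq⟩
        rw [CosetState.cross_comm, show v' q = 0 from if_pos hq,
          S.cross_zero_left hx₀ (hv p).1]
      · rw [show v p = 0 from if_neg hp, S.cross_zero_left hx₀ (hv' q).1]
  rw [bil_eq_sum]
  conv_lhs => rw [hwv]
  refine S.cross_sum_left hx₀ _ _ _ _ (fun p => (hv p).1) hw'.1
    (fun p l => disjoint_of_supportedIn (hv p) hw' l) fun p => ?_
  conv_lhs => rw [hwv', CosetState.cross_comm]
  rw [S.cross_sum_left hx₀ _ _ _ (fun q => crossMatrix A T₁ T₂ x₀ p q) (fun q => (hv' q).1)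
    (hv p).1 (fun q l => (disjoint_of_supportedIn (hv p) (hv' q) l).symm) fun q => ?_]
  · simp only [mul_comm]
  · rw [CosetState.cross_comm, hbase]

theorem exists_adaptedForms {n m : ℕ} {g : Fin m → XSOp n} {ψ : QVec n} (h : IsXSStateOf g ψ)
    (A : Finset (Fin n)) : ∃ T₁ T₂, AdaptedForms A
      (Submodule.span (ZMod 2) (Set.range fun j => (g j).a)) ψ T₁ T₂ := by
  have hL : Submodule.span (ZMod 2) (Set.range fun j => (g j).a) =
      Submodule.span (ZMod 2) ((fun g : XSOp n => g.a) '' Set.range g) := by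
    rw [← Set.range_comp]; rfl
  obtain ⟨T₁, h₁⟩ := XSOp.exists_spans (keyOut_injOn A) (Set.finite_range g)
  obtain ⟨T₂, h₂⟩ := XSOp.exists_spans (keyIn_injOn A) (Set.finite_range g)
  refine ⟨T₁, T₂, h₁.reduced, h₂.reduced, by rw [hL, h₁.span_eq], by rw [hL, h₂.span_eq],
    h₁.of_gen _ (XSOp.stable_fixes ψ) ?_⟩
  rintro _ ⟨j, rfl⟩
  exact ((isXSStateOf_iff g ψ).1 h).2.1 j

theorem exists_ne_zero_of_isXSStateOf {n m : ℕ} {g : Fin m → XSOp n} {ψ : QVec n}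
    (h : IsXSStateOf g ψ) : ∃ x₀, ψ x₀ ≠ 0 := Function.ne_iff.1 h.1

/-- Bipartite reduction to Pauli stabilizer states. -/
theorem exists_pauli_diagonallyEquivalent {n : ℕ} {ψ : QVec n} (A : Finset (Fin n))
    (h : IsXSStabilizerState ψ) :
    ∃ φ : QVec n, IsPauliStabilizerState φ ∧ DiagonallyEquivalent A ψ φ := by
  obtain ⟨m, g, hg⟩ := h
  obtain ⟨x₀, hx₀⟩ := exists_ne_zero_of_isXSStateOf hg
  obtain ⟨T₁, T₂, hT⟩ := exists_adaptedForms hg A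
  have S := cosetState_of_isXSStateOf hg hx₀
  have hκ : (‖ψ x₀‖ : ℂ) ≠ 0 := by simpa using hx₀
  refine ⟨_, ⟨n, _, isPauliStateOf_quadPauli hT.reduced₁ x₀ (crossMatrix A T₁ T₂ x₀) hκ⟩, ?_⟩
  rw [hT.span₁]
  exact S.diagonallyEquivalent (isCoupling_crossMatrix _ _ _ _) (hT.couples S)

/-! ### Reduced density operators -/

theorem glue_bijective {n : ℕ} (A : Finset (Fin n)) :
    Function.Bijective fun p : BitsIn A × BitsOut A => glue A p.1 p.2 := by
  constructor
  · rintro ⟨x, z⟩ ⟨x', z'⟩ h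
    refine Prod.ext (funext fun i => ?_) (funext fun i => ?_)
    · have := congrFun h i.1
      simpa only [glue_left _ _ _ _ i.2] using this
    · have := congrFun h i.1
      simpa only [glue_right _ _ _ _ i.2] using this
  · intro w
    refine ⟨(fun i => w i, fun i => w i), funext fun i => ?_⟩
    simp only [glue]
    split_ifs <;> rfl

theorem sum_glue {n : ℕ} (A : Finset (Fin n)) (f : Bits n → ℂ) :
    ∑ x : BitsIn A, ∑ z : BitsOut A, f (glue A x z) = ∑ w, f w := by
  rw [← Fintype.sum_prod_type']
  exact Fintype.sum_bijective _ (glue_bijective A) _ _ fun _ => rfl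

theorem glue_add {n : ℕ} (A : Finset (Fin n)) (x x' : BitsIn A) (z z' : BitsOut A) :
    glue A (x + x') (z + z') = glue A x z + glue A x' z' := by
  funext i
  simp only [glue, Pi.add_apply]
  split_ifs <;> rfl

theorem sum_supportedIn {n : ℕ} (A : Finset (Fin n)) (L : Submodule (ZMod 2) (Bits n))
    [Fintype (supportedIn L A)] (f : Bits n → ℂ)
    (hf : ∀ w, w ∉ L → f w = 0) : ∑ x : BitsIn A, f (glue A x 0) = ∑ w : supportedIn L A, f w := by
  symm
  refine Fintype.sum_of_injective (fun (w : supportedIn L A) (i : {i // i ∈ A}) => w.1 i) (fun w w' h => ?_) _ _ (fun x hx => hf _ fun hL => hx ?_)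
    fun w => ?_
  · refine Subtype.ext (funext fun i => ?_)
    by_cases hi : i ∈ A
    · exact congrFun h ⟨i, hi⟩
    · rw [w.2.2 i hi, w'.2.2 i hi]
  · exact ⟨⟨_, hL, fun l hl => glue_right _ _ _ _ hl⟩, funext fun i => glue_left _ _ _ _ i.2⟩
  · congr 1
    funext i
    by_cases hi : i ∈ A
    · rw [glue_left _ _ _ _ hi]
    · rw [glue_right _ _ _ _ hi, w.2.2 i hi]; rfl

theorem sum_supportedIn_compl {n : ℕ} (A : Finset (Fin n)) (L : Submodule (ZMod 2) (Bits n))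
    [Fintype (supportedIn L Aᶜ)] (f : Bits n → ℂ)
    (hf : ∀ w, w ∉ L → f w = 0) : ∑ z : BitsOut A, f (glue A 0 z) = ∑ w : supportedIn L Aᶜ, f w := by
  symm
  refine Fintype.sum_of_injective (fun (w : supportedIn L Aᶜ) (i : {i // i ∉ A}) => w.1 i) (fun w w' h => ?_) _ _ (fun x hx => hf _ fun hL => hx ?_)
    fun w => ?_
  · refine Subtype.ext (funext fun i => ?_)
    by_cases hi : i ∈ A
    · rw [w.2.2 i (by simpa using hi), w'.2.2 i (by simpa using hi)]
    · exact congrFun h ⟨i, hi⟩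
  · exact ⟨⟨_, hL, fun l hl => glue_left _ _ _ _ (by simpa using hl)⟩,
      funext fun i => glue_right _ _ _ _ i.2⟩
  · congr 1
    funext i
    by_cases hi : i ∈ A
    · rw [glue_left _ _ _ _ hi, w.2.2 i (by simpa using hi)]; rfl
    · rw [glue_right _ _ _ _ hi]

open scoped ComplexOrder in
theorem trace_reducedDensity {n : ℕ} (A : Finset (Fin n)) {ψ : QVec n} (hψ : ψ ≠ 0) :
    (reducedDensity A ψ).trace = 1 := by
  have h0 : ∑ w, ψ w * star (ψ w) ≠ 0 := by
    intro h
    exact hψ (dotProduct_self_star_eq_zero.1 h)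
  simp only [Matrix.trace, Matrix.diag, reducedDensity, Matrix.of_apply]
  rw [← Finset.sum_div, sum_glue A fun w => ψ w * star (ψ w), div_self h0]

/-- A vector in the left kernel of the restriction of `M` to the vectors of `L` supported on the two
parties. -/
def IsUncoupled {n : ℕ} (A : Finset (Fin n)) (L : Submodule (ZMod 2) (Bits n))
    (M : Matrix (Fin n) (Fin n) (ZMod 2)) (w : Bits n) : Prop :=
  ∀ w' ∈ supportedIn L Aᶜ, bil M w w' = 0

/-- `w' ↦ (-1)^(wᵀ M w')` is a character of `W`, and the sum of a nontrivial character vanishes. -/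
theorem sum_sgn_bil {n : ℕ} (M : Matrix (Fin n) (Fin n) (ZMod 2)) (W : Submodule (ZMod 2) (Bits n))
    [Fintype W] (w : Bits n) [Decidable (∀ w' ∈ W, bil M w w' = 0)] :
    ∑ w' : W, sgn (bil M w w') = if ∀ w' ∈ W, bil M w w' = 0 then (Fintype.card W : ℂ) else 0 := by
  classical
  let χ : AddChar W ℂ :=
    { toFun := fun w' => sgn (bil M w w')
      map_zero_eq_one' := by simp [bil]
      map_add_eq_mul' := fun x y => by
        rw [Submodule.coe_add, bil_add_right, AddChar.map_add_eq_mul] }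
  have h := AddChar.sum_eq_ite χ
  have h2 : χ = 0 ↔ ∀ w' ∈ W, bil M w w' = 0 := by
    constructor
    · intro h w' hw'
      have := DFunLike.congr_fun h ⟨w', hw'⟩
      change sgn (bil M w w') = 1 at this
      rcases zmod2_cases (bil M w w') with h3 | h3
      · exact h3
      · rw [h3, sgn_one] at this; norm_num at this
    · intro h
      refine DFunLike.ext _ _ fun w' => ?_
      change sgn (bil M w w') = 1
      rw [h _ w'.2, AddChar.map_zero_eq_one]
  simp only [h2] at h
  exact h

theorem CosetState.sum_norm {n : ℕ} {L : Submodule (ZMod 2) (Bits n)} {x₀ : Bits n} {ψ : QVec n}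
    (S : CosetState L x₀ ψ) :
    ∑ w, ψ w * star (ψ w) = Nat.card L * (‖ψ x₀‖ ^ 2 : ℂ) := by
  classical
  have h1 : ∑ w : L, ψ (w + x₀) * star (ψ (w + x₀)) = ∑ w, ψ w * star (ψ w) := by
    refine Fintype.sum_of_injective (fun w : L => (w : Bits n) + x₀) (fun w w' h => ?_) _ _
      (fun x hx => ?_) fun w => rfl
    · exact Subtype.ext (add_right_cancel h)
    · have : ψ x = 0 := by
        by_contra h
        exact hx ⟨⟨x + x₀, (S.supp x).1 h⟩, Bits.add_add_cancel _ _⟩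
      simp [this]
  rw [← h1, Finset.sum_congr rfl fun w _ => ?_, Finset.sum_const, Finset.card_univ,
    nsmul_eq_mul, Nat.card_eq_fintype_card]
  have hw : ψ (w + x₀) ≠ 0 := (S.supp _).2 (by rw [Bits.add_add_cancel]; exact w.2)
  rw [← S.norm_eq hw, Complex.star_def, Complex.mul_conj, Complex.normSq_eq_norm_sq]
  push_cast
  rfl

/-- This is the amplitude form of `ρ_A² = r ρ_A`. After the substitution `y = x + ω`, `t = z + τ`,
only `ω ∈ L_A` and `τ ∈ L_B` contribute. The phases combine to a sign times `ψ (x, z)`, and summing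
the sign over `τ` leaves only uncoupled `ω`. -/
theorem CosetState.triple_sum {n : ℕ} {A : Finset (Fin n)} {L : Submodule (ZMod 2) (Bits n)}
    {x₀ : Bits n} {ψ : QVec n} (S : CosetState L x₀ ψ) {M : Matrix (Fin n) (Fin n) (ZMod 2)}
    (hc : Couples A L x₀ ψ M) (x : BitsIn A) (z : BitsOut A) :
    ∑ y : BitsIn A, ∑ t : BitsOut A,
      ψ (glue A x t) * star (ψ (glue A y t)) * ψ (glue A y z) =
      ((Nat.card {w : supportedIn L A // IsUncoupled A L M w} * Nat.card (supportedIn L Aᶜ) : ℕ) : ℂ)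
        * (‖ψ x₀‖ ^ 2 : ℂ) * ψ (glue A x z) := by
  classical
  set X := glue A x z with hX
  have e1 : ∀ (ω : BitsIn A) (τ : BitsOut A), glue A (x + ω) (z + τ) =
      X + glue A ω 0 + glue A 0 τ := by
    intro ω τ
    rw [add_assoc, ← glue_add, add_zero, zero_add, ← glue_add]
  have e2 : ∀ (ω : BitsIn A), glue A (x + ω) z = X + glue A ω 0 := by
    intro ω; rw [hX, ← glue_add, add_zero]
  have e3 : ∀ (τ : BitsOut A), glue A x (z + τ) = X + glue A 0 τ := by
    intro τ; rw [hX, ← glue_add, add_zero]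
  have step1 : ∑ y : BitsIn A, ∑ t : BitsOut A,
      ψ (glue A x t) * star (ψ (glue A y t)) * ψ (glue A y z) =
      ∑ ω : BitsIn A, ∑ τ : BitsOut A, ψ (X + glue A 0 τ) *
        star (ψ (X + glue A ω 0 + glue A 0 τ)) * ψ (X + glue A ω 0) := by
    rw [← Equiv.sum_comp (Equiv.addLeft x)]
    refine Finset.sum_congr rfl fun ω _ => ?_
    rw [← Equiv.sum_comp (Equiv.addLeft z)]
    refine Finset.sum_congr rfl fun τ _ => ?_
    simp only [Equiv.coe_addLeft, e1, e2, e3]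
  rw [step1]
  by_cases hXV : ψ X = 0
  · rw [hXV, mul_zero]
    refine Finset.sum_eq_zero fun ω _ => Finset.sum_eq_zero fun τ _ => ?_
    by_contra h
    simp only [mul_eq_zero, star_eq_zero, not_or] at h
    obtain ⟨⟨h1, h2⟩, h3⟩ := h
    rw [← ne_eq, S.supp] at h1 h2 h3
    -- Modulo 2 the three arguments add up to `X`, so if all three lay in the coset, `X` would too.
    have h4 := L.add_mem (L.add_mem h1 h2) h3
    rw [show X + glue A 0 τ + x₀ + (X + glue A ω 0 + glue A 0 τ + x₀) + (X + glue A ω 0 + x₀) =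
      X + x₀ + (X + X) + (x₀ + x₀) + (glue A 0 τ + glue A 0 τ) + (glue A ω 0 + glue A ω 0) by abel]
      at h4
    simp only [Bits.add_self, add_zero] at h4
    exact (S.supp X).2 h4 hXV
  have hsupp : ∀ w, w ∉ L → ψ (X + w) = 0 := by
    intro w hw
    by_contra h
    refine hw ?_
    have := L.add_mem ((S.supp _).1 h) ((S.supp X).1 hXV)
    rwa [show X + w + x₀ + (X + x₀) = w + (X + X) + (x₀ + x₀) by abel, Bits.add_self,
      Bits.add_self, add_zero, add_zero] at this
  have hXL : X + x₀ ∈ L := (S.supp X).1 hXV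
  rw [sum_supportedIn A L (fun w => ∑ τ : BitsOut A, ψ (X + glue A 0 τ) *
    star (ψ (X + w + glue A 0 τ)) * ψ (X + w)) (fun w hw => by simp [hsupp w hw])]
  have step2 : ∀ w : supportedIn L A, ∑ τ : BitsOut A, ψ (X + glue A 0 τ) *
      star (ψ (X + w + glue A 0 τ)) * ψ (X + w) = (if IsUncoupled A L M w then
        (Fintype.card (supportedIn L Aᶜ) : ℂ) else 0) * ((‖ψ x₀‖ ^ 2 : ℂ) * ψ X) := by
    intro w
    rw [sum_supportedIn_compl A L (fun w' => ψ (X + w') * star (ψ (X + w + w')) * ψ (X + w))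
      (fun w' hw' => by simp [hsupp w' hw'])]
    rw [IsUncoupled, ← sum_sgn_bil, Finset.sum_mul]
    refine Finset.sum_congr rfl fun w' _ => ?_
    have n1 := S.ne_zero_add hXV w.2.1
    have n2 := S.ne_zero_add hXV w'.2.1
    have n3 := S.ne_zero_add n1 w'.2.1
    have h1 := S.cross_shift x₀ (y := X + x₀) hXL (disjoint_of_supportedIn w.2 w'.2)
    rw [add_comm X, ← add_assoc, Bits.add_self, zero_add, hc _ w.2 _ w'.2, cross,
      div_eq_iff (mul_ne_zero n1 n2)] at h1
    -- The second difference moves both displacements into one amplitude, which then meets its own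
    -- conjugate.
    have h2 : ψ (X + w) * ψ (X + w') = sgn (bil M w w') * (ψ X * ψ (X + w + w')) := by
      rw [h1, ← mul_assoc, sgn_mul_self, one_mul]
    have h3 : ψ (X + w + w') * star (ψ (X + w + w')) = (‖ψ x₀‖ ^ 2 : ℂ) := by
      rw [← S.norm_eq n3, Complex.star_def, Complex.mul_conj, Complex.normSq_eq_norm_sq]
      push_cast
      rfl
    calc _ = (ψ (X + w) * ψ (X + w')) * star (ψ (X + w + w')) := by ring
      _ = sgn (bil M w w') * ψ X * (ψ (X + w + w') * star (ψ (X + w + w'))) := by rw [h2]; ring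
      _ = _ := by rw [h3]; ring
  rw [Finset.sum_congr rfl fun w _ => step2 w, ← Finset.sum_mul, ← Finset.sum_filter,
    Finset.sum_const, nsmul_eq_mul, ← Fintype.card_subtype, Nat.card_eq_fintype_card,
    Nat.card_eq_fintype_card, Nat.cast_mul]
  ring

/-- The nonzero eigenvalue of the reduced density operator. -/
noncomputable def flatValue {n : ℕ} (A : Finset (Fin n)) (L : Submodule (ZMod 2) (Bits n))
    (M : Matrix (Fin n) (Fin n) (ZMod 2)) : ℝ :=
  ((Nat.card {w : supportedIn L A // IsUncoupled A L M w} * Nat.card (supportedIn L Aᶜ) : ℕ) : ℝ) /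
    Nat.card L

theorem flatValue_pos {n : ℕ} (A : Finset (Fin n)) (L : Submodule (ZMod 2) (Bits n))
    (M : Matrix (Fin n) (Fin n) (ZMod 2)) : 0 < flatValue A L M := by
  have : Nonempty {w : supportedIn L A // IsUncoupled A L M w} :=
    ⟨⟨0, fun w' _ => by simp [bil]⟩⟩
  unfold flatValue
  have h1 : 0 < Nat.card {w : supportedIn L A // IsUncoupled A L M w} := Nat.card_pos
  have h2 : 0 < Nat.card (supportedIn L Aᶜ) := Nat.card_pos
  have h3 : 0 < Nat.card L := Nat.card_pos
  positivity

theorem CosetState.reducedDensity_mul_self {n : ℕ} {A : Finset (Fin n)}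
    {L : Submodule (ZMod 2) (Bits n)} {x₀ : Bits n} {ψ : QVec n} (S : CosetState L x₀ ψ)
    {M : Matrix (Fin n) (Fin n) (ZMod 2)} (hc : Couples A L x₀ ψ M) :
    reducedDensity A ψ * reducedDensity A ψ = (flatValue A L M : ℂ) • reducedDensity A ψ := by
  have hx₀ : ψ x₀ ≠ 0 := (S.supp x₀).2 (by rw [Bits.add_self]; exact L.zero_mem)
  have hκ : (‖ψ x₀‖ : ℂ) ≠ 0 := by simpa using hx₀
  have hL : ((Nat.card L : ℕ) : ℂ) ≠ 0 := by
    have : 0 < Nat.card L := Nat.card_pos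
    exact_mod_cast this.ne'
  ext x y
  simp only [Matrix.mul_apply, Matrix.smul_apply, reducedDensity, Matrix.of_apply, S.sum_norm,
    smul_eq_mul]
  set D : ℂ := Nat.card L * (‖ψ x₀‖ ^ 2 : ℂ) with hD
  have hD0 : D ≠ 0 := mul_ne_zero hL (pow_ne_zero 2 hκ)
  set C : ℂ := ((Nat.card {w : supportedIn L A // IsUncoupled A L M w} *
    Nat.card (supportedIn L Aᶜ) : ℕ) : ℂ) with hC
  have hflat : (flatValue A L M : ℂ) = C / Nat.card L := by
    rw [flatValue, Complex.ofReal_div, Complex.ofReal_natCast, Complex.ofReal_natCast]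
  have key : ∑ k : BitsIn A, (∑ t, ψ (glue A x t) * star (ψ (glue A k t))) *
      (∑ z, ψ (glue A k z) * star (ψ (glue A y z))) =
      C * (‖ψ x₀‖ ^ 2 : ℂ) * ∑ z, ψ (glue A x z) * star (ψ (glue A y z)) := by
    simp only [Finset.mul_sum, Finset.sum_mul]
    rw [Finset.sum_comm]
    refine Finset.sum_congr rfl fun z _ => ?_
    rw [← mul_assoc, ← S.triple_sum hc x z, Finset.sum_mul]
    refine Finset.sum_congr rfl fun k _ => ?_
    rw [Finset.sum_mul]
    refine Finset.sum_congr rfl fun t _ => ?_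
    ring
  calc _ = (∑ k : BitsIn A, (∑ t, ψ (glue A x t) * star (ψ (glue A k t))) *
      (∑ z, ψ (glue A k z) * star (ψ (glue A y z)))) / (D * D) := by
        rw [Finset.sum_div]
        refine Finset.sum_congr rfl fun k _ => ?_
        rw [div_mul_div_comm]
    _ = _ := by
        rw [key, hflat, hD]
        field_simp

theorem eigenvalue_of_mul_self {ι : Type*} [Fintype ι] [DecidableEq ι] {ρ : Matrix ι ι ℂ}
    (hρ : ρ.IsHermitian) {r : ℝ} (h : ρ * ρ = (r : ℂ) • ρ) (k : ι) :
    hρ.eigenvalues k = 0 ∨ hρ.eigenvalues k = r := by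
  set l := hρ.eigenvalues k with hl
  set v : ι → ℂ := ⇑(hρ.eigenvectorBasis k) with hv
  have h1 : ρ.mulVec v = l • v := hρ.mulVec_eigenvectorBasis k
  have hv0 : v ≠ 0 := by
    intro h0
    refine hρ.eigenvectorBasis.orthonormal.ne_zero k ?_
    ext i
    exact congrFun h0 i
  have h2 : (ρ * ρ).mulVec v = (l * l) • v := by
    rw [← Matrix.mulVec_mulVec, h1, Matrix.mulVec_smul, h1, smul_smul]
  rw [h, Matrix.smul_mulVec, h1] at h2
  obtain ⟨i, hi⟩ := Function.ne_iff.1 hv0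
  have h3 := congrFun h2 i
  simp only [Pi.smul_apply, smul_eq_mul, Complex.real_smul] at h3
  have h4 : (r : ℂ) * l = l * l := by
    refine mul_right_cancel₀ hi ?_
    rw [mul_assoc, h3]
    push_cast
    ring
  have h5 : r * l = l * l := by exact_mod_cast h4
  by_cases h0 : l = 0
  · exact .inl h0
  · exact .inr (mul_right_cancel₀ h0 h5).symm

/-- Every eigenvalue is `0` or `r`, so each term of the entropy equals the eigenvalue times `-log
r`; the eigenvalues add up to the trace `1`. -/
theorem CosetState.entanglementEntropy_eq {n : ℕ} {A : Finset (Fin n)}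
    {L : Submodule (ZMod 2) (Bits n)} {x₀ : Bits n} {ψ : QVec n} (S : CosetState L x₀ ψ)
    {M : Matrix (Fin n) (Fin n) (ZMod 2)} (hc : Couples A L x₀ ψ M) :
    entanglementEntropy A ψ = -Real.log (flatValue A L M) / Real.log 2 := by
  have hx₀ : ψ x₀ ≠ 0 := (S.supp x₀).2 (by rw [Bits.add_self]; exact L.zero_mem)
  have htr := trace_reducedDensity A (ψ := ψ) (fun h => hx₀ (by rw [h]; rfl))
  rw [(reducedDensity_isHermitian A ψ).trace_eq_sum_eigenvalues] at htr
  have htr' : ∑ k, (reducedDensity_isHermitian A ψ).eigenvalues k = 1 := by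
    have : ((∑ k, (reducedDensity_isHermitian A ψ).eigenvalues k : ℝ) : ℂ) = 1 := by
      push_cast
      exact htr
    exact_mod_cast this
  rw [entanglementEntropy]
  congr 1
  calc _ = ∑ k, (reducedDensity_isHermitian A ψ).eigenvalues k * -Real.log (flatValue A L M) := by
        refine Finset.sum_congr rfl fun k _ => ?_
        rcases eigenvalue_of_mul_self (reducedDensity_isHermitian A ψ)
          (S.reducedDensity_mul_self hc) k with h | h <;> rw [h]
        · simp
        · rw [Real.negMulLog]; ring
    _ = _ := by rw [← Finset.sum_mul, htr', one_mul]

/-- Flatness of the entanglement spectrum. -/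
theorem flat_of_isXSStabilizerState {n : ℕ} {ψ : QVec n} (A : Finset (Fin n))
    (h : IsXSStabilizerState ψ) :
    (∃ (r : ℝ) (P : Matrix (BitsIn A) (BitsIn A) ℂ), 0 < r ∧ P.IsHermitian ∧ P * P = P ∧
        reducedDensity A ψ = (r : ℂ) • P) ∧
      ∀ k l, (reducedDensity_isHermitian A ψ).eigenvalues k ≠ 0 →
        (reducedDensity_isHermitian A ψ).eigenvalues l ≠ 0 →
        (reducedDensity_isHermitian A ψ).eigenvalues k =
          (reducedDensity_isHermitian A ψ).eigenvalues l := by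
  obtain ⟨m, g, hg⟩ := h
  obtain ⟨x₀, hx₀⟩ := exists_ne_zero_of_isXSStateOf hg
  obtain ⟨T₁, T₂, hT⟩ := exists_adaptedForms hg A
  have S := cosetState_of_isXSStateOf hg hx₀
  set L := Submodule.span (ZMod 2) (Set.range fun j => (g j).a)
  have hc := hT.couples S
  set r := flatValue A L (crossMatrix A T₁ T₂ x₀) with hr
  have hr0 : 0 < r := flatValue_pos _ _ _
  have hr1 : (r : ℂ) ≠ 0 := by exact_mod_cast hr0.ne'
  have hmul := S.reducedDensity_mul_self hc
  refine ⟨⟨r, (r : ℂ)⁻¹ • reducedDensity A ψ, hr0, ?_, ?_, ?_⟩, fun k l hk hl => ?_⟩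
  · rw [Matrix.IsHermitian, Matrix.conjTranspose_smul, reducedDensity_isHermitian A ψ]
    congr 1
    rw [star_inv₀, Complex.star_def, Complex.conj_ofReal]
  · rw [Matrix.smul_mul, Matrix.mul_smul, hmul, smul_smul, smul_smul]
    congr 1
    rw [← hr]
    field_simp
  · rw [smul_smul, mul_inv_cancel₀ hr1, one_smul]
  · rw [(eigenvalue_of_mul_self _ hmul k).resolve_left hk,
      (eigenvalue_of_mul_self _ hmul l).resolve_left hl]

/-! ### The rank formula for the entropy -/

/-- The rows of a matrix as operators. -/
def rowOp {n : ℕ} (M : Matrix (Fin n) (Fin n) (ZMod 2)) (p : Fin n) : XSOp n := ⟨0, M p, 0⟩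

theorem natCard_submodule {n : ℕ} (W : Submodule (ZMod 2) (Bits n)) :
    Nat.card W = 2 ^ Module.finrank (ZMod 2) W := by
  classical
  have : Fintype W := Fintype.ofFinite W
  rw [Nat.card_eq_fintype_card, Module.card_eq_pow_finrank (K := ZMod 2), ZMod.card]

/-- The exponent of `1 / r` is `dim L - dim L_B - dim K`, and `dim K = dim L_A - rank M`. The pivots
of `T₂` in `A` number `dim L - dim L_B`, those of `T₁` in `A` number `dim L_A`, and `T₄` has `rank
M` pivots. -/
theorem AdaptedForms.log_flatValue {n : ℕ} {A : Finset (Fin n)}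
    {L : Submodule (ZMod 2) (Bits n)} {ψ : QVec n} {T₁ T₂ : ℕ → XSOp n}
    (h : AdaptedForms A L ψ T₁ T₂) (x₀ : Bits n) {key : ℕ → ℕ} {T₄ : ℕ → XSOp n}
    (h₄ : XSOp.Spans key T₄ (Set.range (rowOp (crossMatrix A T₁ T₂ x₀)))) :
    -Real.log (flatValue A L (crossMatrix A T₁ T₂ x₀)) / Real.log 2 =
      (((A.filter fun p : Fin n => (T₂ p).a p ≠ 0).card +
        (Finset.univ.filter fun p : Fin n => (T₄ p).a p ≠ 0).card -
        (A.filter fun p : Fin n => (T₁ p).a p ≠ 0).card : ℕ) : ℝ) := by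
  classical
  set M := crossMatrix A T₁ T₂ x₀ with hM
  let f : supportedIn L A →ₗ[ZMod 2] Bits n :=
    (Matrix.vecMulLinear M).comp (supportedIn L A).subtype
  have hf : ∀ w, f w = Matrix.vecMul w.1 M := fun w => rfl
  have hbil : ∀ w w', bil M w w' = Matrix.vecMul w M ⬝ᵥ w' := fun w w' =>
    Matrix.dotProduct_mulVec _ _ _
  have hMrow : ∀ p q, M p q ≠ 0 → p ∈ A ∧ q ∉ A ∧ (T₁ p).a p ≠ 0 ∧ (T₂ q).a q ≠ 0 := by
    intro p q hpq
    obtain ⟨hp, hq⟩ := isCoupling_crossMatrix A T₁ T₂ x₀ p q hpq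
    refine ⟨hp, hq, fun h0 => hpq ?_, fun h0 => hpq ?_⟩
    · rw [hM, crossMatrix, Matrix.of_apply, h.reduced₁.bit_eq_zero (by rwa [XSOp.bit_fin])]
      simp [crossExp]
    · rw [hM, crossMatrix, Matrix.of_apply, h.reduced₂.bit_eq_zero (by rwa [XSOp.bit_fin])]
      simp [crossExp]
  -- The row of `T₂` with pivot `q` has zeros at the other pivots, and `M` has nonzero columns only
  -- at such pivots outside of `A`. Pairing with this row isolates the entry `q` of `wᵀ M`.
  have hker : ∀ w : supportedIn L A, IsUncoupled A L M w ↔ f w = 0 := by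
    intro w
    constructor
    · intro hw
      funext q
      by_contra hq
      obtain ⟨p, -, hp⟩ := Finset.exists_ne_zero_of_sum_ne_zero
        (show ∑ p, w.1 p * M p q ≠ 0 from hq)
      obtain ⟨-, hqA, -, hqT⟩ := hMrow p q (right_ne_zero_of_mul hp)
      have h1 := hw (T₂ q).a ⟨by rw [← h.span₂]; exact Submodule.subset_span ⟨q, rfl⟩, fun l hl => by
        have := h.reduced₂.lead q l (keyIn_lt A q (by simpa using hqA) l hl)
        rwa [XSOp.bit_fin] at this⟩
      rw [hbil, dotProduct, Finset.sum_eq_single q] at h1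
      · exact (mul_eq_zero.1 h1).elim hq hqT
      · intro q' _ hq'
        by_cases hz : Matrix.vecMul w.1 M q' = 0
        · rw [hz, zero_mul]
        · obtain ⟨p', -, hp'⟩ := Finset.exists_ne_zero_of_sum_ne_zero
            (show ∑ p, w.1 p * M p q' ≠ 0 from hz)
          obtain ⟨-, -, -, hqT'⟩ := hMrow p' q' (right_ne_zero_of_mul hp')
          have := h.reduced₂.off q' q (fun h => hq' (Fin.ext h)) (by rwa [XSOp.bit_fin])
          rw [XSOp.bit_fin] at this
          rw [this, mul_zero]
      · simp
    · intro hw w' _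
      rw [hbil, ← hf, hw, zero_dotProduct]
  have hrange : LinearMap.range f =
      Submodule.span (ZMod 2) (Set.range fun p => (T₄ p).a) := by
    rw [h₄.span_eq, ← Set.range_comp]
    apply le_antisymm
    · rintro _ ⟨w, rfl⟩
      have : f w = ∑ p, w.1 p • M p := by
        funext q
        rw [hf, Finset.sum_apply]
        rfl
      rw [this]
      exact Submodule.sum_mem _ fun p _ => Submodule.smul_mem _ _ (Submodule.subset_span ⟨p, rfl⟩)
    · refine Submodule.span_le.2 ?_
      rintro _ ⟨p, rfl⟩
      change M p ∈ LinearMap.range f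
      by_cases hp : M p = 0
      · rw [hp]; exact Submodule.zero_mem _
      · obtain ⟨q, hq⟩ := Function.ne_iff.1 hp
        obtain ⟨hpA, -, hpT, -⟩ := hMrow p q hq
        -- The row of `T₁` with pivot `p` vanishes at the other pivots, so its image under `f` is
        -- row `p` of `M`. Restricting to `L_A` therefore loses no rank.
        have hmem : (T₁ p).a ∈ supportedIn L A :=
          ⟨by rw [← h.span₁]; exact Submodule.subset_span ⟨p, rfl⟩, fun l hl => by
            have := h.reduced₁.lead p l (keyOut_lt A p hpA l hl)
            rwa [XSOp.bit_fin] at this⟩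
        refine ⟨⟨_, hmem⟩, ?_⟩
        funext q
        rw [hf]
        change ∑ p', (T₁ p).a p' * M p' q = M p q
        rw [Finset.sum_eq_single p]
        · rw [(zmod2_cases _).resolve_left hpT, one_mul]
        · intro p' _ hp'
          by_cases hz : M p' q = 0
          · rw [hz, mul_zero]
          · obtain ⟨-, -, hpT', -⟩ := hMrow p' q hz
            have := h.reduced₁.off p' p (fun h => hp' (Fin.ext h)) (by rwa [XSOp.bit_fin])
            rw [XSOp.bit_fin] at this
            rw [this, zero_mul]
        · simp
  have hL₁ : Module.finrank (ZMod 2) (supportedIn L A) =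
      (A.filter fun p : Fin n => (T₁ p).a p ≠ 0).card := by
    rw [← h.span₁, h.reduced₁.supportedIn_eq (keyOut_lt A), h.reduced₁.finrank_span]
  have hL₂ : Module.finrank (ZMod 2) (supportedIn L Aᶜ) =
      (Aᶜ.filter fun p : Fin n => (T₂ p).a p ≠ 0).card := by
    rw [← h.span₂, h.reduced₂.supportedIn_eq (keyIn_lt A), h.reduced₂.finrank_span]
  have hL : Module.finrank (ZMod 2) L = (A.filter fun p : Fin n => (T₂ p).a p ≠ 0).card +
      (Aᶜ.filter fun p : Fin n => (T₂ p).a p ≠ 0).card := by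
    rw [← h.span₂, h.reduced₂.finrank_eq, ← Finset.card_union_of_disjoint
      (Finset.disjoint_filter_filter disjoint_compl_right), ← Finset.filter_union,
      Finset.union_compl]
  have hrk := f.finrank_range_add_finrank_ker
  rw [hrange, h₄.reduced.finrank_eq, hL₁] at hrk
  have hcard : Nat.card {w : supportedIn L A // IsUncoupled A L M w} =
      2 ^ Module.finrank (ZMod 2) (LinearMap.ker f) := by
    have e : {w : supportedIn L A // IsUncoupled A L M w} ≃ LinearMap.ker f :=
      Equiv.subtypeEquivRight fun w => by rw [hker, LinearMap.mem_ker]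
    have : Fintype (LinearMap.ker f) := Fintype.ofFinite _
    rw [Nat.card_congr e, Nat.card_eq_fintype_card, Module.card_eq_pow_finrank (K := ZMod 2),
      ZMod.card]
  -- `L_A` and `L_B` meet trivially. This makes the truncated subtraction in the entropy formula
  -- exact.
  have hdisj : Module.finrank (ZMod 2) (supportedIn L A) +
      Module.finrank (ZMod 2) (supportedIn L Aᶜ) ≤ Module.finrank (ZMod 2) L := by
    have h1 := Submodule.finrank_sup_add_finrank_inf_eq (supportedIn L A) (supportedIn L Aᶜ)
    have h2 : supportedIn L A ⊔ supportedIn L Aᶜ ≤ L := sup_le (fun y hy => hy.1) fun y hy => hy.1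
    have h3 := Submodule.finrank_mono h2
    have h4 : supportedIn L A ⊓ supportedIn L Aᶜ = ⊥ := by
      refine (Submodule.eq_bot_iff _).2 fun y hy => funext fun l => ?_
      rcases disjoint_of_supportedIn hy.1 hy.2 l with h | h <;> exact h
    rw [h4, finrank_bot] at h1
    omega
  rw [flatValue, hcard, natCard_submodule, natCard_submodule, hL₂, hL, ← pow_add]
  rw [hL₁, hL₂, hL] at hdisj
  generalize (A.filter fun p : Fin n => (T₁ p).a p ≠ 0).card = a₁ at *
  generalize (A.filter fun p : Fin n => (T₂ p).a p ≠ 0).card = a₂ at *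
  generalize (Aᶜ.filter fun p : Fin n => (T₂ p).a p ≠ 0).card = b₂ at *
  generalize (Finset.univ.filter fun p : Fin n => (T₄ p).a p ≠ 0).card = c at *
  generalize Module.finrank (ZMod 2) (LinearMap.ker f) = k at *
  have hlog : Real.log 2 ≠ 0 := (Real.log_pos (by norm_num)).ne'
  obtain ⟨d, hd⟩ : ∃ d, a₂ + b₂ = (k + b₂) + d := ⟨a₂ + c - a₁, by omega⟩
  have hd' : a₂ + c - a₁ = d := by omega
  have hq : (2 ^ (k + b₂) / 2 ^ (k + b₂ + d) : ℝ) = (2 ^ d)⁻¹ := by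
    rw [pow_add _ (k + b₂) d, ← div_div, div_self (by positivity), one_div]
  rw [hd, hd', Nat.cast_pow, Nat.cast_pow, Nat.cast_ofNat, hq, Real.log_inv, Real.log_pow, neg_neg,
    mul_div_cancel_right₀ _ hlog]

/-! ### A point of the support of a regular XS-stabilizer state -/

theorem chiFour_eq_one {e : ZMod 4} (h : chiFour e = 1) : e = 0 := by
  have key : ∀ e : ZMod 4, e = 0 ∨ e = 1 ∨ e = 2 ∨ e = 3 := by decide
  have v1 : (1 : ZMod 4).val = 1 := rfl
  have v2 : (2 : ZMod 4).val = 2 := rfl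
  have v3 : (3 : ZMod 4).val = 3 := rfl
  rcases key e with rfl | rfl | rfl | rfl
  · rfl
  · simp only [chiFour, AddChar.zmodChar_apply, v1, pow_one] at h
    simpa using congrArg Complex.im h
  · simp only [chiFour, AddChar.zmodChar_apply, v2, Complex.I_sq] at h
    norm_num at h
  · simp only [chiFour, AddChar.zmodChar_apply, v3, Complex.I_pow_three] at h
    simpa using congrArg Complex.im h

theorem opX_zero {n : ℕ} : opX (0 : Fin n → ZMod 2) = 1 := by
  simp [opX, tensorOp_one]

theorem opZ_eq_opS {n : ℕ} (c : Fin n → ZMod 2) :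
    opZ c = opS fun l => 2 * ((c l).val : ZMod 4) := by
  rw [opZ, opS]
  congr 1
  funext l
  rw [pauliZ_pow, gateS_pow]
  congr 1
  funext x
  have v2 : (2 : ZMod 4).val = 2 := rfl
  rcases zmod2_cases (c l) with h | h
  · simp [h]
  · simp [h, ZMod.val_one, v2, pow_mul]

namespace XSOp

variable {n : ℕ}

/-- In a regular group, diagonal operators are of `Z`-type. -/
theorem b_of_isRegular {G : Subgroup (QOp n)ˣ} (hG : IsRegularXSGroup G) {d : XSOp n}
    (hd : d.isUnit_toMatrix.unit ∈ G) (ha : d.a = 0) (l : Fin n) : d.b l = 0 ∨ d.b l = 2 := by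
  have h1 : d.isUnit_toMatrix.unit ∈ diagonalSubgroup G :=
    ⟨hd, d.s, d.b, by rw [IsUnit.unit_spec, toMatrix, ha, opX_zero, one_mul]⟩
  rw [hG] at h1
  obtain ⟨-, s, c, hc⟩ := h1
  let d' : XSOp n := ⟨s, 0, fun l => 2 * ((c l).val : ZMod 4)⟩
  have h2 : d.toMatrix = d'.toMatrix := by
    rw [IsUnit.unit_spec] at hc
    rw [hc, toMatrix, opZ_eq_opS, opX_zero, one_mul]
  have h3 : ∀ x, d.phase x = d'.phase x := by
    intro x
    have := congrFun (congrArg (fun M : QOp n => M.mulVec fun _ => 1) h2) x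
    simp only [mulVec_toMatrix, ha, mul_one, add_zero] at this
    rw [this, show d'.a = 0 from rfl, add_zero]
  -- Evaluation at the zero string isolates the scalar; evaluation at a unit vector then isolates
  -- one exponent `b l`.
  have h4 : chiEight d.s = chiEight s := by
    have := h3 0
    simpa [phase_eq, d'] using this
  have h5 := h3 (Pi.single l 1)
  have h6 : ∀ e : XSOp n, e.phase (Pi.single l 1) = chiEight e.s * chiFour (e.b l) := by
    intro e
    rw [phase_eq, Finset.prod_eq_single l]
    · simp [ZMod.val_one]
    · intro l' _ hl'
      simp [hl']
    · simp
  have h7 : chiEight s ≠ 0 := by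
    rw [chiEight, AddChar.zmodChar_apply]
    exact pow_ne_zero _ (Complex.exp_ne_zero _)
  rw [h6, h6, h4] at h5
  have h8 : chiFour (d.b l) = chiFour (2 * ((c l).val : ZMod 4)) := mul_left_cancel₀ h7 h5
  have h9 : d.b l = 2 * ((c l).val : ZMod 4) := by
    refine sub_eq_zero.1 (chiFour_eq_one ?_)
    rw [AddChar.map_sub_eq_div, h8]
    exact div_self (by
      rw [chiFour, AddChar.zmodChar_apply]
      exact pow_ne_zero _ Complex.I_ne_zero)
  rw [h9]
  rcases zmod2_cases (c l) with h | h
  · left; simp [h]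
  · right; simp [h, ZMod.val_one]

/-- The linear equation for the basis vectors fixed by a diagonal operator of `Z`-type, as an operator
whose `X`-exponents are the coefficients. -/
def toEquation (d : XSOp n) : XSOp n :=
  -- Truncated subtraction halves without division: `0, 4` become `0, 1` in the phase, and `0, 2`
  -- become `0, 1` in the exponents.
  ⟨((d.s.val - 3 : ℕ) : ZMod 8), fun l => (((d.b l).val - 1 - ((d.b l).val - 2) : ℕ) : ZMod 2), 0⟩

theorem sat_toEquation {d : XSOp n} (hb : ∀ l, d.b l = 0 ∨ d.b l = 2) (hs : d.s = 0 ∨ d.s = 4)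
    (x : Bits n) : Sat x d.toEquation ↔ d.phase x = 1 := by
  have v2 : (2 : ZMod 4).val = 2 := rfl
  have v4 : (4 : ZMod 8).val = 4 := rfl
  have h1 : chiEight d.s = sgn ((ZMod.castHom (show 2 ∣ 8 by norm_num) (ZMod 2)) d.toEquation.s) := by
    rcases hs with h | h
    · simp [toEquation, h]
    · simp [toEquation, h, v4, sgn_one, chiEight, AddChar.zmodChar_apply, alphaPhase_pow_four]
  have h2 : ∏ l, chiFour (d.b l) ^ (x l).val = sgn (∑ l, d.toEquation.a l * x l) := by
    rw [AddChar.map_sum_eq_prod]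
    refine Finset.prod_congr rfl fun l _ => ?_
    rcases hb l with h | h <;> rcases zmod2_cases (x l) with hx | hx
    · simp [toEquation, h]
    · simp [toEquation, h]
    · simp [hx]
    · simp [toEquation, h, hx, v2, ZMod.val_one, sgn_one, chiFour, AddChar.zmodChar_apply]
  rw [phase_eq, h1, h2, ← AddChar.map_add_eq_mul, Sat]
  generalize (ZMod.castHom (show 2 ∣ 8 by norm_num) (ZMod 2)) d.toEquation.s = u,
    ∑ l, d.toEquation.a l * x l = v
  rcases zmod2_cases u with rfl | rfl <;> rcases zmod2_cases v with rfl | rfl <;>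
    first
    | rw [show (1 + 1 : ZMod 2) = 0 from rfl]; simp
    | norm_num [sgn_one]

/-- Squaring removes the signs of the `Z`-part and leaves `i^s = 1`, so `s` is divisible by 4. -/
theorem s_of_phase_eq_one {d : XSOp n} (hb : ∀ l, d.b l = 0 ∨ d.b l = 2) {x : Bits n}
    (h : d.phase x = 1) : d.s = 0 ∨ d.s = 4 := by
  have h2 : (∏ l, chiFour (d.b l) ^ (x l).val) ^ 2 = 1 := by
    rw [← Finset.prod_pow]
    refine Finset.prod_eq_one fun l _ => ?_
    have v2 : (2 : ZMod 4).val = 2 := rfl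
    rcases hb l with h | h
    · simp [h]
    · rw [h, chiFour, AddChar.zmodChar_apply, v2, Complex.I_sq, pow_right_comm]
      norm_num
  have h3 : chiFour ((d.s.val : ℕ) : ZMod 4) = 1 := by
    rw [chiFour, AddChar.zmodChar_apply', ← alphaPhase_sq, pow_right_comm]
    have h4 := congrArg (· ^ 2) h
    simp only [phase_eq, mul_pow, h2, mul_one, one_pow, chiEight, AddChar.zmodChar_apply] at h4
    exact h4
  have h5 := chiFour_eq_one h3
  revert h5
  generalize d.s = s
  revert s
  decide

theorem toEquation_add {d : XSOp n} {x y : Bits n} (hx : Sat x d.toEquation) :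
    Sat (x + y) d.toEquation ↔ ∑ l, d.toEquation.a l * y l = 0 := by
  rw [Sat] at *
  simp only [Pi.add_apply, mul_add, Finset.sum_add_distrib]
  rw [hx, left_eq_add]

/-- The rows of an echelon form commute and are involutions on the coset of `x`; then there is a
vector supported on this coset that is fixed by all of them. -/
theorem Reduced.exists_fixed {key : ℕ → ℕ} {T : ℕ → XSOp n} (hT : Reduced key T) (x : Bits n)
    (hsq : ∀ p q : ℕ, ∀ z, z + x ∈ Submodule.span (ZMod 2) (Set.range fun p => (T p).a) →
      ((T p * T q) * (T p * T q)).phase z = 1) :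
    ∃ φ : QVec n, φ x = 1 ∧
      (∀ z, φ z ≠ 0 → z + x ∈ Submodule.span (ZMod 2) (Set.range fun p => (T p).a)) ∧
      ∀ p, (T p).Fixes φ := by
  classical
  set L := Submodule.span (ZMod 2) (Set.range fun p => (T p).a) with hL
  have hTL : ∀ p, (T p).a ∈ L := fun p => Submodule.subset_span ⟨p, rfl⟩
  -- No column `n` exists, so row `n` is the identity. Taking it for one factor in `hsq` shows that
  -- single rows are involutions.
  have hTn : T n = 1 := hT.bit_eq_zero (dif_neg (lt_irrefl n))
  have hinv : ∀ q z, z + x ∈ L → (T q).phase z * (T q).phase (z + (T q).a) = 1 := by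
    intro q z hz
    have := hsq q n z hz
    simpa [hTn, phase_mul, mul_comm] using this
  have hCadd : ∀ q z, z + (T q).a + x ∈ L ↔ z + x ∈ L := by
    intro q z
    rw [add_right_comm]
    exact L.add_mem_iff_left (hTL q)
  -- If `T p`, `T q` and `T p * T q` all square to one on the coset, then `T p` and `T q` commute
  -- there.
  have hcomm : ∀ p q w, w + x ∈ L → (T q).phase (w + (T p).a) * (T p).phase w =
      (T p).phase (w + (T q).a) * (T q).phase w := by
    intro p q w hw
    have h1 := hsq p q w hw
    rw [phase_mul, phase_mul, phase_mul, mul_a, add_comm (T p).a, ← add_assoc, add_right_comm _ _ (T q).a,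
      Bits.add_add_cancel] at h1
    have h2 := hinv p w hw
    have h3 := hinv q (w + (T p).a) ((hCadd p w).2 hw)
    rw [add_right_comm] at h3
    have hne : (T p).phase (w + (T p).a) * (T q).phase (w + (T q).a + (T p).a) ≠ 0 :=
      mul_ne_zero (phase_ne_zero _ _) (phase_ne_zero _ _)
    refine mul_left_cancel₀ hne ?_
    rw [h1]
    calc _ = ((T p).phase w * (T p).phase (w + (T p).a)) *
        ((T q).phase (w + (T p).a) * (T q).phase (w + (T q).a + (T p).a)) := by ring
      _ = 1 := by rw [h2, h3, one_mul]
  -- The rows are treated one at a time. The bits at the pivots not yet treated stay equal to those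
  -- of `x`.
  suffices H : ∀ F : Finset (Fin n), ∃ φ : QVec n, φ x = 1 ∧ (∀ z, φ z ≠ 0 → z + x ∈ L ∧
      ∀ q : Fin n, q ∉ F → (T q).a q ≠ 0 → z q = x q) ∧ ∀ p ∈ F, (T p).Fixes φ by
    obtain ⟨φ, h1, h2, h3⟩ := H Finset.univ
    refine ⟨φ, h1, fun z hz => (h2 z hz).1, fun p => ?_⟩
    by_cases hp : (T p).bit p = 0
    · rw [hT.bit_eq_zero hp]
      exact (stable_fixes φ).one
    · exact h3 ⟨p, lt_of_bit_ne hp⟩ (Finset.mem_univ _)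
  intro F
  induction F using Finset.induction_on with
  | empty =>
    refine ⟨Pi.single x 1, by simp, fun z hz => ?_, by simp⟩
    have : z = x := by
      by_contra h
      exact hz (by simp [h])
    subst this
    rw [Bits.add_self]
    exact ⟨L.zero_mem, fun _ _ _ => rfl⟩
  | insert q F hqF ih =>
    obtain ⟨φ, h1, h2, h3⟩ := ih
    by_cases hq : (T q).a q = 0
    · refine ⟨φ, h1, fun z hz => ⟨(h2 z hz).1, fun q' hq' hne => (h2 z hz).2 q'
        (fun h => hq' (Finset.mem_insert_of_mem h)) hne⟩, fun p hp => ?_⟩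
      rcases Finset.mem_insert.1 hp with rfl | hp
      · rw [hT.bit_eq_zero (by rwa [bit_fin])]
        exact (stable_fixes φ).one
      · exact h3 p hp
    set a := (T q).a with ha
    -- Symmetrization by `1 + T q`: involutivity makes the result fixed by `T q`, commutation keeps
    -- it fixed by the earlier rows. The translate is zero at `x`, because `T q` flips the still
    -- untouched bit `q`, so no cancellation can occur.
    refine ⟨fun z => φ z + (T q).phase (z + a) * φ (z + a), ?_, fun z hz => ?_, fun p hp => ?_⟩
    · have : φ (x + a) = 0 := by
        by_contra h
        have := (h2 _ h).2 q hqF hq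
        rw [Pi.add_apply, add_eq_left] at this
        exact hq this
      simp [h1, this]
    · by_cases hz1 : φ z = 0
      · have hz2 : φ (z + a) ≠ 0 := fun h => hz (by simp [hz1, h])
        obtain ⟨h4, h5⟩ := h2 _ hz2
        refine ⟨(hCadd q z).1 h4, fun q' hq' hne => ?_⟩
        have h6 := h5 q' (fun h => hq' (Finset.mem_insert_of_mem h)) hne
        have h7 := hT.off q' q (fun h => hq' (by
          rw [Fin.ext h]; exact Finset.mem_insert_self _ _)) (by rwa [bit_fin])
        rw [bit_fin] at h7
        rwa [Pi.add_apply, ha, h7, add_zero] at h6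
      · obtain ⟨h4, h5⟩ := h2 _ hz1
        exact ⟨h4, fun q' hq' hne => h5 q' (fun h => hq' (Finset.mem_insert_of_mem h)) hne⟩
    · intro z
      rcases Finset.mem_insert.1 hp with rfl | hp
      · simp only
        rw [← ha, Bits.add_add_cancel]
        by_cases h0 : φ (z + a) = 0
        · simp [h0]
        · have hz := (hCadd p z).1 (h2 _ h0).1
          have := hinv p z hz
          rw [mul_add, ← mul_assoc, this]
          ring
      · have hf := h3 p hp
        simp only
        rw [hf z, add_right_comm z, hf (z + a), mul_add]
        congr 1
        by_cases h0 : φ (z + a) = 0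
        · simp [h0]
        · have := hcomm p q (z + a) (h2 _ h0).1
          rw [← ha, Bits.add_add_cancel] at this
          rw [← mul_assoc, this, mul_assoc]

/-- Generators of the diagonal subgroup. -/
def diagGens {m : ℕ} (g : Fin m → XSOp n) (T : ℕ → XSOp n) (N : ℕ) : Set (XSOp n) :=
  (Set.range fun j => reduce T (g j) N) ∪ {d | ∃ p q, d = (T p * T q) * (T p * T q)}

theorem diagGens_mem {m : ℕ} {g : Fin m → XSOp n} {key : ℕ → ℕ} {T : ℕ → XSOp n} {N : ℕ}
    (hN : n ≤ N) (hT : Spans key T (Set.range g)) {d : XSOp n} (hd : d ∈ diagGens g T N) :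
    d.isUnit_toMatrix.unit ∈ xsGroup g ∧ d.a = 0 := by
  have hP := stable_mem_group (xsGroup g)
  have hTG := hT.of_gen _ hP (by
    rintro _ ⟨j, rfl⟩
    exact Subgroup.subset_closure ⟨j, rfl⟩)
  rcases hd with ⟨j, rfl⟩ | ⟨p, q, rfl⟩
  · refine ⟨(hP.reduce_iff hTG _ _).2 (Subgroup.subset_closure ⟨j, rfl⟩), ?_⟩
    have h1 : (reduce T (g j) N).a ∈ Submodule.span (ZMod 2) (Set.range fun p => (T p).a) := by
      refine ((stable_a_mem (Submodule.span (ZMod 2) (Set.range fun p => (T p).a))).reduce_iff (fun p => Submodule.subset_span ⟨p, rfl⟩) _ _).2 ?_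
      rw [hT.span_eq]
      exact Submodule.subset_span ⟨_, ⟨j, rfl⟩, rfl⟩
    rw [hT.reduced.eq_sum h1]
    refine Finset.sum_eq_zero fun p _ => ?_
    by_cases hp : (T p).bit p = 0
    · rw [hT.reduced.bit_eq_zero hp]; simp
    · have := hT.reduced.bit_reduce (g j) hN p hp
      rw [bit_fin] at this
      rw [this, zero_smul]
  · refine ⟨hP.mul (hP.mul (hTG p) (hTG q)) (hP.mul (hTG p) (hTG q)), ?_⟩
    rw [mul_a, Bits.add_self]

/-- The solution of a system of equations in echelon form that vanishes at the free variables. -/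
def solution (T : ℕ → XSOp n) : Bits n := fun l =>
  (ZMod.castHom (show 2 ∣ 8 by norm_num) (ZMod 2)) (T l).s

theorem Reduced.sat_solution {key : ℕ → ℕ} {T : ℕ → XSOp n} (hT : Reduced key T) (p : ℕ) :
    Sat (solution T) (T p) := by
  by_cases hp : (T p).bit p = 0
  · rw [hT.bit_eq_zero hp]
    exact (stable_sat _).one
  have hpn := lt_of_bit_ne hp
  rw [Sat, Finset.sum_eq_single ⟨p, hpn⟩]
  · have : (T p).a ⟨p, hpn⟩ = 1 := by
      refine (zmod2_cases _).resolve_left ?_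
      simpa [bit, hpn] using hp
    rw [this, one_mul, solution]
  · intro q _ hq
    by_cases hqq : (T q).bit q = 0
    · simp [solution, hT.bit_eq_zero hqq]
    · have := hT.off q p (fun h => hq (Fin.ext h)) hqq
      rw [bit_fin] at this
      rw [this, zero_mul]
  · simp

/-- The solution `x` might lie in a different coset than the support. But on `x + L` all members of
`diagGens` act trivially, so `Reduced.exists_fixed` yields a vector fixed by all generators with
value `1` at `x`. It is a multiple of `ψ`, hence `ψ x ≠ 0`. -/
theorem ne_zero_solution {m : ℕ} {g : Fin m → XSOp n} {ψ : QVec n}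
    (hG : IsRegularXSGroup (xsGroup g)) (hψ : IsXSStateOf g ψ) {key key' : ℕ → ℕ}
    {T T' : ℕ → XSOp n} {N : ℕ} (hN : n ≤ N) (hT : Spans key T (Set.range g))
    (hT' : Spans key' T' (toEquation '' diagGens g T N)) : ψ (solution T') ≠ 0 := by
  set x := solution T' with hx
  obtain ⟨x₁, hx₁⟩ := exists_ne_zero_of_isXSStateOf hψ
  have S := cosetState_of_isXSStateOf hψ hx₁
  have hspan : Submodule.span (ZMod 2) (Set.range fun j => (g j).a) =
      Submodule.span (ZMod 2) (Set.range fun p => (T p).a) := by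
    rw [hT.span_eq, ← Set.range_comp]; rfl
  rw [hspan] at S
  set L := Submodule.span (ZMod 2) (Set.range fun p => (T p).a) with hL
  have hb : ∀ d ∈ diagGens g T N, ∀ l, d.b l = 0 ∨ d.b l = 2 := fun d hd =>
    b_of_isRegular hG (diagGens_mem hN hT hd).1 (diagGens_mem hN hT hd).2
  have hphase : ∀ d ∈ diagGens g T N, ∀ y, ψ y ≠ 0 → d.phase y = 1 := by
    intro d hd y hy
    have h1 := fixes_of_mem_xsGroup hψ (diagGens_mem hN hT hd).1 y
    rw [(diagGens_mem hN hT hd).2, add_zero] at h1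
    exact (mul_right_cancel₀ hy ((one_mul _).trans h1)).symm
  have hs : ∀ d ∈ diagGens g T N, d.s = 0 ∨ d.s = 4 := fun d hd =>
    s_of_phase_eq_one (hb d hd) (hphase d hd x₁ hx₁)
  have hsat : ∀ d ∈ diagGens g T N, ∀ y, ψ y ≠ 0 → Sat y d.toEquation := fun d hd y hy =>
    (sat_toEquation (hb d hd) (hs d hd) y).2 (hphase d hd y hy)
  -- Equations eliminated completely read `0 = s`. They hold at `x` because they hold at the support
  -- point `x₁`: the system is consistent.
  have hsatx : ∀ e ∈ toEquation '' diagGens g T N, Sat x e := by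
    refine hT'.gen_of _ (Sat x₁) (stable_sat x) (stable_sat x₁) ?_ (fun h hh hQ => ?_)
      hT'.reduced.sat_solution
    · rintro _ ⟨d, hd, rfl⟩
      exact hsat d hd x₁ hx₁
    · rw [Sat, hh] at *
      simpa using hQ
  -- The equations hold on all of `x₁ + L`, so their linear parts vanish on `L`, and validity at `x`
  -- extends to `x + L`.
  have hcoset : ∀ d ∈ diagGens g T N, ∀ z, z + x ∈ L → d.phase z = 1 := by
    intro d hd z hz
    have h1 := (toEquation_add (y := z + x) (hsat d hd x₁ hx₁)).1
      (hsat d hd _ (S.ne_zero_add hx₁ hz))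
    have h2 := (toEquation_add (y := z + x) (hsatx _ ⟨d, hd, rfl⟩)).2 h1
    rw [add_comm z, ← add_assoc, Bits.add_self, zero_add] at h2
    exact (sat_toEquation (hb d hd) (hs d hd) z).1 h2
  obtain ⟨φ, h1, h2, h3⟩ := hT.reduced.exists_fixed x fun p q z hz =>
    hcoset _ (.inr ⟨p, q, rfl⟩) z hz
  obtain ⟨c, hc⟩ := ((isXSStateOf_iff g ψ).1 hψ).2.2 φ fun j => by
    refine ((stable_fixes φ).reduce_iff h3 (g j) N).1 fun z => ?_
    have hd : reduce T (g j) N ∈ diagGens g T N := .inl ⟨j, rfl⟩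
    rw [(diagGens_mem hN hT hd).2, add_zero]
    by_cases hz : φ z = 0
    · rw [hz, mul_zero]
    · rw [hcoset _ hd z (h2 z hz), one_mul]
  intro h0
  have := congrFun hc x
  rw [h1, Pi.smul_apply, h0, smul_zero] at this
  exact one_ne_zero this

end XSOp

/-! ### Modular arithmetic in the array language -/

namespace RAM

/-- `k * e` -/
def AExp.smul : ℕ → AExp → AExp
  | 0, _ => .const 0
  | k + 1, e => .add e (AExp.smul k e)

variable {N : ℕ} {I : ℕ → ℕ} {ρ : ℕ → ℕ} {A : Arrays}

@[simp] theorem AExp.ev_smul (k : ℕ) (e : AExp) :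
    (AExp.smul k e).ev N I ρ A = k * e.ev N I ρ A := by
  induction k with
  | zero => simp [AExp.smul, AExp.ev]
  | succ k ih => simp only [AExp.smul, AExp.ev, ih]; ring

/-- Reduce the entries of array `k` modulo `w`. -/
def modCmd (k w : ℕ) : Cmd :=
  .assign k <| .sub (.arr k 0 1) <| .smul w <| .sum 10 <|
    .ite (.sub (.smul w (.add (.var 10) (.const 1))) (.arr k 0 1)) (.const 0) (.const 1)

/-- The quotient is counted: `e / w` is the number of `x` with `w * (x + 1) ≤ e`. The count is
complete since `e ≤ w * N`. -/
theorem sub_mul_sum_eq_mod {w e : ℕ} (hw : 0 < w) (he : e ≤ w * N) :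
    e - w * ∑ x ∈ Finset.range N, (if w * (x + 1) - e ≠ 0 then 0 else 1) = e % w := by
  have h1 : ∀ x, (if w * (x + 1) - e ≠ 0 then 0 else 1) = if x < e / w then 1 else 0 := by
    intro x
    have : w * (x + 1) - e ≠ 0 ↔ ¬ x < e / w := by
      rw [← Nat.succ_le_iff, Nat.le_div_iff_mul_le hw, Nat.mul_comm w, Nat.succ_eq_add_one]
      omega
    split_ifs <;> tauto
  have h2 : e / w ≤ N := Nat.div_le_of_le_mul he
  have h3 : (Finset.range N).filter (· < e / w) = Finset.range (e / w) := by
    ext x; simp; omega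
  rw [Finset.sum_congr rfl fun x _ => h1 x, ← Finset.sum_filter, h3]
  have := Nat.div_add_mod e w
  simp
  omega

/-- Assign the value of `e` modulo `w`. -/
def assignMod (k w : ℕ) (e : AExp) : Cmd := .seq (.assign k e) (modCmd k w)

theorem exec_assignMod {k w : ℕ} (hw : 0 < w) {e : AExp} (v : ℕ → ℕ → ℕ)
    (hv : ∀ i j, e.ev N I (Function.update (Function.update ρ 0 i) 1 j) A = v i j)
    (hle : ∀ i j, v i j ≤ w * N) :
    (assignMod k w e).exec N I ρ A = Function.update A k fun i j => v i j % w := by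
  simp only [assignMod, modCmd, Cmd.exec, hv, Function.update_idem]
  congr 1
  funext i j
  rw [← sub_mul_sum_eq_mod hw (hle i j)]
  simp [AExp.ev]

theorem exec_assign {k : ℕ} {e : AExp} (v : ℕ → ℕ → ℕ)
    (hv : ∀ i j, e.ev N I (Function.update (Function.update ρ 0 i) 1 j) A = v i j) :
    (Cmd.assign k e).exec N I ρ A = Function.update A k v := by
  simp only [Cmd.exec, hv]

/-! ### Rows of operators in arrays -/

variable {n : ℕ}

/-- The rows of the arrays `k`, `k + 1`, `k + 2` hold the operators `T`. -/
def Holds (A : Arrays) (k : ℕ) (T : ℕ → XSOp n) : Prop :=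
  ∀ i l, A k i l = (T i).s.val ∧ A (k + 1) i l = ((T i).bit l).val ∧
    A (k + 2) i l = ((T i).sbit l).val

theorem Holds.congr {A A' : Arrays} {k : ℕ} {T : ℕ → XSOp n} (h : Holds A k T)
    (h' : ∀ i < 3, A' (k + i) = A (k + i)) : Holds A' k T := by
  intro i l
  have h0 := h' 0 (by norm_num)
  rw [add_zero] at h0
  rw [h0, h' 1 (by norm_num), h' 2 (by norm_num)]
  exact h i l

theorem Holds.exec {c : Cmd} {k : ℕ} {T : ℕ → XSOp n} (h : Holds A k T)
    (h' : ∀ i < 3, ¬ c.Writes (k + i)) : Holds (c.exec N I ρ A) k T :=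
  h.congr fun i hi => c.exec_of_not_writes (h' i hi) _ _

theorem holds_update {B B' B'' : ℕ → ℕ → ℕ} {k : ℕ} {T : ℕ → XSOp n}
    (h : ∀ i l, B i l = (T i).s.val ∧ B' i l = ((T i).bit l).val ∧ B'' i l = ((T i).sbit l).val) :
    Holds (Function.update (Function.update (Function.update A k B) (k + 1) B') (k + 2) B'') k T := by
  intro i l
  simpa using h i l

theorem sum_range_eq_sum_fin {M : Type*} [AddCommMonoid M] (hn : n ≤ N) {f : ℕ → M} (hf : ∀ l, n ≤ l → f l = 0) :
    ∑ l ∈ Finset.range N, f l = ∑ l : Fin n, f l := by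
  rw [Finset.sum_range, ← Finset.sum_range, ← Finset.sum_range]
  exact (Finset.sum_subset (Finset.range_mono hn) fun l _ hl => hf l (by simpa using hl)).symm

/-- Multiply the rows of `K` for which `cond` holds by the row `x` of `H`. -/
def mulRows (K H x : ℕ) (cond : AExp) : Cmd :=
  -- All new entries go to the arrays `30`, `31`, `32` before any part of `K` is overwritten. The
  -- new phase needs the old exponents, and `H` may coincide with `K`, as in squaring.
  .seq (.assign 33 cond) <|
  .seq (assignMod 30 8 <| .ite (.arr 33 0 1) (.add (.add (.arr K 0 1) (.arr H x 1)) <| .sum 10 <|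
    .ite (.arr (H + 1) x 10) (.smul 2 (.arr (K + 2) 0 10)) (.const 0)) (.arr K 0 1)) <|
  .seq (assignMod 31 2 <|
    .ite (.arr 33 0 1) (.add (.arr (K + 1) 0 1) (.arr (H + 1) x 1)) (.arr (K + 1) 0 1)) <|
  .seq (assignMod 32 4 <| .ite (.arr 33 0 1) (.add (.ite (.arr (H + 1) x 1)
    (.sub (.const 4) (.arr (K + 2) 0 1)) (.arr (K + 2) 0 1)) (.arr (H + 2) x 1))
    (.arr (K + 2) 0 1)) <|
  .seq (.assign K (.arr 30 0 1)) <| .seq (.assign (K + 1) (.arr 31 0 1)) <|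
    .assign (K + 2) (.arr 32 0 1)

theorem val_mul_s (g h : XSOp n) (hn : n ≤ N) : (g * h).s.val =
    (g.s.val + h.s.val + ∑ l ∈ Finset.range N, if (h.bit l).val ≠ 0 then 2 * (g.sbit l).val else 0) %
      8 := by
  rw [← ZMod.val_natCast, XSOp.mul_s, sum_range_eq_sum_fin hn fun l hl => by
    simp [XSOp.bit, not_lt.2 hl]]
  congr 1
  push_cast
  simp only [ZMod.natCast_val, ZMod.cast_id', id, XSOp.bit_fin, XSOp.sbit_fin]
  congr 1
  refine Finset.sum_congr rfl fun l _ => ?_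
  by_cases h0 : h.a l = 0 <;> simp [h0]

theorem val_mul_bit (g h : XSOp n) (l : ℕ) :
    ((g * h).bit l).val = ((g.bit l).val + (h.bit l).val) % 2 := by
  rw [XSOp.bit_mul, ZMod.val_add]

theorem val_mul_sbit (g h : XSOp n) (l : ℕ) : ((g * h).sbit l).val =
    ((if (h.bit l).val ≠ 0 then 4 - (g.sbit l).val else (g.sbit l).val) + (h.sbit l).val) % 4 := by
  rw [XSOp.sbit_mul]
  generalize h.bit l = a, g.sbit l = b, h.sbit l = c
  revert a b c
  decide

theorem sum_two_mul_sbit_le (g h : XSOp n) (hn : n ≤ N) :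
    (∑ l ∈ Finset.range N, if (h.bit l).val ≠ 0 then 2 * (g.sbit l).val else 0) ≤ 6 * n := by
  rw [sum_range_eq_sum_fin hn fun l hl => by simp [XSOp.bit, not_lt.2 hl]]
  calc _ ≤ ∑ l : Fin n, 6 := Finset.sum_le_sum fun l _ => by
        have := (g.sbit l).val_lt
        split_ifs <;> omega
    _ = 6 * n := by simp [mul_comm]

theorem holds_mulRows {K H x : ℕ} {cond : AExp} {G T : ℕ → XSOp n} (hn : n + 2 ≤ N) (hK : K + 2 < 30)
    (hH : H + 2 < 30) (hx : x ≠ 1) (hx' : x ≠ 10) (c : ℕ → ℕ)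
    (hc : ∀ i j, cond.ev N I (Function.update (Function.update ρ 0 i) 1 j) A = c i)
    (hG : Holds A K G) (hT : Holds A H T) :
    Holds ((mulRows K H x cond).exec N I ρ A) K fun i =>
      if c i ≠ 0 then G i * T (Function.update ρ 0 i x) else G i := by
  set y : ℕ → ℕ := fun i => Function.update ρ 0 i x with hy
  have hyx : ∀ i j, Function.update (Function.update ρ 0 i) 1 j x = y i := by
    intro i j; simp [hy, hx]
  have hs : ∀ i l, A K i l = (G i).s.val := fun i l => (hG i l).1
  have hs' : ∀ i l, A H i l = (T i).s.val := fun i l => (hT i l).1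
  have ha : ∀ i l, A (K + 1) i l = ((G i).bit l).val := fun i l => (hG i l).2.1
  have ha' : ∀ i l, A (H + 1) i l = ((T i).bit l).val := fun i l => (hT i l).2.1
  have hb : ∀ i l, A (K + 2) i l = ((G i).sbit l).val := fun i l => (hG i l).2.2
  have hb' : ∀ i l, A (H + 2) i l = ((T i).sbit l).val := fun i l => (hT i l).2.2
  have ne : ∀ k < 30, k ≠ 30 ∧ k ≠ 31 ∧ k ≠ 32 ∧ k ≠ 33 := by omega
  have nK := ne K (by omega)
  have nK1 := ne (K + 1) (by omega)
  have nK2 := ne (K + 2) (by omega)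
  have nH := ne H (by omega)
  have nH1 := ne (H + 1) (by omega)
  have nH2 := ne (H + 2) (by omega)
  have hmod : ∀ i, (G i).s.val < 8 := fun i => (G i).s.val_lt
  have hmod' : ∀ i, (T i).s.val < 8 := fun i => (T i).s.val_lt
  rw [mulRows, Cmd.exec, exec_assign (fun i _ => c i) hc, Cmd.exec,
    exec_assignMod (by norm_num) (fun i _ => if c i ≠ 0 then (G i).s.val + (T (y i)).s.val +
      ∑ l ∈ Finset.range N, (if ((T (y i)).bit l).val ≠ 0 then 2 * ((G i).sbit l).val else 0)
      else (G i).s.val) ?_ ?_, Cmd.exec,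
    exec_assignMod (by norm_num) (fun i l => if c i ≠ 0 then ((G i).bit l).val + ((T (y i)).bit l).val
      else ((G i).bit l).val) ?_ ?_, Cmd.exec,
    exec_assignMod (by norm_num) (fun i l => if c i ≠ 0 then
      (if ((T (y i)).bit l).val ≠ 0 then 4 - ((G i).sbit l).val else ((G i).sbit l).val) +
        ((T (y i)).sbit l).val else ((G i).sbit l).val) ?_ ?_, Cmd.exec,
    exec_assign (fun i _ => (if c i ≠ 0 then (G i).s.val + (T (y i)).s.val +
      ∑ l ∈ Finset.range N, (if ((T (y i)).bit l).val ≠ 0 then 2 * ((G i).sbit l).val else 0)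
      else (G i).s.val) % 8) ?_, Cmd.exec,
    exec_assign (k := K + 1) (fun i l => (if c i ≠ 0 then ((G i).bit l).val + ((T (y i)).bit l).val
      else ((G i).bit l).val) % 2) ?_,
    exec_assign (fun i l => (if c i ≠ 0 then
      (if ((T (y i)).bit l).val ≠ 0 then 4 - ((G i).sbit l).val else ((G i).sbit l).val) +
        ((T (y i)).sbit l).val else ((G i).sbit l).val) % 4) ?_]
  · refine holds_update fun i l => ?_
    have := ((G i).bit l).val_lt
    have := ((G i).sbit l).val_lt
    by_cases h : c i = 0
    · simp only [ne_eq, h, not_true_eq_false, if_false]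
      exact ⟨Nat.mod_eq_of_lt (hmod i), Nat.mod_eq_of_lt (by omega), Nat.mod_eq_of_lt (by omega)⟩
    · simp only [ne_eq, h, not_false_eq_true, if_true]
      exact ⟨(val_mul_s _ _ (by omega)).symm, (val_mul_bit _ _ l).symm, (val_mul_sbit _ _ l).symm⟩
  · intro i j
    simp [AExp.ev, nK.2.2.1.symm, nK1.2.2.1.symm]
  · intro i j
    simp [AExp.ev, nK.2.1.symm]
  · intro i j
    simp [AExp.ev]
  · intro i j
    simp [AExp.ev, nK2, nH1, nH2, hyx, ha', hb, hb']
  · intro i l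
    have := ((T (y i)).sbit l).val_lt
    have := ((G i).sbit l).val_lt
    split_ifs <;> omega
  · intro i j
    simp [AExp.ev, nK1, nH1, hyx, ha, ha']
  · intro i l
    have := ((T (y i)).bit l).val_lt
    have := ((G i).bit l).val_lt
    split_ifs <;> omega
  · intro i j
    simp [AExp.ev, nK, nK2, nH, nH1, hyx, ha', hb, hs, hs', hx']
  · intro i l
    have := sum_two_mul_sbit_le (G i) (T (y i)) (show n ≤ N by omega)
    have := hmod i
    have := hmod' (y i)
    split_ifs <;> omega

end RAM

/-! ### Gauss–Jordan elimination in the array language -/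

namespace RAM

variable {N : ℕ} {I : ℕ → ℕ} {ρ : ℕ → ℕ} {A : Arrays} {n : ℕ}

theorem exec_seq (c₁ c₂ : Cmd) :
    (Cmd.seq c₁ c₂).exec N I ρ A = c₂.exec N I ρ (c₁.exec N I ρ A) := rfl

theorem writes_mulRows {K H x : ℕ} {cond : AExp} {k : ℕ} (h : (mulRows K H x cond).Writes k) :
    (30 ≤ k ∧ k ≤ 33) ∨ (K ≤ k ∧ k ≤ K + 2) := by
  simp only [mulRows, assignMod, modCmd, Cmd.Writes] at h
  omega

/-- Clear the entries of the operator in the arrays `15`, `16`, `17` at the pivots of `K`. -/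
def reduceRow (K : ℕ) : Cmd := .loop 2 (mulRows 15 K 2 (.arr 16 0 2))

theorem writes_reduceRow {K k : ℕ} (h : (reduceRow K).Writes k) :
    (30 ≤ k ∧ k ≤ 33) ∨ (15 ≤ k ∧ k ≤ 17) :=
  writes_mulRows h

theorem holds_reduceRow {K : ℕ} {T : ℕ → XSOp n} {r : XSOp n} (hn : n + 2 ≤ N)
    (hK : K + 2 < 15 ∨ 17 < K ∧ K + 2 < 30) (hr : Holds A 15 fun _ => r) (hT : Holds A K T) :
    Holds ((reduceRow K).exec N I ρ A) 15 fun _ => XSOp.reduce T r N := by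
  refine (iter_induction (fun p A' => Holds A' 15 (fun _ => XSOp.reduce T r p) ∧ Holds A' K T) N
    ⟨hr, hT⟩ fun p _ A' hA' => ⟨?_, ?_⟩).1
  · obtain ⟨h1, h2⟩ := hA'
    have := holds_mulRows (N := N) (I := I) (ρ := Function.update ρ 2 p) (x := 2)
      (cond := .arr 16 0 2) hn (by norm_num) (by omega) (by norm_num) (by norm_num)
      (fun _ => ((XSOp.reduce T r p).bit p).val) (fun i j => by simp [AExp.ev, (h1 i p).2.1]) h1 h2
    simp only [Function.update_of_ne (show (2 : ℕ) ≠ 0 by norm_num), Function.update_self, ne_eq,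
      ZMod.val_eq_zero, ite_not] at this
    exact this
  · exact hA'.2.exec fun i hi hw => by have := writes_mulRows hw; omega

/-- Add the operator in the arrays `15`, `16`, `17` to the rows `K`; the order of the columns is
given by the array `key`. -/
def insertRow (K key : ℕ) : Cmd :=
  -- A sum serves as a quantifier: it is nonzero exactly when some column with smaller key carries a
  -- nonzero bit.
  .seq (.assign 34 <| .ite (.arr 16 0 1) (.ite (.sum 10 <| .ite (.sub (.arr key 0 1) (.arr key 0 10))
    (.arr 16 0 10) (.const 0)) (.const 0) (.const 1)) (.const 0)) <|
  .seq (mulRows K 15 0 <| .ite (.arr 34 0 0) (.const 0) <|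
    .sum 10 <| .ite (.arr 34 0 10) (.arr (K + 1) 0 10) (.const 0)) <|
  .seq (.assign K <| .ite (.arr 34 0 0) (.arr 15 0 1) (.arr K 0 1)) <|
  .seq (.assign (K + 1) <| .ite (.arr 34 0 0) (.arr 16 0 1) (.arr (K + 1) 0 1)) <|
  .assign (K + 2) <| .ite (.arr 34 0 0) (.arr 17 0 1) (.arr (K + 2) 0 1)

theorem writes_insertRow {K key k : ℕ} (h : (insertRow K key).Writes k) :
    (30 ≤ k ∧ k ≤ 34) ∨ (K ≤ k ∧ k ≤ K + 2) := by
  simp only [insertRow, Cmd.Writes] at h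
  rcases h with h | h | h
  · omega
  · have := writes_mulRows h; omega
  · omega

theorem holds_insertRow {K key : ℕ} {κ : ℕ → ℕ} {T : ℕ → XSOp n} {r : XSOp n} (hn : n + 2 ≤ N)
    (hK : K + 2 < 15 ∨ 17 < K ∧ K + 2 < 30) (hkey : ∀ i l, A key i l = κ l)
    (hr : Holds A 15 fun _ => r) (hT : Holds A K T) :
    Holds ((insertRow K key).exec N I ρ A) K (XSOp.insertRow κ T r) := by
  classical
  have hpiv : ∀ i j, (AExp.ite (.arr 16 0 1) (.ite (.sum 10 <| .ite (.sub (.arr key 0 1)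
      (.arr key 0 10)) (.arr 16 0 10) (.const 0)) (.const 0) (.const 1)) (.const 0)).ev N I
      (Function.update (Function.update ρ 0 i) 1 j) A = if XSOp.IsPivot κ r j then 1 else 0 := by
    intro i j
    have h1 : ∀ l, A 16 i l = (r.bit l).val := fun l => (hr i l).2.1
    simp only [AExp.ev, hkey, h1, ne_eq, Function.update_self, Function.update_of_ne
      (show (0 : ℕ) ≠ 1 by norm_num), Function.update_of_ne (show (0 : ℕ) ≠ 10 by norm_num),
      Function.update_of_ne (show (1 : ℕ) ≠ 10 by norm_num)]
    have h2 : (∑ l ∈ Finset.range N, if ¬κ j - κ l = 0 then (r.bit l).val else 0) = 0 ↔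
        ∀ l, κ l < κ j → r.bit l = 0 := by
      rw [Finset.sum_eq_zero_iff]
      constructor
      · intro h l hl
        by_contra h0
        have := h l (Finset.mem_range.2 (by have := XSOp.lt_of_bit_ne h0; omega))
        rw [if_pos (by omega), ZMod.val_eq_zero] at this
        exact h0 this
      · intro h l _
        by_cases hl : κ j - κ l = 0
        · rw [if_neg (not_not.2 hl)]
        · rw [if_pos hl, h l (by omega), ZMod.val_zero]
    simp only [h2, ZMod.val_eq_zero]
    by_cases h3 : r.bit j = 0
    · rw [if_neg (not_not.2 h3), if_neg fun h => h.1 h3]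
    by_cases h4 : ∀ l, κ l < κ j → r.bit l = 0
    · rw [if_pos h3, if_neg (not_not.2 h4), if_pos ⟨h3, h4⟩]
    · rw [if_pos h3, if_pos h4, if_neg fun h => h4 h.2]
  set A₁ := Function.update A 34 fun _ j => if XSOp.IsPivot κ r j then 1 else 0 with hA₁
  have hr₁ : Holds A₁ 15 fun _ => r := hr.congr fun i hi => Function.update_of_ne (by omega) _ _
  have hT₁ : Holds A₁ K T := hT.congr fun i hi => Function.update_of_ne (by omega) _ _
  have h34 : ∀ i j, A₁ 34 i j = if XSOp.IsPivot κ r j then 1 else 0 := by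
    intro i j; simp [hA₁]
  set cond := AExp.ite (.arr 34 0 0) (.const 0) <|
    .sum 10 <| .ite (.arr 34 0 10) (.arr (K + 1) 0 10) (.const 0) with hcond
  have hc : ∀ i j, cond.ev N I (Function.update (Function.update ρ 0 i) 1 j) A₁ =
      if XSOp.IsPivot κ r i then 0 else
        ∑ c ∈ Finset.range N, if XSOp.IsPivot κ r c then ((T i).bit c).val else 0 := by
    intro i j
    have h1 : ∀ l, A₁ (K + 1) i l = ((T i).bit l).val := fun l => (hT₁ i l).2.1
    simp [hcond, AExp.ev, h34, h1]
  have hmul := holds_mulRows (I := I) (ρ := ρ) hn (by omega) (x := 0) (by norm_num) (by norm_num)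
    (by norm_num) _ hc hT₁ hr₁
  set A₂ := (mulRows K 15 0 cond).exec N I ρ A₁ with hA₂
  have hr₂ : Holds A₂ 15 fun _ => r := hr₁.exec fun i hi hw => by
    have := writes_mulRows hw; omega
  have h34' : ∀ i j, A₂ 34 i j = if XSOp.IsPivot κ r j then 1 else 0 := by
    intro i j
    rw [hA₂, Cmd.exec_of_not_writes fun hw => by have := writes_mulRows hw; omega]
    exact h34 i j
  have hmul' : ∀ i, (¬ XSOp.IsPivot κ r i) → ∀ l, A₂ K i l = (XSOp.insertRow κ T r i).s.val ∧
      A₂ (K + 1) i l = ((XSOp.insertRow κ T r i).bit l).val ∧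
      A₂ (K + 2) i l = ((XSOp.insertRow κ T r i).sbit l).val := by
    intro i hi l
    have h1 : (∑ c ∈ Finset.range N, if XSOp.IsPivot κ r c then ((T i).bit c).val else 0) ≠ 0 ↔
        ∃ c, XSOp.IsPivot κ r c ∧ (T i).bit c ≠ 0 := by
      rw [ne_eq, Finset.sum_eq_zero_iff]
      push Not
      refine exists_congr fun c => ?_
      constructor
      · rintro ⟨-, h⟩
        split_ifs at h with h'
        · exact ⟨h', by simpa using h⟩
        · exact absurd rfl h
      · rintro ⟨h, h'⟩
        exact ⟨Finset.mem_range.2 (by have := XSOp.lt_of_bit_ne h'; omega), by simpa [h] using h'⟩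
    have h2 := hmul i l
    simp only [if_neg hi, h1] at h2
    simpa only [XSOp.insertRow, if_neg hi] using h2
  have ne : ∀ i < 3, K + i ≠ 34 ∧ K + i ≠ 15 ∧ K + i ≠ 16 ∧ K + i ≠ 17 := by omega
  have n0 := ne 0 (by norm_num)
  have n1 := ne 1 (by norm_num)
  have n2 := ne 2 (by norm_num)
  rw [add_zero] at n0
  have hval : ∀ i l, (if XSOp.IsPivot κ r i then A₂ 15 i l else A₂ K i l) =
      (XSOp.insertRow κ T r i).s.val ∧ (if XSOp.IsPivot κ r i then A₂ 16 i l else A₂ (K + 1) i l) =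
      ((XSOp.insertRow κ T r i).bit l).val ∧ (if XSOp.IsPivot κ r i then A₂ 17 i l else
      A₂ (K + 2) i l) = ((XSOp.insertRow κ T r i).sbit l).val := by
    intro i l
    by_cases hp : XSOp.IsPivot κ r i
    · simp only [if_pos hp, XSOp.insertRow]
      exact hr₂ i l
    · simp only [if_neg hp]
      exact hmul' i hp l
  rw [insertRow, exec_seq, exec_assign _ hpiv, ← hA₁, exec_seq, ← hA₂, exec_seq, exec_seq,
    exec_assign (k := K) (fun i l => (XSOp.insertRow κ T r i).s.val),
    exec_assign (k := K + 1) (fun i l => ((XSOp.insertRow κ T r i).bit l).val),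
    exec_assign (k := K + 2) (fun i l => ((XSOp.insertRow κ T r i).sbit l).val)]
  · exact holds_update fun i l => ⟨rfl, rfl, rfl⟩
  · intro i l
    rw [← (hval i l).2.2]
    simp [AExp.ev, n0.1.symm, n1.1.symm, n0.2.2.2.symm, n1.2.2.2.symm, h34']
  · intro i l
    rw [← (hval i l).2.1]
    simp [AExp.ev, n0.1.symm, n0.2.2.1.symm, h34']
  · intro i l
    rw [← (hval i l).1]
    simp [AExp.ev, h34']

/-- Add the operators that `c` writes to the arrays `15`, `16`, `17`, for `x = 0, …, N - 1`, to the
rows `K`. -/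
def gather (x K key : ℕ) (c : Cmd) : Cmd := .loop x <| .seq c <| .seq (reduceRow K) (insertRow K key)

theorem writes_gather {x K key k : ℕ} {c : Cmd} (h : (gather x K key c).Writes k) :
    c.Writes k ∨ (30 ≤ k ∧ k ≤ 34) ∨ (15 ≤ k ∧ k ≤ 17) ∨ (K ≤ k ∧ k ≤ K + 2) := by
  rcases h with h | h | h
  · exact .inl h
  · have := writes_reduceRow h; omega
  · have := writes_insertRow h; omega

/-- The rows `K` hold an echelon form of `S`. -/
def HoldsSpan (A : Arrays) (K : ℕ) (κ : ℕ → ℕ) (S : Set (XSOp n)) : Prop :=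
  ∃ T, Holds A K T ∧ XSOp.Spans κ T S

/-- Each round inserts one further operator into the echelon form, after reducing it by the rows
present so far. -/
theorem holdsSpan_gather {x K key : ℕ} {κ : ℕ → ℕ} (hκ : Set.InjOn κ (Set.Iio n)) {c : Cmd}
    (hn : n + 2 ≤ N) (hK : K + 2 < 15 ∨ 17 < K ∧ K + 2 < 30) (hkey : ∀ i l, A key i l = κ l)
    (hw : ∀ k, (gather x K key c).Writes k → k ≠ key) (hcK : ∀ i < 3, ¬ c.Writes (K + i))
    {G : ℕ → XSOp n} {S : Set (XSOp n)} (hS : HoldsSpan A K κ S)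
    (hc : ∀ p < N, ∀ A', (∀ k, ¬ (gather x K key c).Writes k → A' k = A k) →
      Holds (c.exec N I (Function.update ρ x p) A') 15 fun _ => G p) :
    HoldsSpan ((gather x K key c).exec N I ρ A) K κ (S ∪ G '' Set.Iio N) := by
  refine (iter_induction (fun p A' => (∀ k, ¬ (gather x K key c).Writes k → A' k = A k) ∧
    HoldsSpan A' K κ (S ∪ G '' Set.Iio p)) N ⟨fun _ _ => rfl, by simpa using hS⟩ ?_).2
  rintro p hp A' ⟨hA', T, hT, hTS⟩
  refine ⟨fun k hk => ?_, XSOp.insertRow κ T (XSOp.reduce T (G p) N), ?_, ?_⟩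
  · rw [← hA' k hk]
    exact Cmd.exec_of_not_writes (c := .seq c (.seq (reduceRow K) (insertRow K key))) hk _ _
  · have h1 := hc p hp A' hA'
    have h2 := hT.exec (N := N) (I := I) (ρ := Function.update ρ x p) hcK
    have h3 := holds_reduceRow (I := I) (ρ := Function.update ρ x p) hn hK h1 h2
    refine holds_insertRow hn hK (fun i l => ?_) h3 (h2.exec fun i hi hw' => ?_)
    · rw [Cmd.exec_of_not_writes fun h => hw key (.inr (.inl h)) rfl,
        Cmd.exec_of_not_writes fun h => hw key (.inl h) rfl,
        hA' key fun h => hw key h rfl, hkey]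
    · have := writes_reduceRow hw'; omega
  · have := hTS.insertRow hκ (G p) (show n ≤ N by omega)
    have e : S ∪ G '' Set.Iio (p + 1) = insert (G p) (S ∪ G '' Set.Iio p) := by
      have : Set.Iio (p + 1) = insert p (Set.Iio p) := by
        ext; simp only [Set.mem_Iio, Set.mem_insert_iff]; omega
      rw [this, Set.image_insert_eq, Set.union_insert]
    rwa [e]

end RAM

/-! ### Reading the input -/

theorem List.getD_flatten_of_length {α : Type*} {w : ℕ} (L : List (List α))
    (hL : ∀ l ∈ L, l.length = w) {j r : ℕ} (hj : j < L.length) (hr : r < w) (d : α) :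
    L.flatten.getD (j * w + r) d = (L[j]).getD r d := by
  induction L generalizing j with
  | nil => simp at hj
  | cons l L ih =>
    have hl : l.length = w := hL l (by simp)
    cases j with
    | zero =>
      rw [List.flatten_cons, List.getD_append _ _ _ _ (by omega)]
      simp
    | succ j =>
      rw [List.flatten_cons, List.getD_append_right _ _ _ _ (by rw [hl, Nat.succ_mul]; omega), hl,
        show (j + 1) * w + r - w = j * w + r by rw [Nat.succ_mul]; omega,
        ih (fun l' h' => hL l' (by simp [h'])) (by simpa using hj)]
      simp

theorem List.getD_ofFn {α : Type*} {n : ℕ} (f : Fin n → α) {i : ℕ} (hi : i < n) (d : α) :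
    (List.ofFn f).getD i d = f ⟨i, hi⟩ := by
  rw [List.getD_eq_getElem _ _ (by simpa using hi), List.getElem_ofFn]

section
variable {n : ℕ}

theorem XSOp.length_encode (g : XSOp n) : g.encode.length = 2 * n + 1 := by
  simp [XSOp.encode]; ring

theorem XSOp.getD_encode_a (g : XSOp n) {l : ℕ} (hl : l < n) :
    g.encode.getD (1 + l) 0 = (g.bit l).val := by
  rw [XSOp.encode, Nat.add_comm, List.getD_cons_succ, List.getD_append _ _ _ _ (by simpa using hl),
    List.getD_ofFn _ hl]
  simp [XSOp.bit, hl]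

theorem XSOp.getD_encode_b (g : XSOp n) {l : ℕ} (hl : l < n) :
    g.encode.getD (1 + n + l) 0 = (g.sbit l).val := by
  rw [XSOp.encode, show 1 + n + l = n + l + 1 by ring, List.getD_cons_succ,
    List.getD_append_right _ _ _ _ (by simp), List.length_ofFn, Nat.add_sub_cancel_left,
    List.getD_ofFn _ hl]
  simp [XSOp.sbit, hl]

theorem PauliOp.length_encode (g : PauliOp n) : g.encode.length = 2 * n + 1 := by
  simp [PauliOp.encode]; ring

theorem PauliOp.getD_encode_a (g : PauliOp n) (l : Fin n) :
    g.encode.getD (1 + l) 0 = (g.a l).val := by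
  rw [PauliOp.encode, Nat.add_comm, List.getD_cons_succ, List.getD_append _ _ _ _ (by simp),
    List.getD_ofFn _ l.2]

theorem PauliOp.getD_encode_b (g : PauliOp n) (l : Fin n) :
    g.encode.getD (1 + n + l) 0 = (g.b l).val := by
  rw [PauliOp.encode, show 1 + n + (l : ℕ) = n + l + 1 by ring, List.getD_cons_succ,
    List.getD_append_right _ _ _ _ (by simp), List.length_ofFn, Nat.add_sub_cancel_left,
    List.getD_ofFn _ l.2]

theorem length_flatten_ofFn {m w : ℕ} (f : Fin m → List ℕ) (hf : ∀ j, (f j).length = w) :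
    (List.ofFn f).flatten.length = m * w := by
  have : List.map (List.length ∘ f) (List.finRange m) = List.replicate m w := by
    refine List.eq_replicate_iff.2 ⟨by simp, ?_⟩
    simp [hf]
  simp [List.length_flatten, List.ofFn_eq_map, this]

theorem getD_flatten_ofFn {m w : ℕ} (f : Fin m → List ℕ) (hf : ∀ j, (f j).length = w) (j : Fin m)
    {r : ℕ} (hr : r < w) : (List.ofFn f).flatten.getD (j * w + r) 0 = (f j).getD r 0 := by
  rw [List.getD_flatten_of_length (w := w) _ _ (by simp) hr]
  · simp
  · intro l hl
    obtain ⟨i, rfl⟩ := (List.mem_ofFn' _ _).1 hl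
    exact hf i

/-- Zero-padded access to the input of the algorithms. -/
structure IsInput {m : ℕ} (I : ℕ → ℕ) (g : Fin m → XSOp n) (S : Finset (Fin n)) : Prop where
  zero : I 0 = n
  one : I 1 = m
  side : ∀ l < n, I (2 + l) = inA S l
  gen : ∀ j : Fin m, ∀ r < 2 * n + 1, I (2 + n + (j * (2 * n + 1) + r)) = (g j).encode.getD r 0

theorem isInput_encodeInput {m : ℕ} (g : Fin m → XSOp n) (S : Finset (Fin n)) :
    IsInput (fun i => (encodeInput g S).getD i 0) g S where
  zero := rfl
  one := rfl
  side l hl := by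
    rw [encodeInput, Nat.add_comm, List.getD_cons_succ, List.getD_cons_succ,
      List.getD_append _ _ _ _ (by simpa using hl), List.getD_ofFn _ hl, ← inA_fin]
  gen j r hr := by
    rw [encodeInput, show 2 + n + (j * (2 * n + 1) + r) = n + (j * (2 * n + 1) + r) + 1 + 1 by ring,
      List.getD_cons_succ, List.getD_cons_succ, List.getD_append_right _ _ _ _ (by simp),
      List.length_ofFn, Nat.add_sub_cancel_left, getD_flatten_ofFn _ (fun j => (g j).length_encode) j hr]

theorem length_encodeInput {m : ℕ} (g : Fin m → XSOp n) (S : Finset (Fin n)) :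
    (encodeInput g S).length = 2 + (n + m * (2 * n + 1)) := by
  simp only [encodeInput, List.length_cons, List.length_append, List.length_ofFn]
  rw [length_flatten_ofFn _ fun j => (g j).length_encode]
  ring

end

namespace RAM

variable {N : ℕ} {I : ℕ → ℕ} {ρ : ℕ → ℕ} {A : Arrays} {n m : ℕ} {g : Fin m → XSOp n}
  {S : Finset (Fin n)}

/-- The generators, continued by the identity. -/
def padded (g : Fin m → XSOp n) (j : ℕ) : XSOp n := if h : j < m then g ⟨j, h⟩ else 1

/-- Write the generators to the arrays `0`, `1`, `2`, the bipartition to the array `40`, and the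
orders of the columns to the arrays `41`, `42`, `43`. -/
def load : Cmd :=
  -- The offset `i * (2 * n + 1)` of generator `i`, as a sum over `y < i`, the language being
  -- without products.
  .seq (.assign 44 <| .sum 10 <| .ite (.sub (.var 0) (.var 10))
    (.add (.smul 2 (.inp (.const 0))) (.const 1)) (.const 0)) <|
  .seq (.assign 0 <| .ite (.sub (.inp (.const 1)) (.var 0))
    (.inp (.add (.add (.const 2) (.inp (.const 0))) (.add (.arr 44 0 1) (.const 0)))) (.const 0)) <|
  .seq (.assign 1 <| .ite (.sub (.inp (.const 1)) (.var 0)) (.ite (.sub (.inp (.const 0)) (.var 1))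
    (.inp (.add (.add (.const 2) (.inp (.const 0))) (.add (.arr 44 0 1) (.add (.const 1) (.var 1)))))
    (.const 0)) (.const 0)) <|
  .seq (.assign 2 <| .ite (.sub (.inp (.const 1)) (.var 0)) (.ite (.sub (.inp (.const 0)) (.var 1))
    (.inp (.add (.add (.const 2) (.inp (.const 0))) (.add (.arr 44 0 1)
      (.add (.add (.const 1) (.inp (.const 0))) (.var 1))))) (.const 0)) (.const 0)) <|
  .seq (.assign 40 <| .ite (.sub (.inp (.const 0)) (.var 1)) (.inp (.add (.const 2) (.var 1)))
    (.const 0)) <|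
  .seq (.assign 41 <| .ite (.arr 40 0 1) (.add (.inp (.const 0)) (.var 1)) (.var 1)) <|
  .seq (.assign 42 <| .ite (.arr 40 0 1) (.var 1) (.add (.inp (.const 0)) (.var 1))) <|
  .assign 43 (.var 1)

theorem writes_load {k : ℕ} (h : load.Writes k) : k ≤ 2 ∨ 40 ≤ k := by
  simp only [load, Cmd.Writes] at h
  omega

theorem sum_ite_sub (i w : ℕ) (hi : i ≤ N) :
    (∑ y ∈ Finset.range N, if i - y ≠ 0 then w else 0) = i * w := by
  have h3 : (Finset.range N).filter (fun y => i - y ≠ 0) = Finset.range i := by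
    ext x; simp; omega
  rw [← Finset.sum_filter, h3]
  simp

/-- The contents of the arrays after loading. -/
structure Loaded (g : Fin m → XSOp n) (S : Finset (Fin n)) (A : Arrays) : Prop where
  gens : Holds A 0 (padded g)
  side : ∀ i l, A 40 i l = inA S l
  out : ∀ i l, A 41 i l = keyOut S l
  inn : ∀ i l, A 42 i l = keyIn S l
  key : ∀ i l, A 43 i l = l

theorem inA_of_le {l : ℕ} (hl : n ≤ l) : inA S l = 0 := by
  rw [inA, if_neg]
  rintro ⟨h, -⟩
  omega

theorem loaded_load (hI : IsInput I g S) (hm : m ≤ N) : Loaded g S (load.exec N I ρ A) := by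
  have hs : ∀ i, (if m - i ≠ 0 then I (2 + n + ((∑ y ∈ Finset.range N, if i - y ≠ 0 then 2 * n + 1
      else 0) + 0)) else 0) = (padded g i).s.val := by
    intro i
    by_cases hi : i < m
    · rw [if_pos (by omega), sum_ite_sub i _ (by omega), hI.gen ⟨i, hi⟩ 0 (by omega), padded, dif_pos hi]
      rfl
    · rw [if_neg (by omega), padded, dif_neg hi]
      rfl
  have ha : ∀ i l, (if m - i ≠ 0 then if n - l ≠ 0 then I (2 + n + ((∑ y ∈ Finset.range N,
      if i - y ≠ 0 then 2 * n + 1 else 0) + (1 + l))) else 0 else 0) = ((padded g i).bit l).val := by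
    intro i l
    by_cases hi : i < m
    · by_cases hl : l < n
      · rw [if_pos (by omega), if_pos (by omega), sum_ite_sub i _ (by omega),
          hI.gen ⟨i, hi⟩ (1 + l) (by omega), padded, dif_pos hi, XSOp.getD_encode_a _ hl]
      · rw [if_pos (by omega), if_neg (by omega), XSOp.bit, dif_neg hl]
        rfl
    · rw [if_neg (by omega), padded, dif_neg hi]
      simp
  have hb : ∀ i l, (if m - i ≠ 0 then if n - l ≠ 0 then I (2 + n + ((∑ y ∈ Finset.range N,
      if i - y ≠ 0 then 2 * n + 1 else 0) + (1 + n + l))) else 0 else 0) =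
      ((padded g i).sbit l).val := by
    intro i l
    by_cases hi : i < m
    · by_cases hl : l < n
      · rw [if_pos (by omega), if_pos (by omega), sum_ite_sub i _ (by omega),
          hI.gen ⟨i, hi⟩ (1 + n + l) (by omega), padded, dif_pos hi, XSOp.getD_encode_b _ hl]
      · rw [if_pos (by omega), if_neg (by omega), XSOp.sbit, dif_neg hl]
        rfl
    · rw [if_neg (by omega), padded, dif_neg hi]
      simp
  have h40 : ∀ l, (if n - l ≠ 0 then I (2 + l) else 0) = inA S l := by
    intro l
    by_cases hl : l < n
    · rw [if_pos (by omega), hI.side l hl]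
    · rw [if_neg (by omega), inA_of_le (by omega)]
  rw [load, exec_seq, exec_assign (k := 44)
      (fun i _ => ∑ y ∈ Finset.range N, if i - y ≠ 0 then 2 * n + 1 else 0),
    exec_seq, exec_assign (k := 0) (fun i _ => (padded g i).s.val),
    exec_seq, exec_assign (k := 1) (fun i l => ((padded g i).bit l).val),
    exec_seq, exec_assign (k := 2) (fun i l => ((padded g i).sbit l).val),
    exec_seq, exec_assign (k := 40) (fun _ l => inA S l),
    exec_seq, exec_assign (k := 41) (fun _ l => keyOut S l),
    exec_seq, exec_assign (k := 42) (fun _ l => keyIn S l), exec_assign (k := 43) (fun _ l => l)]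
  · refine ⟨fun i l => ?_, fun i l => ?_, fun i l => ?_, fun i l => ?_, fun i l => ?_⟩ <;> simp
  · intro i l
    simp [AExp.ev]
  · intro i l
    simp [AExp.ev, hI.zero, keyIn]
  · intro i l
    simp [AExp.ev, hI.zero, keyOut]
  · intro i l
    rw [← h40]
    simp [AExp.ev, hI.zero]
  · intro i l
    rw [← hb]
    simp [AExp.ev, hI.zero, hI.one]
  · intro i l
    rw [← ha]
    simp [AExp.ev, hI.zero, hI.one]
  · intro i l
    rw [← hs]
    simp [AExp.ev, hI.zero, hI.one]
  · intro i l
    simp [AExp.ev, hI.zero]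

theorem Loaded.congr {A' : Arrays} (h : Loaded g S A)
    (h' : ∀ k, (k ≤ 2 ∨ (40 ≤ k ∧ k ≤ 43)) → A' k = A k) : Loaded g S A' := by
  refine ⟨h.gens.congr fun i hi => h' _ (by omega), fun i l => ?_, fun i l => ?_, fun i l => ?_,
    fun i l => ?_⟩
  · rw [h' 40 (by norm_num), h.side]
  · rw [h' 41 (by norm_num), h.out]
  · rw [h' 42 (by norm_num), h.inn]
  · rw [h' 43 (by norm_num), h.key]

theorem Loaded.exec {c : Cmd} (h : Loaded g S A)
    (h' : ∀ k, c.Writes k → 3 ≤ k ∧ (k < 40 ∨ 43 < k)) : Loaded g S (c.exec N I ρ A) :=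
  h.congr fun _ hk => c.exec_of_not_writes (fun hw => by have := h' _ hw; omega) _ _

end RAM

/-! ### The echelon forms, the point of the support, and the coupling matrix -/

namespace XSOp

variable {n : ℕ}

theorem Spans.of_subset {key : ℕ → ℕ} {T : ℕ → XSOp n} {S S' : Set (XSOp n)} (h : Spans key T S)
    (hS : S' ⊆ S) (h1 : ∀ g ∈ S, g ∈ S' ∨ g = 1) : Spans key T S' where
  reduced := h.reduced
  of_gen P hP hg := h.of_gen P hP fun g hgS => (h1 g hgS).elim (hg g) (by rintro rfl; exact hP.one)
  gen_of P Q hP hQ hgQ h0 hT g hgS := h.gen_of P Q hP hQ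
    (fun g hgS => (h1 g hgS).elim (hgQ g) (by rintro rfl; exact hQ.one)) h0 hT g (hS hgS)

theorem toEquation_s (d : XSOp n) : d.toEquation.s.val = d.s.val - 3 := by
  rw [toEquation, ZMod.val_natCast]
  have := d.s.val_lt
  omega

theorem toEquation_bit (d : XSOp n) (l : ℕ) :
    (d.toEquation.bit l).val = (d.sbit l).val - 1 - ((d.sbit l).val - 2) := by
  unfold bit sbit toEquation
  split_ifs with h
  · rw [ZMod.val_natCast]
    have := (d.b ⟨l, h⟩).val_lt
    omega
  · rfl

theorem toEquation_sbit (d : XSOp n) (l : ℕ) : d.toEquation.sbit l = 0 := by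
  unfold sbit toEquation
  split_ifs <;> rfl

theorem toEquation_one : (1 : XSOp n).toEquation = 1 := by
  simp only [toEquation, one_s, one_b, Pi.zero_apply, ZMod.val_zero]
  rfl

theorem reduce_one {T : ℕ → XSOp n} (N : ℕ) : reduce T 1 N = 1 :=
  RAM.iter_induction (fun _ r => r = 1) N rfl fun p _ r hr => by simp [hr]

end XSOp

namespace RAM

variable {N : ℕ} {I : ℕ → ℕ} {ρ : ℕ → ℕ} {A : Arrays} {n m : ℕ} {g : Fin m → XSOp n}
  {S : Finset (Fin n)}

/-- Copy the row `x` of `K` to the arrays `15`, `16`, `17`. -/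
def copyRow (K x : ℕ) : Cmd :=
  .seq (.assign 15 (.arr K x 1)) <| .seq (.assign 16 (.arr (K + 1) x 1)) (.assign 17 (.arr (K + 2) x 1))

theorem holds_copyRow {K x : ℕ} {T : ℕ → XSOp n} (hK : K + 2 < 15) (hx : 2 ≤ x) (hT : Holds A K T) :
    Holds ((copyRow K x).exec N I ρ A) 15 fun _ => T (ρ x) := by
  have h : ∀ i j, Function.update (Function.update ρ 0 i) 1 j x = ρ x := by
    intro i j
    rw [Function.update_of_ne (by omega), Function.update_of_ne (by omega)]
  have ne : ∀ i < 3, K + i ≠ 15 ∧ K + i ≠ 16 := by omega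
  rw [copyRow, exec_seq, exec_assign (k := 15) (fun _ _ => (T (ρ x)).s.val),
    exec_seq, exec_assign (k := 16) (fun _ l => ((T (ρ x)).bit l).val),
    exec_assign (k := 17) (fun _ l => ((T (ρ x)).sbit l).val)]
  · exact holds_update fun i l => ⟨rfl, rfl, rfl⟩
  · intro i l
    simp [AExp.ev, h, ne 2, (hT (ρ x) l).2.2]
  · intro i l
    simp [AExp.ev, h, ne 1, (hT (ρ x) l).2.1]
  · intro i l
    simp [AExp.ev, h, (hT (ρ x) l).1]

/-- Convert the diagonal operator in the arrays `15`, `16`, `17` to an equation. -/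
def equationRow : Cmd :=
  .seq (.assign 15 <| .sub (.arr 15 0 1) (.const 3)) <|
  .seq (.assign 16 <| .sub (.sub (.arr 17 0 1) (.const 1)) (.sub (.arr 17 0 1) (.const 2))) <|
  .assign 17 (.const 0)

theorem holds_equationRow {d : XSOp n} (h : Holds A 15 fun _ => d) :
    Holds (equationRow.exec N I ρ A) 15 fun _ => d.toEquation := by
  have h2 : ∀ i l, A 17 i l = (d.sbit l).val := fun i l => (h i l).2.2
  rw [equationRow, exec_seq, exec_assign (k := 15) (fun _ _ => d.toEquation.s.val),
    exec_seq, exec_assign (k := 16) (fun _ l => (d.toEquation.bit l).val),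
    exec_assign (k := 17) (fun _ l => (d.toEquation.sbit l).val)]
  · exact holds_update fun i l => ⟨rfl, rfl, rfl⟩
  · intro i l
    simp [AExp.ev, d.toEquation_sbit]
  · intro i l
    simp [AExp.ev, d.toEquation_bit, h2]
  · intro i l
    simp [AExp.ev, d.toEquation_s, (h i l).1]

/-- The loops that compute the echelon forms of the generators and of the equations. -/
def outForm : Cmd := gather 3 3 41 (copyRow 0 3)
def innForm : Cmd := gather 3 6 42 (copyRow 0 3)
def reducedEquations : Cmd :=
  gather 3 9 43 (.seq (copyRow 0 3) (.seq (reduceRow 3) equationRow))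
def squareEquations : Cmd := .loop 4 <| gather 3 9 43 <| .seq (copyRow 3 4) <|
  .seq (mulRows 15 3 3 (.const 1)) <| .seq (mulRows 15 15 0 (.const 1)) equationRow

theorem writes_copyRow {K x k : ℕ} (h : (copyRow K x).Writes k) : 15 ≤ k ∧ k ≤ 17 := by
  simp only [copyRow, Cmd.Writes] at h; omega

theorem writes_equationRow {k : ℕ} (h : equationRow.Writes k) : 15 ≤ k ∧ k ≤ 17 := by
  simp only [equationRow, Cmd.Writes] at h; omega

theorem writes_outForm {k : ℕ} (h : outForm.Writes k) :
    (3 ≤ k ∧ k ≤ 5) ∨ (15 ≤ k ∧ k ≤ 17) ∨ (30 ≤ k ∧ k ≤ 34) := by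
  rcases writes_gather h with h | h
  · have := writes_copyRow h; omega
  · omega

theorem writes_innForm {k : ℕ} (h : innForm.Writes k) :
    (6 ≤ k ∧ k ≤ 8) ∨ (15 ≤ k ∧ k ≤ 17) ∨ (30 ≤ k ∧ k ≤ 34) := by
  rcases writes_gather h with h | h
  · have := writes_copyRow h; omega
  · omega

theorem writes_reducedEquations {k : ℕ} (h : reducedEquations.Writes k) :
    (9 ≤ k ∧ k ≤ 11) ∨ (15 ≤ k ∧ k ≤ 17) ∨ (30 ≤ k ∧ k ≤ 34) := by
  rcases writes_gather h with (h | h | h) | h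
  · have := writes_copyRow h; omega
  · have := writes_reduceRow h; omega
  · have := writes_equationRow h; omega
  · omega

theorem writes_squareEquations {k : ℕ} (h : squareEquations.Writes k) :
    (9 ≤ k ∧ k ≤ 11) ∨ (15 ≤ k ∧ k ≤ 17) ∨ (30 ≤ k ∧ k ≤ 34) := by
  rcases writes_gather (x := 3) h with (h | h | h | h) | h
  · have := writes_copyRow h; omega
  · have := writes_mulRows h; omega
  · have := writes_mulRows h; omega
  · have := writes_equationRow h; omega
  · omega

/-- Loops run to `N` instead of `m`; the surplus rounds insert the identity, which leaves the span
of the generators unchanged. -/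
theorem spans_of_padded (hm : m ≤ N) {κ : ℕ → ℕ} {T : ℕ → XSOp n}
    (h : XSOp.Spans κ T (∅ ∪ padded g '' Set.Iio N)) : XSOp.Spans κ T (Set.range g) := by
  refine h.of_subset ?_ ?_
  · rintro _ ⟨j, rfl⟩
    exact .inr ⟨j, j.2.trans_le hm, by simp [padded]⟩
  · rintro _ (h | ⟨j, -, rfl⟩)
    · exact h.elim
    · by_cases hj : j < m
      · exact .inl ⟨⟨j, hj⟩, by simp [padded, hj]⟩
      · exact .inr (dif_neg hj)

theorem HoldsSpan.empty {K : ℕ} {κ : ℕ → ℕ} (hA : ∀ i < 3, A (K + i) = fun _ _ => 0) :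
    HoldsSpan A K (n := n) κ ∅ := by
  refine ⟨_, fun i l => ?_, XSOp.spans_empty _⟩
  have := hA 0 (by norm_num)
  rw [add_zero] at this
  simp [this, hA]

theorem holds_outForm (hn : n + 2 ≤ N) (hm : m ≤ N) (hA : Loaded g S A)
    (h0 : ∀ i < 3, A (3 + i) = fun _ _ => 0) :
    HoldsSpan (outForm.exec N I ρ A) 3 (keyOut S) (Set.range g) := by
  obtain ⟨T, h1, h2⟩ := holdsSpan_gather (I := I) (ρ := ρ) (x := 3) (c := copyRow 0 3)
    (keyOut_injOn S) hn (by norm_num) hA.out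
    (fun k hk => by have := writes_outForm hk; omega)
    (fun i hi hw => by have := writes_copyRow hw; omega) (HoldsSpan.empty h0) (G := padded g)
    (fun p hp A' hA' => by
      have := holds_copyRow (N := N) (I := I) (ρ := Function.update ρ 3 p) (x := 3) (by norm_num)
        (by norm_num) (hA.gens.congr fun i hi => hA' _ fun hw => by
          have := writes_outForm hw; omega)
      simpa using this)
  exact ⟨T, h1, spans_of_padded hm h2⟩

theorem holds_innForm (hn : n + 2 ≤ N) (hm : m ≤ N) (hA : Loaded g S A)
    (h0 : ∀ i < 3, A (6 + i) = fun _ _ => 0) :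
    HoldsSpan (innForm.exec N I ρ A) 6 (keyIn S) (Set.range g) := by
  obtain ⟨T, h1, h2⟩ := holdsSpan_gather (I := I) (ρ := ρ) (x := 3) (c := copyRow 0 3)
    (keyIn_injOn S) hn (by norm_num) hA.inn
    (fun k hk => by have := writes_innForm hk; omega)
    (fun i hi hw => by have := writes_copyRow hw; omega) (HoldsSpan.empty h0) (G := padded g)
    (fun p hp A' hA' => by
      have := holds_copyRow (N := N) (I := I) (ρ := Function.update ρ 3 p) (x := 3) (by norm_num)
        (by norm_num) (hA.gens.congr fun i hi => hA' _ fun hw => by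
          have := writes_innForm hw; omega)
      simpa using this)
  exact ⟨T, h1, spans_of_padded hm h2⟩

theorem holds_reducedEquations (hn : n + 2 ≤ N) (hA : Loaded g S A) {T : ℕ → XSOp n}
    (hT : Holds A 3 T) (h0 : ∀ i < 3, A (9 + i) = fun _ _ => 0) :
    HoldsSpan (reducedEquations.exec N I ρ A) 9 id
      (∅ ∪ (fun j => (XSOp.reduce T (padded g j) N).toEquation) '' Set.Iio N) := by
  refine holdsSpan_gather (Set.injOn_id _) hn (by norm_num) hA.key
    (fun k hk => by have := writes_reducedEquations hk; omega)
    (fun i hi hw => ?_) (HoldsSpan.empty h0) (fun p hp A' hA' => ?_)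
  · rcases hw with hw | hw | hw
    · have := writes_copyRow hw; omega
    · have := writes_reduceRow hw; omega
    · have := writes_equationRow hw; omega
  · have h1 := holds_copyRow (N := N) (I := I) (ρ := Function.update ρ 3 p) (x := 3) (by norm_num)
      (by norm_num) (hA.gens.congr fun i hi => hA' _ fun hw => by
        have := writes_reducedEquations hw; omega)
    rw [Function.update_self] at h1
    refine holds_equationRow (holds_reduceRow hn (by norm_num) h1 (Holds.exec ?_ fun i hi hw => by
      have := writes_copyRow hw; omega))
    exact hT.congr fun i hi => hA' _ fun hw => by have := writes_reducedEquations hw; omega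

theorem holds_squareEquations (hn : n + 2 ≤ N) (hA : Loaded g S A) {T : ℕ → XSOp n}
    (hT : Holds A 3 T) {S₀ : Set (XSOp n)} (hS : HoldsSpan A 9 id S₀) :
    HoldsSpan (squareEquations.exec N I ρ A) 9 id
      (S₀ ∪ {e | ∃ p < N, ∃ q < N, e = ((T p * T q) * (T p * T q)).toEquation}) := by
  refine (iter_induction (fun k A' => (∀ i, ¬ squareEquations.Writes i → A' i = A i) ∧
    HoldsSpan A' 9 id (S₀ ∪ {e | ∃ p < k, ∃ q < N, e = ((T p * T q) * (T p * T q)).toEquation})) N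
    ⟨fun _ _ => rfl, by simpa using hS⟩ ?_).2
  rintro p hp A₁ ⟨hA₁, hS₁⟩
  refine ⟨fun i hi => ?_, ?_⟩
  · rw [← hA₁ i hi]
    exact Cmd.exec_of_not_writes (c := gather 3 9 43 _) hi _ _
  have hset : S₀ ∪ {e | ∃ p' < p + 1, ∃ q < N, e = ((T p' * T q) * (T p' * T q)).toEquation} =
      (S₀ ∪ {e | ∃ p' < p, ∃ q < N, e = ((T p' * T q) * (T p' * T q)).toEquation}) ∪
      (fun q => ((T p * T q) * (T p * T q)).toEquation) '' Set.Iio N := by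
    rw [Set.union_assoc]
    congr 1
    ext e
    constructor
    · rintro ⟨p', hp', q, hq, rfl⟩
      rcases Nat.lt_succ_iff_lt_or_eq.1 hp' with h | rfl
      · exact .inl ⟨p', h, q, hq, rfl⟩
      · exact .inr ⟨q, hq, rfl⟩
    · rintro (⟨p', hp', q, hq, rfl⟩ | ⟨q, hq, rfl⟩)
      · exact ⟨p', by omega, q, hq, rfl⟩
      · exact ⟨p, by omega, q, hq, rfl⟩
  rw [hset]
  refine holdsSpan_gather (κ := id) (Set.injOn_id _) hn (by norm_num) (fun i l => ?_)
    (fun k hk => by have := writes_squareEquations hk; omega) (fun i hi hw => ?_) hS₁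
    (fun q hq A' hA' => ?_)
  · rw [hA₁ _ fun hw => by have := writes_squareEquations hw; omega, hA.key]
    rfl
  · rcases hw with hw | hw | hw | hw
    · have := writes_copyRow hw; omega
    · have := writes_mulRows hw; omega
    · have := writes_mulRows hw; omega
    · have := writes_equationRow hw; omega
  · have hT' : Holds A' 3 T := hT.congr fun i hi => by
      have h : ¬ squareEquations.Writes (3 + i) := fun hw => by
        have := writes_squareEquations hw; omega
      rw [hA' _ h, hA₁ _ h]
    have h1 := holds_copyRow (N := N) (I := I) (x := 4)
      (ρ := Function.update (Function.update ρ 4 p) 3 q) (by norm_num) (by norm_num) hT'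
    have h2 := holds_mulRows (N := N) (I := I) (x := 3) (cond := .const 1)
      (ρ := Function.update (Function.update ρ 4 p) 3 q) hn (by norm_num) (by norm_num)
      (by norm_num) (by norm_num) (fun _ => 1) (fun _ _ => rfl) h1 (hT'.exec fun i hi hw => by
        have := writes_copyRow hw; omega)
    have h3 := holds_mulRows (N := N) (I := I) (x := 0) (cond := .const 1)
      (ρ := Function.update (Function.update ρ 4 p) 3 q) hn (by norm_num) (by norm_num)
      (by norm_num) (by norm_num) (fun _ => 1) (fun _ _ => rfl) h2 h2
    refine holds_equationRow ?_
    simpa using h3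

/-- The loops produce finitely many squares. Rows with index at least `n` are the identity, so
indices below `N` already give all of them. -/
theorem spans_equations (hn : n + 2 ≤ N) (hm : m ≤ N) {κ κ' : ℕ → ℕ} {T T' : ℕ → XSOp n}
    (hT : XSOp.Reduced κ T) (h : XSOp.Spans κ' T'
      ((∅ ∪ (fun j => (XSOp.reduce T (padded g j) N).toEquation) '' Set.Iio N) ∪
        {e | ∃ p < N, ∃ q < N, e = ((T p * T q) * (T p * T q)).toEquation})) :
    XSOp.Spans κ' T' (XSOp.toEquation '' XSOp.diagGens g T N) := by
  refine h.of_subset ?_ ?_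
  · rintro _ ⟨_, ⟨j, rfl⟩ | ⟨p, q, rfl⟩, rfl⟩
    · exact .inl (.inr ⟨j, j.2.trans_le hm, by simp [padded]⟩)
    · have key : ∀ p, ∃ p' < N, T p' = T p := by
        intro p
        by_cases hp : p < N
        · exact ⟨p, hp, rfl⟩
        · refine ⟨n, by omega, ?_⟩
          rw [hT.bit_eq_zero (p := n) (dif_neg (lt_irrefl n)),
            hT.bit_eq_zero (p := p) (dif_neg (by omega))]
      obtain ⟨p', hp', ep⟩ := key p
      obtain ⟨q', hq', eq⟩ := key q
      exact .inr ⟨p', hp', q', hq', by rw [ep, eq]⟩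
  · rintro _ ((h | ⟨j, -, rfl⟩) | ⟨p, -, q, -, rfl⟩)
    · exact h.elim
    · by_cases hj : j < m
      · exact .inl ⟨_, .inl ⟨⟨j, hj⟩, rfl⟩, by simp [padded, hj]⟩
      · right
        simp only [padded, dif_neg hj, XSOp.reduce_one (T := T) N,
          XSOp.toEquation_one]
    · exact .inl ⟨_, .inr ⟨p, q, rfl⟩, rfl⟩

end RAM

/-! ### The point of the support, the coupling matrix and the entropy -/

section
variable {n : ℕ} {N : ℕ}

/-- The zero-padded entries of a vector. -/
def Bits.entry (x : Bits n) (l : ℕ) : ℕ := if h : l < n then (x ⟨l, h⟩).val else 0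

/-- The zero-padded entries of a matrix. -/
def matEntry (M : Matrix (Fin n) (Fin n) (ZMod 2)) (p q : ℕ) : ℕ :=
  if h : p < n ∧ q < n then (M ⟨p, h.1⟩ ⟨q, h.2⟩).val else 0

theorem Bits.entry_fin (x : Bits n) (l : Fin n) : x.entry l = (x l).val := by
  simp [Bits.entry]

theorem Bits.entry_of_le (x : Bits n) {l : ℕ} (hl : n ≤ l) : x.entry l = 0 :=
  dif_neg (by omega)

theorem Bits.entry_le (x : Bits n) (l : ℕ) : x.entry l ≤ 1 := by
  unfold Bits.entry
  split_ifs with h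
  · have := (x ⟨l, h⟩).val_lt; omega
  · omega

theorem XSOp.val_bit (g : XSOp n) (l : ℕ) : (g.bit l).val = Bits.entry g.a l := by
  unfold XSOp.bit Bits.entry
  split_ifs <;> rfl

theorem matEntry_fin (M : Matrix (Fin n) (Fin n) (ZMod 2)) (p q : Fin n) :
    matEntry M p q = (M p q).val := by
  simp [matEntry]

theorem matEntry_le (M : Matrix (Fin n) (Fin n) (ZMod 2)) (p q : ℕ) : matEntry M p q ≤ 1 := by
  unfold matEntry
  split_ifs with h
  · have := (M ⟨p, h.1⟩ ⟨q, h.2⟩).val_lt; omega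
  · omega

theorem entry_solution {κ : ℕ → ℕ} {T : ℕ → XSOp n} (hT : XSOp.Reduced κ T) (l : ℕ) :
    Bits.entry (XSOp.solution T) l = (T l).s.val % 2 := by
  unfold Bits.entry XSOp.solution
  split_ifs with h
  · generalize (T l).s = s
    revert s
    decide
  · rw [hT.bit_eq_zero (p := l) (dif_neg h)]
    rfl

/-- The exponent in `crossExp` before its reduction modulo 4. -/
def crossSum (N : ℕ) (g : XSOp n) (x w : Bits n) : ℕ := ∑ l ∈ Finset.range N,
  if w.entry l ≠ 0 then if x.entry l ≠ 0 then 3 * (g.sbit l).val else (g.sbit l).val else 0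

theorem crossSum_eq (hn : n ≤ N) (g : XSOp n) (x w : Bits n) : crossSum N g x w = ∑ l : Fin n,
    if w l = 0 then 0 else if x l = 0 then (g.b l).val else 3 * (g.b l).val := by
  rw [crossSum, RAM.sum_range_eq_sum_fin hn fun l hl => by simp [w.entry_of_le hl]]
  refine Finset.sum_congr rfl fun l _ => ?_
  simp only [Bits.entry_fin, XSOp.sbit_fin, ne_eq, ZMod.val_eq_zero, ite_not]

/-- Each summand is at most `3 * 3`. The bound makes the reduction modulo 4 by counting up to `N`
legitimate. -/
theorem crossSum_le (hn : n ≤ N) (g : XSOp n) (x w : Bits n) : crossSum N g x w ≤ 9 * n := by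
  rw [crossSum_eq hn]
  calc _ ≤ ∑ l : Fin n, 9 := Finset.sum_le_sum fun l _ => by
        have := (g.b l).val_lt
        split_ifs <;> omega
    _ = 9 * n := by simp [mul_comm]

theorem val_crossExp (hn : n ≤ N) (g : XSOp n) (x w : Bits n) :
    (crossExp g x w).val = crossSum N g x w % 4 := by
  rw [← ZMod.val_natCast, crossSum_eq hn, crossExp]
  congr 1
  push_cast
  refine Finset.sum_congr rfl fun l _ => ?_
  split_ifs <;> simp

theorem matEntry_crossMatrix (hn : n ≤ N) {S : Finset (Fin n)} {κ : ℕ → ℕ} {T₁ T₂ : ℕ → XSOp n}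
    (hT : XSOp.Reduced κ T₂) (x : Bits n) (p q : ℕ) :
    matEntry (crossMatrix S T₁ T₂ x) p q = if inA S p ≠ 0 then if inA S q ≠ 0 then 0 else
      crossSum N (T₁ p) x (T₂ q).a % 4 - 1 - (crossSum N (T₁ p) x (T₂ q).a % 4 - 2) else 0 := by
  unfold matEntry
  split_ifs with h hp hq hq hp
  · rw [crossMatrix, Matrix.of_apply, if_neg, ZMod.val_zero]
    have := inA_fin S ⟨q, h.2⟩
    simp only at this
    rw [this] at hq
    intro h'
    simp [h'.2] at hq
  · have h1 := inA_fin S ⟨q, h.2⟩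
    have h2 := inA_fin S ⟨p, h.1⟩
    simp only at h1 h2
    rw [crossMatrix, Matrix.of_apply, if_pos, ZMod.val_natCast, val_crossExp hn]
    · have := Nat.mod_lt (crossSum N (T₁ p) x (T₂ q).a) (show 0 < 4 by norm_num)
      simp only
      omega
    · constructor
      · by_contra h'
        simp [h2, h'] at hp
      · intro h'
        simp [h1, h'] at hq
  · have h2 := inA_fin S ⟨p, h.1⟩
    simp only at h2
    rw [crossMatrix, Matrix.of_apply, if_neg, ZMod.val_zero]
    intro h'
    simp [h2, h'.1] at hp
  · rfl
  · have hp' : inA S p ≠ 0 := by assumption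
    have hpn : p < n := by
      by_contra h'
      exact hp' (RAM.inA_of_le (by omega))
    have : T₂ q = 1 := hT.bit_eq_zero (dif_neg fun h' => h ⟨hpn, h'⟩)
    rw [crossSum_eq hn, this]
    simp
  · rfl

theorem card_pivots (hn : n ≤ N) (S : Finset (Fin n)) (T : ℕ → XSOp n) :
    (∑ l ∈ Finset.range N, if inA S l ≠ 0 then ((T l).bit l).val else 0) =
      (S.filter fun p : Fin n => (T p).a p ≠ 0).card := by
  rw [RAM.sum_range_eq_sum_fin hn fun l hl => by simp [RAM.inA_of_le hl], Finset.card_filter,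
    ← Finset.sum_subset (Finset.subset_univ S) fun l _ hl => by simp [inA_fin, hl]]
  refine Finset.sum_congr rfl fun l hl => ?_
  rw [inA_fin, if_pos hl, XSOp.bit_fin]
  rcases zmod2_cases ((T l).a l) with h | h <;> simp [h, ZMod.val_one]

end

namespace RAM

variable {N : ℕ} {I : ℕ → ℕ} {ρ : ℕ → ℕ} {A : Arrays} {n m : ℕ} {g : Fin m → XSOp n}
  {S : Finset (Fin n)}

/-- Write a point of the support to the array `45` and the coupling matrix to the array `47`. -/
def coupling : Cmd :=
  -- With free variables zero, bit `l` of the solution is the right-hand side of the equation with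
  -- pivot `l`, or `0` if that row is the identity.
  .seq (assignMod 45 2 (.arr 9 1 1)) <|
  .seq (assignMod 46 4 <| .sum 10 <| .ite (.arr 7 1 10)
    (.ite (.arr 45 0 10) (.smul 3 (.arr 5 0 10)) (.arr 5 0 10)) (.const 0)) <|
  .assign 47 <| .ite (.arr 40 0 0) (.ite (.arr 40 1 1) (.const 0)
    (.sub (.sub (.arr 46 0 1) (.const 1)) (.sub (.arr 46 0 1) (.const 2)))) (.const 0)

theorem writes_coupling {k : ℕ} (h : coupling.Writes k) : 45 ≤ k := by
  simp only [coupling, assignMod, modCmd, Cmd.Writes] at h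
  omega

theorem exec_coupling_of_lt {k : ℕ} (hk : k < 45) : coupling.exec N I ρ A k = A k :=
  Cmd.exec_of_not_writes (fun hw => by have := writes_coupling hw; omega) _ _

theorem exec_coupling (hN : 4 ≤ N) (hn : n ≤ N) (hn' : 9 * n ≤ 4 * N) {κ κ' : ℕ → ℕ} {T₁ T₂ T₃ : ℕ → XSOp n}
    (hA : Loaded g S A) (h₁ : Holds A 3 T₁) (h₂ : Holds A 6 T₂) (h₃ : Holds A 9 T₃)
    (hT₂ : XSOp.Reduced κ T₂) (hT₃ : XSOp.Reduced κ' T₃) (i l : ℕ) :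
    coupling.exec N I ρ A 45 i l = Bits.entry (XSOp.solution T₃) l ∧
      coupling.exec N I ρ A 47 i l = matEntry (crossMatrix S T₁ T₂ (XSOp.solution T₃)) i l := by
  have hs : ∀ i l, A 9 i l = (T₃ i).s.val := fun i l => (h₃ i l).1
  have ha : ∀ i l, A 7 i l = Bits.entry (T₂ i).a l := fun i l => by
    rw [← XSOp.val_bit]; exact (h₂ i l).2.1
  have hb : ∀ i l, A 5 i l = ((T₁ i).sbit l).val := fun i l => (h₁ i l).2.2
  have h40 := hA.side
  rw [coupling, exec_seq, exec_assignMod (by norm_num) (fun _ l => (T₃ l).s.val), exec_seq,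
    exec_assignMod (by norm_num)
      (fun p q => crossSum N (T₁ p) (XSOp.solution T₃) (T₂ q).a),
    exec_assign (k := 47) (fun p q => matEntry (crossMatrix S T₁ T₂ (XSOp.solution T₃)) p q)]
  · simp [entry_solution hT₃]
  · intro p q
    rw [matEntry_crossMatrix (N := N) (by omega) hT₂]
    simp [AExp.ev, h40]
  · intro p q
    simp [AExp.ev, crossSum, ha, hb, entry_solution hT₃]
  · intro p q
    have := crossSum_le (N := N) (by omega) (T₁ p) (XSOp.solution T₃) (T₂ q).a
    omega
  · intro p q
    simp [AExp.ev, hs]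
  · intro p q
    have := (T₃ q).s.val_lt
    omega

/-- The contents of the arrays after the common part of both algorithms. -/
structure Prepared (S : Finset (Fin n)) (T₁ T₂ : ℕ → XSOp n) (x : Bits n) (A : Arrays) : Prop where
  side : ∀ i l, A 40 i l = inA S l
  key : ∀ i l, A 43 i l = l
  out : Holds A 3 T₁
  inn : Holds A 6 T₂
  point : ∀ i l, A 45 i l = x.entry l
  matrix : ∀ i l, A 47 i l = matEntry (crossMatrix S T₁ T₂ x) i l
  free : ∀ k, 12 ≤ k → k < 15 → A k = fun _ _ => 0

/-- The common part of both algorithms. -/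
def prepare : Cmd :=
  .seq load <| .seq outForm <| .seq innForm <| .seq reducedEquations <| .seq squareEquations coupling

/-- The stages write to separate arrays apart from shared scratch space, so earlier results persist.
Regularity enters only through `XSOp.ne_zero_solution`, which places the computed point in the
support. -/
theorem exists_prepared (hN : 2 * ((n + 2) * (n + 2)) ≤ N) (hm : m ≤ N) (hI : IsInput I g S) {ψ : QVec n}
    (hG : IsRegularXSGroup (xsGroup g)) (hψ : IsXSStateOf g ψ) :
    ∃ T₁ T₂ x, AdaptedForms S (Submodule.span (ZMod 2) (Set.range fun j => (g j).a)) ψ T₁ T₂ ∧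
      ψ x ≠ 0 ∧ Prepared S T₁ T₂ x (prepare.exec N I ρ fun _ _ _ => 0) := by
  have hn : n + 2 ≤ N := by nlinarith
  have hn8 : 8 * n + 4 ≤ N := by nlinarith
  have hL : Submodule.span (ZMod 2) (Set.range fun j => (g j).a) =
      Submodule.span (ZMod 2) ((fun g : XSOp n => g.a) '' Set.range g) := by
    rw [← Set.range_comp]; rfl
  rw [prepare, exec_seq, exec_seq, exec_seq, exec_seq, exec_seq]
  set A₀ : Arrays := fun _ _ _ => 0
  set A₁ := load.exec N I ρ A₀ with hA₁
  set A₂ := outForm.exec N I ρ A₁ with hA₂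
  set A₃ := innForm.exec N I ρ A₂ with hA₃
  set A₄ := reducedEquations.exec N I ρ A₃ with hA₄
  set A₅ := squareEquations.exec N I ρ A₄ with hA₅
  have w₁ : ∀ k, 3 ≤ k → k < 40 → A₁ k = fun _ _ => 0 := fun k h3 h40 => by
    rw [hA₁, Cmd.exec_of_not_writes fun hw => by have := writes_load hw; omega]
  have w₂ : ∀ k, 6 ≤ k → k < 15 → A₂ k = fun _ _ => 0 := fun k h3 h40 => by
    rw [hA₂, Cmd.exec_of_not_writes fun hw => by have := writes_outForm hw; omega,
      w₁ k (by omega) (by omega)]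
  have w₃ : ∀ k, 9 ≤ k → k < 15 → A₃ k = fun _ _ => 0 := fun k h3 h40 => by
    rw [hA₃, Cmd.exec_of_not_writes fun hw => by have := writes_innForm hw; omega,
      w₂ k (by omega) (by omega)]
  have w₄ : ∀ k, 12 ≤ k → k < 15 → A₄ k = fun _ _ => 0 := fun k h3 h40 => by
    rw [hA₄, Cmd.exec_of_not_writes fun hw => by have := writes_reducedEquations hw; omega,
      w₃ k (by omega) (by omega)]
  have w₅ : ∀ k, 12 ≤ k → k < 15 → A₅ k = fun _ _ => 0 := fun k h3 h40 => by
    rw [hA₅, Cmd.exec_of_not_writes fun hw => by have := writes_squareEquations hw; omega,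
      w₄ k (by omega) (by omega)]
  have l₁ : Loaded g S A₁ := loaded_load hI hm
  have l₂ : Loaded g S A₂ := l₁.exec fun k hw => by have := writes_outForm hw; omega
  have l₃ : Loaded g S A₃ := l₂.exec fun k hw => by have := writes_innForm hw; omega
  have l₄ : Loaded g S A₄ := l₃.exec fun k hw => by have := writes_reducedEquations hw; omega
  have l₅ : Loaded g S A₅ := l₄.exec fun k hw => by have := writes_squareEquations hw; omega
  obtain ⟨T₁, t₁, s₁⟩ := holds_outForm (I := I) (ρ := ρ) hn hm l₁ fun i hi =>
    w₁ _ (by omega) (by omega)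
  obtain ⟨T₂, t₂, s₂⟩ := holds_innForm (I := I) (ρ := ρ) hn hm l₂ fun i hi =>
    w₂ _ (by omega) (by omega)
  have t₁₃ : Holds A₃ 3 T₁ := t₁.exec fun i hi hw => by have := writes_innForm hw; omega
  have t₁₄ : Holds A₄ 3 T₁ := t₁₃.exec fun i hi hw => by have := writes_reducedEquations hw; omega
  have t₁₅ : Holds A₅ 3 T₁ := t₁₄.exec fun i hi hw => by have := writes_squareEquations hw; omega
  have t₂₄ : Holds A₄ 6 T₂ := t₂.exec fun i hi hw => by have := writes_reducedEquations hw; omega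
  have t₂₅ : Holds A₅ 6 T₂ := t₂₄.exec fun i hi hw => by have := writes_squareEquations hw; omega
  obtain ⟨T₃, t₃, s₃⟩ := holds_squareEquations (I := I) (ρ := ρ) hn l₄ t₁₄
    (holds_reducedEquations (I := I) (ρ := ρ) hn l₃ t₁₃ fun i hi => w₃ _ (by omega) (by omega))
  have hx := XSOp.ne_zero_solution hG hψ (show n ≤ N by omega) s₁ (spans_equations hn hm s₁.reduced s₃)
  have hc := exec_coupling (N := N) (I := I) (ρ := ρ) (by omega)
    (by omega) (by omega) l₅ t₁₅ t₂₅ t₃ s₂.reduced s₃.reduced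
  refine ⟨T₁, T₂, XSOp.solution T₃, ⟨s₁.reduced, s₂.reduced, by rw [hL, s₁.span_eq],
    by rw [hL, s₂.span_eq], s₁.of_gen _ (XSOp.stable_fixes ψ) ?_⟩, hx, ?_⟩
  · rintro _ ⟨j, rfl⟩
    exact ((isXSStateOf_iff g ψ).1 hψ).2.1 j
  · clear_value A₁ A₂ A₃ A₄ A₅
    refine ⟨fun i l => ?_, fun i l => ?_, ?_, ?_, fun i l => (hc i l).1, fun i l => (hc i l).2,
      fun k h1 h2 => ?_⟩
    · rw [exec_coupling_of_lt (by omega), l₅.side]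
    · rw [exec_coupling_of_lt (by omega), l₅.key]
    · exact t₁₅.congr fun i hi => exec_coupling_of_lt (by omega)
    · exact t₂₅.congr fun i hi => exec_coupling_of_lt (by omega)
    · rw [exec_coupling_of_lt (by omega), w₅ k h1 h2]

/-- Compute an echelon form of the coupling matrix, and the rank formula for the entropy. -/
def entropy : Cmd :=
  .seq (gather 3 12 43 <| .seq (.assign 15 (.const 0)) <| .seq (.assign 16 (.arr 47 3 1))
    (.assign 17 (.const 0))) <|
  .assign 48 <| .sub (.add (.sum 10 <| .ite (.arr 40 0 10) (.arr 7 10 10) (.const 0))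
    (.sum 10 <| .arr 13 10 10)) (.sum 10 <| .ite (.arr 40 0 10) (.arr 4 10 10) (.const 0))

/-- The rows of the coupling matrix pass through the same elimination as operators with trivial
phase and `S`-part; the number of pivots is then the rank. -/
theorem exec_entropy (hn : n + 2 ≤ N) {T₁ T₂ : ℕ → XSOp n} {x : Bits n} (hA : Prepared S T₁ T₂ x A) :
    ∃ T₄, XSOp.Spans id T₄ (Set.range (rowOp (crossMatrix S T₁ T₂ x))) ∧ ∀ i j,
      entropy.exec N I ρ A 48 i j = (S.filter fun p : Fin n => (T₂ p).a p ≠ 0).card +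
        (Finset.univ.filter fun p : Fin n => (T₄ p).a p ≠ 0).card -
        (S.filter fun p : Fin n => (T₁ p).a p ≠ 0).card := by
  set M := crossMatrix S T₁ T₂ x with hM
  set c : Cmd := .seq (.assign 15 (.const 0)) <| .seq (.assign 16 (.arr 47 3 1))
    (.assign 17 (.const 0)) with hc
  have hwc : ∀ k, c.Writes k → 15 ≤ k ∧ k ≤ 17 := by
    intro k hk
    simp only [hc, Cmd.Writes] at hk
    omega
  have hw : ∀ k, (gather 3 12 43 c).Writes k → (12 ≤ k ∧ k ≤ 17) ∨ (30 ≤ k ∧ k ≤ 34) := by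
    intro k hk
    rcases writes_gather hk with h | h
    · have := hwc _ h; omega
    · omega
  obtain ⟨T₄, h4, s4⟩ := holdsSpan_gather (I := I) (ρ := ρ) (x := 3) (κ := id) (K := 12) (key := 43)
    (G := padded (rowOp M)) (c := c) (Set.injOn_id _) hn (by norm_num) hA.key
    (fun k hk => by have := hw _ hk; omega)
    (fun i hi hk => by have := hwc _ hk; omega) (HoldsSpan.empty fun i hi => hA.free _ (by omega) (by omega))
    (fun p hp A' hA' => by
      have h47 : ∀ i l, A' 47 i l = matEntry M i l := fun i l => by
        rw [hA' _ fun h => by have := hw _ h; omega, hA.matrix]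
      have h0 : (padded (rowOp M) p).s.val = 0 := by
        unfold padded; split_ifs <;> rfl
      have h1 : ∀ l, ((padded (rowOp M) p).bit l).val = matEntry M p l := by
        intro l
        unfold padded matEntry
        by_cases hp : p < n <;> by_cases hl : l < n <;> simp [hp, hl, XSOp.bit, rowOp]
      have h2 : ∀ l, ((padded (rowOp M) p).sbit l).val = 0 := by
        intro l
        unfold padded
        by_cases hp : p < n <;> by_cases hl : l < n <;> simp [hp, hl, XSOp.sbit, rowOp]
      rw [hc, exec_seq, exec_assign (k := 15) (fun _ _ => (padded (rowOp M) p).s.val), exec_seq,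
        exec_assign (k := 16) (fun _ l => ((padded (rowOp M) p).bit l).val),
        exec_assign (k := 17) (fun _ l => ((padded (rowOp M) p).sbit l).val)]
      · exact holds_update fun i l => ⟨rfl, rfl, rfl⟩
      · intro i l
        simp [AExp.ev, h2]
      · intro i l
        simp [AExp.ev, h1, h47]
      · intro i l
        simp [AExp.ev, h0])
  refine ⟨T₄, spans_of_padded (by omega) s4, fun i j => ?_⟩
  set B := (gather 3 12 43 c).exec N I ρ A with hB
  have h40 : ∀ i l, B 40 i l = inA S l := fun i l => by
    rw [hB, Cmd.exec_of_not_writes fun h => by have := hw _ h; omega, hA.side]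
  have h7 : ∀ i l, B 7 i l = ((T₂ i).bit l).val := fun i l => by
    rw [hB, Cmd.exec_of_not_writes fun h => by have := hw _ h; omega]
    exact (hA.inn i l).2.1
  have hb4 : ∀ i l, B 4 i l = ((T₁ i).bit l).val := fun i l => by
    rw [hB, Cmd.exec_of_not_writes fun h => by have := hw _ h; omega]
    exact (hA.out i l).2.1
  have h13 : ∀ i l, B 13 i l = ((T₄ i).bit l).val := fun i l => (h4 i l).2.1
  rw [← card_pivots (N := N) (by omega), ← card_pivots (N := N) (by omega),
    ← card_pivots (N := N) (by omega), entropy, exec_seq, ← hc, ← hB]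
  have huniv : ∀ l, (if inA (Finset.univ : Finset (Fin n)) l ≠ 0 then ((T₄ l).bit l).val else 0) =
      ((T₄ l).bit l).val := by
    intro l
    by_cases hl : l < n
    · rw [if_pos]
      have := inA_fin (Finset.univ : Finset (Fin n)) ⟨l, hl⟩
      simp only [Finset.mem_univ, if_true] at this
      omega
    · rw [XSOp.bit, dif_neg hl]
      simp
  simp only [huniv]
  simp [Cmd.exec, AExp.ev, h40, h7, hb4, h13]

end RAM

/-! ### The description of the Pauli stabilizer state -/

section
variable {n N : ℕ}

theorem val_natCast_sum_mod {ι : Type*} (s : Finset ι) (f : ι → ℕ) :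
    (∑ i ∈ s, (f i : ZMod 2)).val = (∑ i ∈ s, f i) % 2 := by
  rw [← ZMod.val_natCast, Nat.cast_sum]

theorem val_mulVec_add_transpose (hn : n ≤ N) (M : Matrix (Fin n) (Fin n) (ZMod 2)) (v : Bits n)
    (l : Fin n) : ((M + M.transpose).mulVec v l).val = (∑ k ∈ Finset.range N,
      if v.entry k ≠ 0 then matEntry M l k + matEntry M k l else 0) % 2 := by
  rw [RAM.sum_range_eq_sum_fin (M := ℕ) hn fun k hk => by simp [v.entry_of_le hk], ← val_natCast_sum_mod]
  congr 1
  simp only [Matrix.mulVec, dotProduct]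
  refine Finset.sum_congr rfl fun k _ => ?_
  simp only [Bits.entry_fin, matEntry_fin]
  rcases zmod2_cases (v k) with h | h <;> simp [h, ZMod.val_one]

theorem val_bil (hn : n ≤ N) (M : Matrix (Fin n) (Fin n) (ZMod 2)) (v : Bits n) :
    (bil M v v).val = (∑ k ∈ Finset.range N, if v.entry k ≠ 0 then
      ∑ l ∈ Finset.range N, if v.entry l ≠ 0 then matEntry M k l else 0 else 0) % 2 := by
  rw [RAM.sum_range_eq_sum_fin (M := ℕ) hn fun k hk => by simp [v.entry_of_le hk], ← val_natCast_sum_mod,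
    bil_eq_sum]
  congr 1
  refine Finset.sum_congr rfl fun k _ => ?_
  rw [RAM.sum_range_eq_sum_fin (M := ℕ) hn fun k hk => by simp [v.entry_of_le hk]]
  simp only [Bits.entry_fin, matEntry_fin]
  rcases zmod2_cases (v k) with h | h
  · simp [h]
  · simp only [h, ZMod.val_one, ne_eq, one_ne_zero, not_false_eq_true, if_true, Nat.cast_sum,
      one_mul]
    refine Finset.sum_congr rfl fun l _ => ?_
    rcases zmod2_cases (v l) with h | h <;> simp [h, ZMod.val_one]

theorem val_dotProduct (hn : n ≤ N) (c x : Bits n) : (c ⬝ᵥ x).val =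
    (∑ l ∈ Finset.range N, if x.entry l ≠ 0 then c.entry l else 0) % 2 := by
  rw [RAM.sum_range_eq_sum_fin (M := ℕ) hn fun k hk => by simp [x.entry_of_le hk], ← val_natCast_sum_mod,
    dotProduct]
  congr 1
  refine Finset.sum_congr rfl fun k _ => ?_
  simp only [Bits.entry_fin]
  rcases zmod2_cases (x k) with h | h <;> simp [h, ZMod.val_one]

theorem sum_ite_le_mul {f : ℕ → ℕ} {p : ℕ → Prop} [DecidablePred p] {b : ℕ} (hn : n ≤ N)
    (hp : ∀ l, n ≤ l → ¬ p l) (hf : ∀ l, f l ≤ b) :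
    (∑ l ∈ Finset.range N, if p l then f l else 0) ≤ n * b := by
  rw [RAM.sum_range_eq_sum_fin (M := ℕ) hn fun l hl => by simp [hp l hl]]
  calc _ ≤ ∑ l : Fin n, b := Finset.sum_le_sum fun l _ => by
        have := hf l
        split_ifs <;> omega
    _ = n * b := by simp

theorem val_two_mul_cast (b : ZMod 2) : (2 * (b.val : ZMod 4)).val = 2 * b.val := by
  revert b; decide

theorem getD_encodePaulis (p : Fin n → PauliOp n) (j : Fin n) {r : ℕ} (hr : r < 2 * n + 1) :
    (encodePaulis p).getD (j * (2 * n + 1) + r) 0 = (p j).encode.getD r 0 :=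
  getD_flatten_ofFn _ (fun j => (p j).length_encode) j hr

theorem length_encodePaulis (p : Fin n → PauliOp n) : (encodePaulis p).length = n * (2 * n + 1) :=
  length_flatten_ofFn _ fun j => (p j).length_encode

end

namespace RAM

variable {N : ℕ} {I : ℕ → ℕ} {ρ : ℕ → ℕ} {A : Arrays} {n m : ℕ} {S : Finset (Fin n)}

/-- Whether two expressions have the same value. -/
def AExp.eq (e₁ e₂ : AExp) : AExp := .ite (.add (.sub e₁ e₂) (.sub e₂ e₁)) (.const 0) (.const 1)

@[simp] theorem AExp.ev_eq (e₁ e₂ : AExp) : (AExp.eq e₁ e₂).ev N I ρ A =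
    if e₁.ev N I ρ A = e₂.ev N I ρ A then 1 else 0 := by
  change (if e₁.ev N I ρ A - e₂.ev N I ρ A + (e₂.ev N I ρ A - e₁.ev N I ρ A) ≠ 0 then 0 else 1) = _
  by_cases h : e₁.ev N I ρ A = e₂.ev N I ρ A
  · rw [if_pos h, h, if_neg (by omega)]
  · rw [if_neg h, if_pos (by omega)]

/-- Write the exponents of the Pauli operators to the arrays `54`, `55`, `56`. -/
def pauliExponents : Cmd :=
  .seq (assignMod 50 2 <| .sum 10 <|
    .ite (.arr 4 0 10) (.add (.arr 47 1 10) (.arr 47 10 1)) (.const 0)) <|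
  .seq (assignMod 51 2 <| .add (.eq (.var 1) (.var 0)) (.arr 4 1 0)) <|
  .seq (assignMod 52 2 <| .sum 10 <| .ite (.arr 4 0 10)
    (.sum 11 <| .ite (.arr 4 0 11) (.arr 47 10 11) (.const 0)) (.const 0)) <|
  .seq (assignMod 53 2 <| .sum 10 <| .ite (.arr 45 0 10) (.arr 51 0 10) (.const 0)) <|
  .seq (.assign 54 <| .smul 2 <| .ite (.arr 4 0 0) (.arr 52 0 1) (.arr 53 0 1)) <|
  .seq (.assign 55 <| .ite (.arr 4 0 0) (.arr 4 0 1) (.const 0)) <|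
  .assign 56 <| .ite (.arr 4 0 0) (.arr 50 0 1) (.arr 51 0 1)

theorem exec_pauliExponents (hn : 1 ≤ N) (hN : n * n ≤ N) {κ : ℕ → ℕ} {T₁ T₂ : ℕ → XSOp n} {x : Bits n}
    (hA : Prepared S T₁ T₂ x A) (hT : XSOp.Reduced κ T₁) (i : Fin n) :
    (∀ l, pauliExponents.exec N I ρ A 54 i l =
      (quadPauli T₁ x (crossMatrix S T₁ T₂ x) i).s.val) ∧
    (∀ l : Fin n, pauliExponents.exec N I ρ A 55 i l =
      ((quadPauli T₁ x (crossMatrix S T₁ T₂ x) i).a l).val) ∧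
    ∀ l : Fin n, pauliExponents.exec N I ρ A 56 i l =
      ((quadPauli T₁ x (crossMatrix S T₁ T₂ x) i).b l).val := by
  set M := crossMatrix S T₁ T₂ x with hM
  have hnN : n ≤ N := by nlinarith
  have h4 : ∀ i l, A 4 i l = Bits.entry (T₁ i).a l := fun i l => by
    rw [← XSOp.val_bit]; exact (hA.out i l).2.1
  have h47 := hA.matrix
  have h45 := hA.point
  rw [← hM] at h47
  let q : ℕ → ℕ → ℕ := fun i l => ∑ k ∈ Finset.range N,
      if Bits.entry (T₁ i).a k ≠ 0 then matEntry M l k + matEntry M k l else 0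
  let c : ℕ → ℕ → ℕ := fun i l => (if l = i then 1 else 0) + Bits.entry (T₁ l).a i
  let u : ℕ → ℕ := fun i => ∑ k ∈ Finset.range N, if Bits.entry (T₁ i).a k ≠ 0 then
      ∑ l ∈ Finset.range N, if Bits.entry (T₁ i).a l ≠ 0 then matEntry M k l else 0 else 0
  let w : ℕ → ℕ := fun i => ∑ l ∈ Finset.range N, if x.entry l ≠ 0 then c i l % 2 else 0
  have key : pauliExponents.exec N I ρ A = Function.update (Function.update (Function.update
      (Function.update (Function.update (Function.update (Function.update A 50 fun i l => q i l % 2)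
      51 fun i l => c i l % 2) 52 fun i _ => u i % 2) 53 fun i _ => w i % 2)
      54 fun i _ => 2 * if Bits.entry (T₁ i).a i ≠ 0 then u i % 2 else w i % 2)
      55 fun i l => if Bits.entry (T₁ i).a i ≠ 0 then Bits.entry (T₁ i).a l else 0)
      56 fun i l => if Bits.entry (T₁ i).a i ≠ 0 then q i l % 2 else c i l % 2 := by
    rw [pauliExponents, exec_seq, exec_assignMod (by norm_num) q, exec_seq,
      exec_assignMod (by norm_num) c, exec_seq, exec_assignMod (by norm_num) (fun i _ => u i),
      exec_seq, exec_assignMod (by norm_num) (fun i _ => w i), exec_seq,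
      exec_assign (k := 54) (fun i _ => 2 * if Bits.entry (T₁ i).a i ≠ 0 then u i % 2 else w i % 2),
      exec_seq, exec_assign (k := 55)
        (fun i l => if Bits.entry (T₁ i).a i ≠ 0 then Bits.entry (T₁ i).a l else 0),
      exec_assign (k := 56) (fun i l => if Bits.entry (T₁ i).a i ≠ 0 then q i l % 2 else c i l % 2)]
    · intro i l
      simp [AExp.ev, h4]
    · intro i l
      simp [AExp.ev, h4]
    · intro i l
      simp [AExp.ev, h4]
    · intro i l
      simp [AExp.ev, h45, w]
    · intro i l
      have := sum_ite_le_mul (f := fun l => c i l % 2) (p := fun l => x.entry l ≠ 0) (b := 1) hnN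
        (fun l hl => by simp [x.entry_of_le hl]) (fun l => by omega)
      simp only [w]
      omega
    · intro i l
      simp [AExp.ev, h4, h47, u]
    · intro i l
      -- Before reduction modulo 2 the quadratic form is a sum of up to `n²` ones, which `n * n ≤ N`
      -- admits.
      have h1 : ∀ k, (∑ l ∈ Finset.range N, if Bits.entry (T₁ i).a l ≠ 0 then matEntry M k l else 0) ≤
          n * 1 := fun k => sum_ite_le_mul hnN (fun l hl => by simp [Bits.entry_of_le _ hl])
        (matEntry_le M k)
      have := sum_ite_le_mul (p := fun k => Bits.entry (T₁ i).a k ≠ 0) hnN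
        (fun l hl => by simp [Bits.entry_of_le _ hl]) h1
      simp only [u]
      rw [mul_one] at this
      omega
    · intro i l
      simp [AExp.ev, h4, c]
    · intro i l
      have := Bits.entry_le (T₁ l).a i
      simp only [c]
      split_ifs <;> omega
    · intro i l
      simp [AExp.ev, h4, h47, q]
    · intro i l
      have := sum_ite_le_mul (p := fun k => Bits.entry (T₁ i).a k ≠ 0) (b := 2)
        (f := fun k => matEntry M l k + matEntry M k l) hnN
        (fun l hl => by simp [Bits.entry_of_le _ hl]) (fun k => by
          have := matEntry_le M l k; have := matEntry_le M k l; omega)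
      simp only [q]
      omega
  have hcond : Bits.entry (T₁ i).a i ≠ 0 ↔ (T₁ i).a i ≠ 0 := by
    rw [Bits.entry_fin, ne_eq, ZMod.val_eq_zero]
  have hc : ∀ l : ℕ, c i l % 2 =
      Bits.entry (fun l : Fin n => (if l = i then 1 else 0) + (T₁ l).a i) l := by
    intro l
    by_cases hl : l < n
    · rw [Bits.entry, dif_pos hl, ZMod.val_add]
      simp only [c, Bits.entry_fin]
      congr 2
      by_cases h : l = i
      · rw [if_pos h, if_pos (Fin.ext h)]; rfl
      · rw [if_neg h, if_neg fun h' => h (congrArg Fin.val h')]; rfl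
    · have : T₁ l = 1 := hT.bit_eq_zero (dif_neg hl)
      have h' : l ≠ i := by have := i.2; omega
      rw [Bits.entry_of_le _ (by omega)]
      simp [c, this, h', Bits.entry]
  rw [key]
  by_cases h : (T₁ i).a i ≠ 0
  · have h' := hcond.2 h
    rw [quadPauli, if_pos h]
    refine ⟨fun l => ?_, fun l => ?_, fun l => ?_⟩
    · change _ = (2 * ((bil M (T₁ i).a (T₁ i).a).val : ZMod 4)).val
      rw [val_two_mul_cast, val_bil hnN]
      simp [u, h']
    · simp [h, Bits.entry_fin]
    · simp only [val_mulVec_add_transpose hnN]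
      simp [h', q]
  · have h' : ¬ Bits.entry (T₁ i).a i ≠ 0 := fun h'' => h (hcond.1 h'')
    rw [quadPauli, if_neg h]
    rw [not_not] at h'
    refine ⟨fun l => ?_, fun l => ?_, fun l => ?_⟩
    · change _ = (2 * (((fun l : Fin n => (if l = i then 1 else 0) + (T₁ l).a i) ⬝ᵥ x).val :
        ZMod 4)).val
      rw [val_two_mul_cast, val_dotProduct hnN]
      simp only [← hc]
      simp [h', w]
    · simp [h']
    · rw [← Bits.entry_fin, ← hc]
      simp [h']

/-- Write the encoding of the Pauli operators to the first row of the array `59`. -/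
def pauliOutput : Cmd :=
  .seq (.assign 57 <| .sum 10 <| .ite (.sub (.var 0) (.var 10))
    (.add (.smul 2 (.inp (.const 0))) (.const 1)) (.const 0)) <|
  .seq (.assign 58 <| .add (.ite (.eq (.var 1) (.const 0)) (.arr 54 0 0) (.const 0)) <| .sum 10 <|
    .ite (.sub (.inp (.const 0)) (.var 10)) (.add
      (.ite (.eq (.var 1) (.add (.const 1) (.var 10))) (.arr 55 0 10) (.const 0))
      (.ite (.eq (.var 1) (.add (.add (.const 1) (.inp (.const 0))) (.var 10))) (.arr 56 0 10)
        (.const 0))) (.const 0)) <|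
  .assign 59 <| .sum 10 <| .ite (.sub (.inp (.const 0)) (.var 10)) (.sum 11 <|
    .ite (.sub (.add (.smul 2 (.inp (.const 0))) (.const 1)) (.var 11))
      (.ite (.eq (.add (.arr 57 10 0) (.var 11)) (.var 1)) (.arr 58 10 11) (.const 0))
      (.const 0)) (.const 0)

/-- Position `t` is `j * W + r` for exactly one pair with `r < W`. The double sum with equality
tests selects this pair, so division occurs only in the proof. -/
theorem exec_pauliOutput (hI : I 0 = n) (hN : 2 * n + 1 ≤ N) {p : Fin n → PauliOp n}
    (hs : ∀ i : Fin n, ∀ l, A 54 i l = (p i).s.val) (ha : ∀ i l : Fin n, A 55 i l = ((p i).a l).val)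
    (hb : ∀ i l : Fin n, A 56 i l = ((p i).b l).val) (i : ℕ) {t : ℕ} (ht : t < n * (2 * n + 1)) :
    pauliOutput.exec N I ρ A 59 i t = (encodePaulis p).getD t 0 := by
  set W := 2 * n + 1 with hW
  have off : ∀ i : ℕ, i < n → (∑ y ∈ Finset.range N, if i - y ≠ 0 then 2 * n + 1 else 0) = i * W :=
    fun i hi => sum_ite_sub i _ (by omega)
  let B : ℕ → ℕ → ℕ := fun i r => (if r = 0 then A 54 i i else 0) + ∑ l ∈ Finset.range N,
    if n - l ≠ 0 then (if r = 1 + l then A 55 i l else 0) + (if r = 1 + n + l then A 56 i l else 0)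
    else 0
  have hB : ∀ i : Fin n, ∀ r < W, B i r = (p i).encode.getD r 0 := by
    intro i r hr
    have hl : ∀ l : Fin n, n - (l : ℕ) ≠ 0 := fun l => by have := l.2; omega
    simp only [B]
    rw [sum_range_eq_sum_fin (n := n) (by omega) fun l hl => by rw [if_neg (by omega)]]
    simp only [if_pos (hl _)]
    rcases Nat.eq_zero_or_pos r with rfl | h0
    · rw [if_pos rfl, hs, Finset.sum_eq_zero, add_zero]
      · rfl
      · intro l _
        rw [if_neg (by omega), if_neg (by omega), add_zero]
    · rw [if_neg (by omega), zero_add]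
      by_cases hrn : r ≤ n
      · obtain ⟨l, rfl⟩ : ∃ l : Fin n, r = 1 + l := ⟨⟨r - 1, by omega⟩, by simp; omega⟩
        rw [PauliOp.getD_encode_a, Finset.sum_eq_single l]
        · rw [if_pos rfl, if_neg (by omega), ha, add_zero]
        · intro l' _ hl'
          have : (l' : ℕ) ≠ l := fun h => hl' (Fin.ext h)
          rw [if_neg (by omega), if_neg (by omega), add_zero]
        · simp
      · obtain ⟨l, rfl⟩ : ∃ l : Fin n, r = 1 + n + l := ⟨⟨r - 1 - n, by omega⟩, by simp; omega⟩
        rw [PauliOp.getD_encode_b, Finset.sum_eq_single l]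
        · rw [if_neg (by omega), if_pos rfl, hb, zero_add]
        · intro l' _ hl'
          have : (l' : ℕ) ≠ l := fun h => hl' (Fin.ext h)
          rw [if_neg (by have := l'.2; omega), if_neg (by omega), add_zero]
        · simp
  have key : pauliOutput.exec N I ρ A 59 i t = ∑ j ∈ Finset.range N, if n - j ≠ 0 then
      ∑ r ∈ Finset.range N, if W - r ≠ 0 then
        if (∑ y ∈ Finset.range N, if j - y ≠ 0 then 2 * n + 1 else 0) + r = t then B j r else 0
      else 0 else 0 := by
    rw [pauliOutput, exec_seq, exec_assign (k := 57)
        (fun i _ => ∑ y ∈ Finset.range N, if i - y ≠ 0 then 2 * n + 1 else 0), exec_seq,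
      exec_assign (k := 58) B]
    · simp [Cmd.exec, AExp.ev, hI, hW]
    · intro i l
      simp [AExp.ev, hI, B]
    · intro i l
      simp [AExp.ev, hI]
  rw [key, sum_range_eq_sum_fin (n := n) (by omega) fun l hl => by rw [if_neg (by omega)]]
  have hdiv : t / W < n := Nat.div_lt_of_lt_mul (by rwa [Nat.mul_comm])
  have hmod : t % W < W := Nat.mod_lt _ (by omega)
  have hdm : t / W * W + t % W = t := Nat.div_add_mod' t W
  rw [Finset.sum_eq_single ⟨t / W, hdiv⟩, if_pos (by simp only; omega),
    Finset.sum_eq_single (t % W), if_pos (by omega), off _ hdiv, if_pos hdm]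
  · have := hB ⟨t / W, hdiv⟩ _ hmod
    rw [this, ← getD_encodePaulis p ⟨t / W, hdiv⟩ hmod]
    simp only [← hW, hdm]
  · intro r _ hr
    rw [off _ hdiv, if_neg (c := _ = t) (by omega)]
    simp
  · intro h
    simp at h
    omega
  · intro j _ hj
    rw [if_pos (by omega)]
    refine Finset.sum_eq_zero fun r _ => ?_
    by_cases hr : r < W
    · rw [if_pos (by omega), off _ j.2, if_neg]
      intro h
      refine hj (Fin.ext ?_)
      change (j : ℕ) = t / W
      rw [← h, Nat.mul_comm, Nat.mul_add_div (by omega), Nat.div_eq_of_lt hr, add_zero]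
    · rw [if_neg (by omega)]
  · simp

end RAM

/-! ### The algorithms -/

/-- One bound quadratic in `n + m` covers the input, the output and all sums that are reduced modulo
2, 4 or 8. -/
theorem input_length_le (n m : ℕ) : 2 + (n + m * (2 * n + 1)) ≤ RAM.loopBound (n + m) := by
  unfold RAM.loopBound
  nlinarith [Nat.zero_le (n * n), Nat.zero_le (m * m), Nat.zero_le (n * m)]

theorem output_length_le (n m : ℕ) : n * (2 * n + 1) ≤ RAM.loopBound (n + m) := by
  unfold RAM.loopBound
  nlinarith [Nat.zero_le (n * n), Nat.zero_le (m * m), Nat.zero_le (n * m)]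

theorem exists_pauli_program : ∃ (c : RAM.Program) (T : Polynomial ℕ),
    ∀ (n m : ℕ) (g : Fin m → XSOp n) (A : Finset (Fin n)) (ψ : QVec n),
      IsRegularXSGroup (xsGroup g) → IsXSStateOf g ψ →
      ∃ p : Fin n → PauliOp n,
        RAM.OutputsWithin c (encodeInput g A) (encodePaulis p) (T.eval (n + m)) ∧
        ∃ φ : QVec n, IsPauliStateOf p φ ∧ DiagonallyEquivalent A ψ φ := by
  obtain ⟨c, T, hc⟩ := RAM.exists_program
    (.seq RAM.prepare (.seq RAM.pauliExponents RAM.pauliOutput)) 59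
  refine ⟨c, T, fun n m g A ψ hG hψ => ?_⟩
  have hI := isInput_encodeInput g A
  have hN : 2 * ((n + 2) * (n + 2)) ≤ RAM.loopBound (n + m) := by
    unfold RAM.loopBound
    nlinarith [Nat.zero_le (m * m), Nat.zero_le (n * m)]
  have hm : m ≤ RAM.loopBound (n + m) := by
    have := input_length_le n m
    nlinarith [Nat.zero_le (m * n)]
  obtain ⟨T₁, T₂, x, hT, hx, hA⟩ := RAM.exists_prepared (ρ := fun _ => 0) hN hm hI hG hψ
  have S := cosetState_of_isXSStateOf hψ hx
  have hκ : (‖ψ x‖ : ℂ) ≠ 0 := by simpa using hx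
  have hP := isPauliStateOf_quadPauli hT.reduced₁ x (crossMatrix A T₁ T₂ x) hκ
  rw [hT.span₁] at hP
  refine ⟨_, hc _ _ (n + m) rfl ?_ ?_ ?_, _, hP,
    S.diagonallyEquivalent (isCoupling_crossMatrix _ _ _ _) (hT.couples S)⟩
  · rw [length_encodeInput]
    exact input_length_le n m
  · rw [length_encodePaulis]
    exact output_length_le n m
  · intro t ht
    rw [← List.getD_eq_getElem _ 0 ht]
    rw [length_encodePaulis] at ht
    have he := RAM.exec_pauliExponents (I := fun i => (encodeInput g A).getD i 0) (ρ := fun _ => 0)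
      (show 1 ≤ RAM.loopBound (n + m) by nlinarith) (by nlinarith) hA hT.reduced₁
    exact RAM.exec_pauliOutput hI.zero (by nlinarith) (fun i => (he i).1) (fun i => (he i).2.1)
      (fun i => (he i).2.2) 0 ht

theorem exists_entropy_program : ∃ (c : RAM.Program) (T : Polynomial ℕ),
    ∀ (n m : ℕ) (g : Fin m → XSOp n) (A : Finset (Fin n)) (ψ : QVec n),
      IsRegularXSGroup (xsGroup g) → IsXSStateOf g ψ →
      ∃ k : ℕ, RAM.OutputsWithin c (encodeInput g A) [k] (T.eval (n + m)) ∧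
        entanglementEntropy A ψ = k := by
  obtain ⟨c, T, hc⟩ := RAM.exists_program (.seq RAM.prepare RAM.entropy) 48
  refine ⟨c, T, fun n m g A ψ hG hψ => ?_⟩
  have hI := isInput_encodeInput g A
  have hN : 2 * ((n + 2) * (n + 2)) ≤ RAM.loopBound (n + m) := by
    unfold RAM.loopBound
    nlinarith [Nat.zero_le (m * m), Nat.zero_le (n * m)]
  have hm : m ≤ RAM.loopBound (n + m) := by
    have := input_length_le n m
    nlinarith [Nat.zero_le (m * n)]
  obtain ⟨T₁, T₂, x, hT, hx, hA⟩ := RAM.exists_prepared (ρ := fun _ => 0) hN hm hI hG hψ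
  have S := cosetState_of_isXSStateOf hψ hx
  obtain ⟨T₄, h₄, he⟩ := RAM.exec_entropy (I := fun i => (encodeInput g A).getD i 0)
    (ρ := fun _ => 0) (show n + 2 ≤ RAM.loopBound (n + m) by nlinarith) hA
  refine ⟨_, hc _ _ (n + m) rfl ?_ ?_ ?_, (S.entanglementEntropy_eq (hT.couples S)).trans
    (hT.log_flatValue x h₄)⟩
  · rw [length_encodeInput]
    exact input_length_le n m
  · have := input_length_le n m
    simp only [List.length_singleton]
    omega
  · intro t ht
    obtain rfl : t = 0 := by simpa using ht
    exact he 0 0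

/-- Bipartite entanglement of XS-stabilizer states. -/
theorem mainTheorem1 :
    -- bipartite reduction of every XS-stabilizer state to a Pauli stabilizer state
    (∀ (n : ℕ) (ψ : QVec n) (A : Finset (Fin n)), IsXSStabilizerState ψ →
      ∃ φ : QVec n, IsPauliStabilizerState φ ∧ DiagonallyEquivalent A ψ φ) ∧
    -- a description of such a Pauli stabilizer state is computed in polynomial time
    (∃ (c : RAM.Program) (T : Polynomial ℕ),
      ∀ (n m : ℕ) (g : Fin m → XSOp n) (A : Finset (Fin n)) (ψ : QVec n),
        IsRegularXSGroup (xsGroup g) → IsXSStateOf g ψ →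
        ∃ p : Fin n → PauliOp n,
          RAM.OutputsWithin c (encodeInput g A) (encodePaulis p) (T.eval (n + m)) ∧
          ∃ φ : QVec n, IsPauliStateOf p φ ∧ DiagonallyEquivalent A ψ φ) ∧
    -- the entanglement entropy, an integer number of bits, is computed in polynomial time
    (∃ (c : RAM.Program) (T : Polynomial ℕ),
      ∀ (n m : ℕ) (g : Fin m → XSOp n) (A : Finset (Fin n)) (ψ : QVec n),
        IsRegularXSGroup (xsGroup g) → IsXSStateOf g ψ →
        ∃ k : ℕ,
          RAM.OutputsWithin c (encodeInput g A) [k] (T.eval (n + m)) ∧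
          entanglementEntropy A ψ = k) ∧
    -- every reduced density operator is proportional to a projector
    (∀ (n : ℕ) (ψ : QVec n) (A : Finset (Fin n)), IsXSStabilizerState ψ →
      (∃ (r : ℝ) (P : Matrix (BitsIn A) (BitsIn A) ℂ), 0 < r ∧ P.IsHermitian ∧ P * P = P ∧
        reducedDensity A ψ = (r : ℂ) • P) ∧
      ∀ k l, (reducedDensity_isHermitian A ψ).eigenvalues k ≠ 0 →
        (reducedDensity_isHermitian A ψ).eigenvalues l ≠ 0 →
        (reducedDensity_isHermitian A ψ).eigenvalues k =
          (reducedDensity_isHermitian A ψ).eigenvalues l) := by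
  exact ⟨fun n ψ A => exists_pauli_diagonallyEquivalent A, exists_pauli_program,
    exists_entropy_program, fun n ψ A => flat_of_isXSStabilizerState A⟩
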